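/- Let $\Omega=[0,2\pi]\times[-\tfrac12,\tfrac12]$ with coordinates $(\theta,z)$, and let $H^k_{\mathrm{per}}(\Omega)$ be the space of $\Omega$-periodic real functions in $H^k_{\mathrm{loc}}(\mathbb R^2)$, restricted to $\Omega$. For $\phi=(\phi_\rho,\phi_\theta,\phi_z):\Omega\to\mathbb R^3$ (cylindrical components) and $h>0$ define the von Kármán–Donnell strain and energy $$\epsilon=e(\phi_\theta,\phi_z)+\tfrac12 D\phi_\rho\otimes D\phi_\rho+\phi_\rho\, e_\theta\otimes e_\theta,\qquad E_h(\phi)=\int_\Omega|\epsilon|^2+h^2|D^2\phi_\rho|^2\,d\theta\,dz,$$ where $e_{ij}=\tfrac12(\partial_i\phi_j+\partial_j\phi_i)$ for $i,j\in\{\theta,z\}$, $|\cdot|$ is the Euclidean (Frobenius) norm and derivatives are weak. For $\lambda\in(0,1)$, $\varrho\in(0,\infty)$, $m\in(0,\infty]$ let $A_{\lambda,\varrho,m}$ be the set of all $\phi$ such that $\phi_\rho\in H^2_{\mathrm{per}}(\Omega)$, $\phi_\theta\in H^1_{\mathrm{per}}(\Omega)$, $\phi_z+\lambda z\in H^1_{\mathrm{per}}(\Omega)$,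 $\phi_\rho\ge\varrho-1$ a.e. on $\Omega$, and $\|\partial_i\phi_j\|_{L^\infty(\Omega)}\le m$ for all $i\in\{\theta,z\}$, $j\in\{\rho,\theta,z\}$. Let $\mathcal E_b(\varrho)=|\Omega|(\varrho-1)^2$. **Theorem 1.1.** (i) For every $m\in[2,\infty)$ there are constants $c,C>0$, depending only on $m$, such that for all $h,\lambda\in(0,\tfrac12]$ and $\varrho\in[1,\infty)$ with $\varrho-1\ge\min\{\lambda^{1/2}h^{1/4},m^{1/2}h^{1/2}\}$ the minimum of $E_h$ over $A_{\lambda,\varrho,m}$ is attained and $$c\,S\le\min_{A_{\lambda,\varrho,m}}E_h-\mathcal E_b(\varrho)\le C\,S,\qquad S=\min\Big\{\lambda^2,\max\big\{(\varrho-1)^{4/7}h^{6/7}\lambda^{5/7},\,(\varrho-1)^{2/3}h^{2/3}\lambda\big\}\Big\}.$$ (ii) There are numerical constants $c,C>0$ such that for all $h,\lambda\in(0,\tfrac12]$ and $\varrho\in[1,\infty)$ with $\varrho-1\ge\lambda^{1/2}h^{1/4}$ the minimum of $E_h$ over $A_{\lambda,\varrho,\infty}$ is attained and $$c\,S_\infty\le\min_{A_{\lambda,\varrho,\infty}}E_h-\mathcal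 E_b(\varrho)\le C\,S_\infty,\qquad S_\infty=\min\big\{\lambda^2,(\varrho-1)^{4/7}h^{6/7}\lambda^{5/7}\big\}.$$ -/

import Mathlib

open MeasureTheory Set
open scoped ENNReal NNReal ContDiff

noncomputable section

namespace VKD

/-- The reference domain `Ω = [0, 2π] × [-1/2, 1/2]`, with coordinates `(θ, z)`. -/
def Ω : Set (ℝ × ℝ) := Icc 0 (2 * Real.pi) ×ˢ Icc (-(1 / 2)) (1 / 2)

/-- The coordinate directions: index `0` is `θ`, index `1` is `z`. -/
def dir : Fin 2 → ℝ × ℝ := ![(1, 0), (0, 1)]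

/-- `g` is the weak partial derivative of `f` in the coordinate direction `i` on the open
set `U`, in the sense of integration by parts against `C_c^∞(U)`. -/
def HasWeakDeriv (U : Set (ℝ × ℝ)) (i : Fin 2) (f g : ℝ × ℝ → ℝ) : Prop :=
  LocallyIntegrableOn f U ∧ LocallyIntegrableOn g U ∧
    ∀ ψ : ℝ × ℝ → ℝ, ContDiff ℝ ∞ ψ → HasCompactSupport ψ → tsupport ψ ⊆ U →
      ∫ x in U, f x * fderiv ℝ ψ x (dir i) = -∫ x in U, g x * ψ x

/-- `f ∈ H^k_loc(ℝ²)`: all iterated weak derivatives of order at most `k` exist and are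
square integrable on compact sets. -/
def MemHLoc : ℕ → (ℝ × ℝ → ℝ) → Prop
  | 0, f => ∀ K : Set (ℝ × ℝ), IsCompact K → MemLp f 2 (volume.restrict K)
  | k + 1, f => (∀ K : Set (ℝ × ℝ), IsCompact K → MemLp f 2 (volume.restrict K)) ∧
      ∀ i : Fin 2, ∃ g : ℝ × ℝ → ℝ, HasWeakDeriv univ i f g ∧ MemHLoc k g

/-- `F : ℝ² → ℝ` is `Ω`-periodic: `2π`-periodic in `θ` and `1`-periodic in `z`. -/
def IsPeriodic (F : ℝ × ℝ → ℝ) : Prop :=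
  ∀ x : ℝ × ℝ, F (x + (2 * Real.pi, 0)) = F x ∧ F (x + (0, 1)) = F x

/-- `f ∈ H^k_per(Ω)`: almost everywhere on `Ω`, `f` agrees with an `Ω`-periodic function that
belongs to `H^k_loc(ℝ²)`. The values of `f` outside `Ω` play no role. -/
def MemHPer (k : ℕ) (f : ℝ × ℝ → ℝ) : Prop :=
  ∃ F : ℝ × ℝ → ℝ, IsPeriodic F ∧ MemHLoc k F ∧ F =ᵐ[volume.restrict Ω] f

open Classical in
/-- The weak partial derivative `∂_i f` in the interior of `Ω` (unique almost everywhere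
where it exists; `0` if it does not exist). -/
def weakDeriv (i : Fin 2) (f : ℝ × ℝ → ℝ) : ℝ × ℝ → ℝ :=
  if hf : ∃ g : ℝ × ℝ → ℝ, HasWeakDeriv (interior Ω) i f g then hf.choose else 0

/-- A displacement field `φ : Ω → ℝ³` through its cylindrical components
`(φ_ρ, φ_θ, φ_z)`. Only the values on `Ω` matter. -/
structure Displacement where
  /-- the radial component `φ_ρ` -/
  rho : ℝ × ℝ → ℝ
  /-- the azimuthal component `φ_θ` -/
  theta : ℝ × ℝ → ℝ
  /-- the axial component `φ_z` -/
  z : ℝ × ℝ → ℝ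

namespace Displacement

/-- The in-cylinder displacements `φ_θ` (index `0`) and `φ_z` (index `1`). -/
def tangential (φ : Displacement) : Fin 2 → ℝ × ℝ → ℝ := ![φ.theta, φ.z]

/-- All three components `φ_ρ, φ_θ, φ_z`. -/
def component (φ : Displacement) : Fin 3 → ℝ × ℝ → ℝ := ![φ.rho, φ.theta, φ.z]

/-- The von Kármán–Donnell strain
`ε = e(φ_θ, φ_z) + ½ Dφ_ρ ⊗ Dφ_ρ + φ_ρ e_θ ⊗ e_θ`, where
`e_ij = (∂_i φ_j + ∂_j φ_i) / 2`. -/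
def strain (φ : Displacement) (i j : Fin 2) (x : ℝ × ℝ) : ℝ :=
  (weakDeriv i (φ.tangential j) x + weakDeriv j (φ.tangential i) x) / 2
    + 1 / 2 * (weakDeriv i φ.rho x * weakDeriv j φ.rho x)
    + (if i = 0 ∧ j = 0 then φ.rho x else 0)

/-- The von Kármán–Donnell energy `∫_Ω |ε|² + h² |D²φ_ρ|² dθ dz`, as an extended
nonnegative number. -/
def energy (h : ℝ) (φ : Displacement) : ℝ≥0∞ :=
  ∫⁻ x in Ω, ENNReal.ofReal
    ((∑ i, ∑ j, φ.strain i j x ^ 2)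
      + h ^ 2 * ∑ i, ∑ j, weakDeriv i (weakDeriv j φ.rho) x ^ 2)

end Displacement

/-- The admissible set with axial confinement `lam`, mandrel radius `r` and a priori slope
bound `m ∈ (0, ∞]`. -/
def admissible (lam r : ℝ) (m : ℝ≥0∞) : Set Displacement :=
  {φ | MemHPer 2 φ.rho ∧ MemHPer 1 φ.theta ∧ MemHPer 1 (fun x => φ.z x + lam * x.2) ∧
    (∀ᵐ x ∂(volume.restrict Ω), r - 1 ≤ φ.rho x) ∧
    ∀ (i : Fin 2) (j : Fin 3),
      eLpNorm (weakDeriv i (φ.component j)) ∞ (volume.restrict Ω) ≤ m}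

/-- The bulk energy `|Ω| (r - 1)²`. -/
def bulkEnergy (r : ℝ) : ℝ := (volume Ω).toReal * (r - 1) ^ 2

end VKD

end

noncomputable section

open Filter Topology
open scoped Convolution

namespace VKD

/-! Write A = ϱ − 1, and call the energy minus the bulk energy the excess.

Lower bound. Since hoop² ≥ 2A·hoop − A², since ∂_θφ_θ has mean zero and since the obstacle gives φ_ρ
≥ A, the excess dominates 2A‖φ_ρ − A‖_{L¹} + h²‖∂_z²φ_ρ‖² + ‖ε_zz‖² (`Adm.excess_lower`); the other
energy terms are dropped. Periodicity fixes the mean of ∂_zφ_z at −λ, so ε_zz can be small only if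
wrinkles absorb the compression, that is, if D = ∫|∂_zφ_ρ|² is of order λ. A smaller D costs order
λ². A larger D is paid for by the first two terms, through interpolation between the L¹ norm X of
φ_ρ − A and the squared L² norm Y of its second derivative. On a slice θ = const, D⁵ ≤ 64 X⁴Y³
(`interpolation`) leads to A^{4/7}h^{6/7}λ^{5/7}. Under a slope bound m, D is at most 3l²Y + 4mX/l
for every l > 0 (`PerJet2.integral_sq_le`), and l = h^{2/3}A^{-1/3} leads to A^{2/3}h^{2/3}λ. Both
bounds hold for finite m, which explains the maximum.

Upper bound. All competitors are axisymmetric. The unwrinkled one has excess 2πλ². The wrinkled ones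
superpose N copies of a periodic profile of relative width s (`exists_profile`, `exists_wrinkled`),
with φ_z chosen so that ε_zz vanishes identically. One wrinkle of width h^{4/7}λ^{1/7}A^{-2/7}
attains the first scaling (`exists_few`); about λ/l wrinkles with slopes of order one attain the
second (`exists_many`). With a slope bound, the choice between them is made by comparing λ³A with
h².

Existence is the direct method. A Sobolev function is handled as a jet, an L²(Ω)-limit of smooth
periodic functions together with their derivatives. Jets form a closed subspace, so they are stable
under weak limits (`PerJet.of_wTendsto`). Coercivity (`Adm.bounds`) rests on Poincaré, Ladyzhenskaya
and Korn inequalities. Compactness (`PerJet.rellich`) makes the gradient of φ_ρ converge strongly,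
so the nonlinear strains converge weakly and the energy is lower semicontinuous (`exists_limit`). -/

/-- The classical partial derivative in the coordinate direction `i`. -/
def pd (i : Fin 2) (ψ : ℝ × ℝ → ℝ) (x : ℝ × ℝ) : ℝ := fderiv ℝ ψ x (dir i)

/-- Smooth `Ω`-periodic functions. -/
def SmoothPer (ψ : ℝ × ℝ → ℝ) : Prop := ContDiff ℝ ∞ ψ ∧ IsPeriodic ψ

/-- Convergence in `L²(Ω)`. -/
def L2Tendsto {ι : Type*} (l : Filter ι) (F : ι → ℝ × ℝ → ℝ) (f : ℝ × ℝ → ℝ) : Prop :=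
  Tendsto (fun n => eLpNorm (F n - f) 2 (volume.restrict Ω)) l (𝓝 0)

/-! ### Mollification and its convergence in L²(Ω) -/

/-- A sequence of mollifiers shrinking to the origin. -/
def moll (n : ℕ) : ContDiffBump (0 : ℝ × ℝ) where
  rIn := 1 / (2 * ((n : ℝ) + 1))
  rOut := 1 / ((n : ℝ) + 1)
  rIn_pos := by positivity
  rIn_lt_rOut := by
    apply one_div_lt_one_div_of_lt <;> [positivity; linarith [n.cast_nonneg (α := ℝ)]]

/-- Mollification of `f` at scale `1 / (n + 1)`. -/
def mollify (n : ℕ) (f : ℝ × ℝ → ℝ) : ℝ × ℝ → ℝ :=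
  (moll n).normed volume ⋆[ContinuousLinearMap.lsmul ℝ ℝ, volume] f

theorem mollify_apply (n : ℕ) (f : ℝ × ℝ → ℝ) (x : ℝ × ℝ) :
    mollify n f x = ∫ t, (moll n).normed volume t * f (x - t) := rfl

/-- Hölder for the splitting w g = w^{1/2} · (w^{1/2} g): this is Jensen's inequality for the
probability density `w`. -/
theorem sq_lintegral_mul_le {w g : ℝ × ℝ → ℝ≥0∞} (hw : Measurable w) (hg : Measurable g)
    (h1 : ∫⁻ t, w t = 1) : (∫⁻ t, w t * g t) ^ 2 ≤ ∫⁻ t, w t * g t ^ 2 := by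
  have h := ENNReal.lintegral_mul_le_Lp_mul_Lq (volume : Measure (ℝ × ℝ))
    (p := 2) (q := 2) (by constructor <;> norm_num)
    (f := fun t => w t ^ (1 / 2 : ℝ)) (g := fun t => w t ^ (1 / 2 : ℝ) * g t)
    (hw.pow_const _).aemeasurable ((hw.pow_const _).mul hg).aemeasurable
  have e1 : ∀ t, w t ^ (1 / 2 : ℝ) * (w t ^ (1 / 2 : ℝ) * g t) = w t * g t := by
    intro t
    rw [← mul_assoc, ← ENNReal.rpow_add_of_nonneg _ _ (by norm_num) (by norm_num)]
    norm_num
  have e2 : ∀ t, (w t ^ (1 / 2 : ℝ)) ^ (2 : ℝ) = w t := by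
    intro t; rw [← ENNReal.rpow_mul]; norm_num
  have e3 : ∀ t, (w t ^ (1 / 2 : ℝ) * g t) ^ (2 : ℝ) = w t * g t ^ 2 := by
    intro t; rw [ENNReal.mul_rpow_of_nonneg _ _ (by norm_num), e2]
    norm_num
  simp only [Pi.mul_apply, e1, e2, e3, h1, ENNReal.one_rpow, one_mul] at h
  calc (∫⁻ t, w t * g t) ^ 2 ≤ ((∫⁻ t, w t * g t ^ 2) ^ (1 / 2 : ℝ)) ^ 2 := by gcongr
    _ = _ := by
      rw [← ENNReal.rpow_natCast, ← ENNReal.rpow_mul]; norm_num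

theorem lintegral_enorm_moll (n : ℕ) : ∫⁻ t, ‖(moll n).normed volume t‖ₑ = 1 := by
  have h := (moll n).integral_normed (μ := volume)
  have hi : Integrable ((moll n).normed volume) := (moll n).integrable_normed
  have h2 := ofReal_integral_eq_lintegral_ofReal hi
    (Eventually.of_forall fun t => (moll n).nonneg_normed t)
  rw [h] at h2
  rw [← ENNReal.ofReal_one, h2]
  refine lintegral_congr fun t => ?_
  rw [Real.enorm_eq_ofReal ((moll n).nonneg_normed t)]

theorem eLpNorm_two_eq {α : Type*} [MeasurableSpace α] (μ : Measure α) (f : α → ℝ) :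
    eLpNorm f 2 μ = (∫⁻ x, ‖f x‖ₑ ^ 2 ∂μ) ^ (1 / 2 : ℝ) := by
  rw [eLpNorm_eq_lintegral_rpow_enorm_toReal (by norm_num) (by norm_num)]
  simp

/-- Jensen under the convolution integral, then Tonelli and translation invariance. A measurable
representative is chosen first so that Tonelli applies. -/
theorem eLpNorm_mollify_le (n : ℕ) {f : ℝ × ℝ → ℝ} (hf : AEStronglyMeasurable f volume) :
    eLpNorm (mollify n f) 2 volume ≤ eLpNorm f 2 volume := by
  have hm : mollify n f = mollify n (hf.mk f) :=
    convolution_congr _ (ae_eq_refl _) hf.ae_eq_mk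
  rw [hm, eLpNorm_congr_ae hf.ae_eq_mk]
  have hg := hf.stronglyMeasurable_mk.measurable
  generalize hf.mk f = g at hg
  have hη : Measurable (fun t => ‖(moll n).normed volume t‖ₑ) :=
    ((moll n).continuous_normed (μ := volume)).measurable.enorm
  rw [eLpNorm_two_eq, eLpNorm_two_eq]
  gcongr ?_ ^ (1 / 2 : ℝ)
  calc ∫⁻ x, ‖mollify n g x‖ₑ ^ 2
      ≤ ∫⁻ x, ∫⁻ t, ‖(moll n).normed volume t‖ₑ * ‖g (x - t)‖ₑ ^ 2 := by
        refine lintegral_mono fun x => ?_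
        refine le_trans ?_ (sq_lintegral_mul_le hη
          (hg.comp (measurable_const.sub measurable_id)).enorm (lintegral_enorm_moll n))
        gcongr
        rw [mollify_apply]
        refine (enorm_integral_le_lintegral_enorm _).trans (le_of_eq ?_)
        simp [enorm_mul]
    _ = ∫⁻ t, ∫⁻ x, ‖(moll n).normed volume t‖ₑ * ‖g (x - t)‖ₑ ^ 2 := by
        apply lintegral_lintegral_swap
        refine Measurable.aemeasurable ?_
        exact (hη.comp measurable_snd).mul
          ((hg.comp (measurable_fst.sub measurable_snd)).enorm.pow_const 2)
    _ = ∫⁻ t, ‖(moll n).normed volume t‖ₑ * ∫⁻ x, ‖g x‖ₑ ^ 2 := by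
        refine lintegral_congr fun t => ?_
        rw [lintegral_const_mul' _ _ enorm_ne_top]
        congr 1
        exact lintegral_sub_right_eq_self (fun x => ‖g x‖ₑ ^ 2) t
    _ = _ := by
        rw [lintegral_mul_const _ hη, lintegral_enorm_moll, one_mul]

theorem isCompact_Ω : IsCompact Ω := isCompact_Icc.prod isCompact_Icc

theorem measurableSet_Ω : MeasurableSet Ω := isCompact_Ω.measurableSet

instance isFiniteMeasure_Ω : IsFiniteMeasure (volume.restrict Ω) :=
  ⟨by rw [Measure.restrict_apply_univ]; exact isCompact_Ω.measure_lt_top⟩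

theorem locallyIntegrable_of_memLp {f : ℝ × ℝ → ℝ}
    (hf : ∀ K : Set (ℝ × ℝ), IsCompact K → MemLp f 2 (volume.restrict K)) :
    LocallyIntegrable f volume := by
  refine locallyIntegrable_iff.2 fun K hK => ?_
  have : IsFiniteMeasure (volume.restrict K) :=
    ⟨by rw [Measure.restrict_apply_univ]; exact hK.measure_lt_top⟩
  exact (hf K hK).integrable (by norm_num)

theorem aestronglyMeasurable_mollify (n : ℕ) {f : ℝ × ℝ → ℝ} (hf : LocallyIntegrable f volume) :
    Continuous (mollify n f) :=
  (moll n).hasCompactSupport_normed.continuous_convolution_left _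
    (moll n).continuous_normed hf

theorem mollify_sub (n : ℕ) {f g : ℝ × ℝ → ℝ} (hf : LocallyIntegrable f volume)
    (hg : LocallyIntegrable g volume) : mollify n (f - g) = mollify n f - mollify n g := by
  have hc := fun {k : ℝ × ℝ → ℝ} (hk : LocallyIntegrable k volume) =>
    (moll n).hasCompactSupport_normed.convolutionExists_left
      (ContinuousLinearMap.lsmul ℝ ℝ) ((moll n).continuous_normed (μ := volume)) hk
  have := (hc hf).distrib_add (g' := -g) (hc hg.neg)
  rw [sub_eq_add_neg, mollify, this, sub_eq_add_neg]
  congr 1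
  exact neg_eq_neg_one_mul g ▸ by
    ext x; simp [mollify_apply, convolution, integral_neg]

theorem tendsto_rOut_moll : Tendsto (fun n => (moll n).rOut) atTop (𝓝 0) :=
  tendsto_one_div_add_atTop_nhds_zero_nat

theorem rOut_moll_le (n : ℕ) : (moll n).rOut ≤ 1 := by
  change 1 / ((n : ℝ) + 1) ≤ 1
  rw [div_le_one (by positivity)]; linarith [n.cast_nonneg (α := ℝ)]

/-- A three-ε argument: for a continuous compactly supported `g` close to `f` the mollifications
converge uniformly, and contractivity in L² controls `f - g` uniformly in `n`. -/
theorem tendsto_mollify_of_memLp {f : ℝ × ℝ → ℝ} (hf : MemLp f 2 volume) :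
    L2Tendsto atTop (fun n => mollify n f) f := by
  have hfl := hf.locallyIntegrable (by norm_num)
  rw [L2Tendsto, ENNReal.tendsto_atTop_zero]
  intro ε hε
  have hε3 : ε / 3 ≠ 0 := by simp [hε.ne']
  obtain ⟨g, hgs, hfg, hgc, hg2⟩ := hf.exists_hasCompactSupport_eLpNorm_sub_le (by norm_num) hε3
  have hgl := hg2.locallyIntegrable (by norm_num)
  have hu : UniformContinuous g := hgs.uniformContinuous_of_continuous hgc
  -- A uniform error δ costs |Ω|^{1/2} δ in L²(Ω).
  obtain ⟨δ, hδ, hδε⟩ : ∃ δ : ℝ, 0 < δ ∧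
      (volume.restrict Ω) univ ^ (1 / (2 : ℝ≥0∞).toReal) * ENNReal.ofReal δ ≤ ε / 3 := by
    have ht : Tendsto (fun δ : ℝ => (volume.restrict Ω) univ ^ (1 / (2 : ℝ≥0∞).toReal)
        * ENNReal.ofReal δ) (𝓝[>] 0) (𝓝 ((volume.restrict Ω) univ ^ (1 / (2 : ℝ≥0∞).toReal)
        * ENNReal.ofReal 0)) := by
      refine (ENNReal.Tendsto.const_mul ?_ (Or.inr ?_))
      · exact (ENNReal.continuous_ofReal.tendsto 0).mono_left nhdsWithin_le_nhds
      · exact ENNReal.rpow_ne_top_of_nonneg (by norm_num) (measure_ne_top _ _)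
    simp only [ENNReal.ofReal_zero, mul_zero] at ht
    have := (ht.eventually (ge_mem_nhds (pos_iff_ne_zero.2 hε3))).and self_mem_nhdsWithin
    obtain ⟨δ, h1, h2⟩ := this.exists
    exact ⟨δ, h2, h1⟩
  obtain ⟨r, hr, hrg⟩ := Metric.uniformContinuous_iff.1 hu δ hδ
  obtain ⟨N, hN⟩ := eventually_atTop.1 (tendsto_rOut_moll.eventually (gt_mem_nhds hr))
  refine ⟨N, fun n hn => ?_⟩
  have e : mollify n f - f = mollify n (f - g) + ((mollify n g - g) + (g - f)) := by
    rw [mollify_sub n hfl hgl]; ring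
  have m1 := (aestronglyMeasurable_mollify n (hfl.sub hgl)).aestronglyMeasurable
    (μ := volume.restrict Ω)
  have m2 := ((aestronglyMeasurable_mollify n hgl).sub hgc).aestronglyMeasurable
    (μ := volume.restrict Ω)
  have m3 : AEStronglyMeasurable (g - f) (volume.restrict Ω) :=
    (hg2.aestronglyMeasurable.sub hf.aestronglyMeasurable).restrict
  have b1 : eLpNorm (mollify n (f - g)) 2 (volume.restrict Ω) ≤ ε / 3 :=
    ((eLpNorm_mono_measure _ Measure.restrict_le_self).trans
      (eLpNorm_mollify_le n (hf.sub hg2).aestronglyMeasurable)).trans hfg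
  have b3 : eLpNorm (g - f) 2 (volume.restrict Ω) ≤ ε / 3 := by
    rw [eLpNorm_sub_comm]
    exact (eLpNorm_mono_measure _ Measure.restrict_le_self).trans hfg
  have b2 : eLpNorm (mollify n g - g) 2 (volume.restrict Ω) ≤ ε / 3 := by
    refine le_trans (eLpNorm_le_of_ae_bound (C := δ) (Eventually.of_forall fun x => ?_)) ?_
    · have := (moll n).dist_normed_convolution_le (μ := volume) (x₀ := x) (ε := δ)
        hgc.aestronglyMeasurable (fun y hy => (hrg
          ((Metric.mem_ball.1 hy).trans (hN n hn))).le)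
      rw [dist_eq_norm] at this
      exact this
    · simpa using hδε
  calc _ ≤ ε / 3 + (ε / 3 + ε / 3) := by
        rw [e]
        refine (eLpNorm_add_le m1 (m2.add m3) (by norm_num)).trans (add_le_add b1 ?_)
        exact (eLpNorm_add_le m2 m3 (by norm_num)).trans (add_le_add b2 b3)
    _ = ε := by rw [← add_assoc, ENNReal.add_thirds]

/-- The mollifiers have radius at most 1, so on Ω they do not notice a truncation of `f` outside the
closed 1-neighbourhood of Ω. -/
theorem tendsto_mollify {f : ℝ × ℝ → ℝ}
    (hf : ∀ K : Set (ℝ × ℝ), IsCompact K → MemLp f 2 (volume.restrict K)) :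
    L2Tendsto atTop (fun n => mollify n f) f := by
  set K := Metric.cthickening 1 Ω
  have hK : IsCompact K := isCompact_Ω.cthickening
  have hKm : MeasurableSet K := hK.measurableSet
  have h1 : MemLp (K.indicator f) 2 volume := (memLp_indicator_iff_restrict hKm).2 (hf K hK)
  have h2 := tendsto_mollify_of_memLp h1
  refine h2.congr fun n => ?_
  refine eLpNorm_congr_ae ?_
  filter_upwards [ae_restrict_mem measurableSet_Ω] with x hx
  have hxK : x ∈ K := Metric.self_subset_cthickening _ hx
  simp only [Pi.sub_apply, indicator_of_mem hxK]
  congr 1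
  rw [mollify_apply, mollify_apply]
  refine integral_congr_ae (Eventually.of_forall fun t => ?_)
  change (moll n).normed volume t * _ = (moll n).normed volume t * _
  by_cases ht : t ∈ Metric.ball (0 : ℝ × ℝ) (moll n).rOut
  · congr 1
    refine indicator_of_mem (Metric.mem_cthickening_of_dist_le _ x _ _ hx ?_) f
    rw [dist_eq_norm, sub_sub_cancel_left, norm_neg]
    exact (mem_ball_zero_iff.1 ht).le.trans (rOut_moll_le n)
  · rw [← (moll n).support_normed_eq (μ := volume), Function.notMem_support] at ht
    rw [ht, zero_mul, zero_mul]

theorem contDiff_mollify (n : ℕ) {f : ℝ × ℝ → ℝ} (hf : LocallyIntegrable f volume) :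
    ContDiff ℝ ∞ (mollify n f) :=
  (moll n).hasCompactSupport_normed.contDiff_convolution_left _ (moll n).contDiff_normed hf

theorem isPeriodic_mollify (n : ℕ) {f : ℝ × ℝ → ℝ} (hf : IsPeriodic f) :
    IsPeriodic (mollify n f) := by
  intro x
  simp only [mollify_apply, add_sub_right_comm]
  exact ⟨by simp only [(hf _).1], by simp only [(hf _).2]⟩

/-- The weak derivative is tested with y ↦ η(x − y); the sign from the reflection cancels the sign
from integration by parts. -/
theorem pd_mollify (n : ℕ) {i : Fin 2} {f g : ℝ × ℝ → ℝ} (h : HasWeakDeriv univ i f g) :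
    pd i (mollify n f) = mollify n g := by
  obtain ⟨hf, hg, hw⟩ := h
  rw [locallyIntegrableOn_univ] at hf hg
  ext x
  have hη : ContDiff ℝ ∞ ((moll n).normed (volume : Measure (ℝ × ℝ))) := (moll n).contDiff_normed
  have hcs : HasCompactSupport ((moll n).normed (volume : Measure (ℝ × ℝ))) :=
    (moll n).hasCompactSupport_normed
  have hd := hcs.hasFDerivAt_convolution_left (ContinuousLinearMap.lsmul ℝ ℝ)
    (hη.of_le (by exact_mod_cast le_top)) hf x
  have hce := (hcs.fderiv ℝ).convolutionExists_left
      ((ContinuousLinearMap.lsmul ℝ ℝ).precompL (ℝ × ℝ)) (hη.continuous_fderiv (by simp)) hf x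
  have e1 : pd i (mollify n f) x = ∫ t, fderiv ℝ ((moll n).normed volume) t (dir i) * f (x - t) := by
    rw [pd, mollify, hd.fderiv, convolution]
    rw [ContinuousLinearMap.integral_apply hce]
    rfl
  have hsub : ContDiff ℝ ∞ (fun y : ℝ × ℝ => x - y) := contDiff_const.sub contDiff_id
  have e2 : ∀ y, fderiv ℝ (fun y => (moll n).normed volume (x - y)) y (dir i)
      = - fderiv ℝ ((moll n).normed volume) (x - y) (dir i) := by
    intro y
    have h1 : HasFDerivAt (fun y : ℝ × ℝ => x - y) (-ContinuousLinearMap.id ℝ (ℝ × ℝ)) y :=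
      (hasFDerivAt_id y).const_sub x
    have h2 := ((hη.differentiable (by simp)) (x - y)).hasFDerivAt.comp y h1
    rw [show (fun y => (moll n).normed volume (x - y))
      = (moll n).normed volume ∘ (fun y => x - y) from rfl, h2.fderiv]
    simp
  have h3 := hw (fun y => (moll n).normed volume (x - y)) (hη.comp hsub)
    (hcs.comp_homeomorph (Homeomorph.subLeft x)) (subset_univ _)
  simp only [e2, Measure.restrict_univ] at h3
  rw [e1, mollify_apply, ← integral_sub_left_eq_self _ volume x,
    ← integral_sub_left_eq_self (fun t => (moll n).normed volume t * g (x - t)) volume x]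
  simp only [sub_sub_cancel, mul_neg, integral_neg, neg_inj] at h3 ⊢
  simpa only [mul_comm] using h3

/-! ### Strong convergence and inner products in L² -/

section L2

variable {α ι : Type*} [MeasurableSpace α] {μ : Measure α} {l : Filter ι}

theorem inner_toLp {f g : α → ℝ} (hf : MemLp f 2 μ) (hg : MemLp g 2 μ) :
    inner ℝ (hf.toLp f) (hg.toLp g) = ∫ x, f x * g x ∂μ := by
  rw [L2.inner_def]
  refine integral_congr_ae ?_
  filter_upwards [hf.coeFn_toLp, hg.coeFn_toLp] with x h1 h2
  rw [h1, h2, real_inner_eq_re_inner]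
  simp [mul_comm]

theorem tendsto_toLp {F : ι → α → ℝ} {f : α → ℝ} (hF : ∀ n, MemLp (F n) 2 μ) (hf : MemLp f 2 μ)
    (h : Tendsto (fun n => eLpNorm (F n - f) 2 μ) l (𝓝 0)) :
    Tendsto (fun n => (hF n).toLp (F n)) l (𝓝 (hf.toLp f)) :=
  (Lp.tendsto_Lp_iff_tendsto_eLpNorm'' F hF f hf).2 h

theorem tendsto_integral_mul {F G : ι → α → ℝ} {f g : α → ℝ} (hF : ∀ n, MemLp (F n) 2 μ)
    (hf : MemLp f 2 μ) (hG : ∀ n, MemLp (G n) 2 μ) (hg : MemLp g 2 μ)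
    (h1 : Tendsto (fun n => eLpNorm (F n - f) 2 μ) l (𝓝 0))
    (h2 : Tendsto (fun n => eLpNorm (G n - g) 2 μ) l (𝓝 0)) :
    Tendsto (fun n => ∫ x, F n x * G n x ∂μ) l (𝓝 (∫ x, f x * g x ∂μ)) := by
  have := (tendsto_toLp hF hf h1).inner (𝕜 := ℝ) (tendsto_toLp hG hg h2)
  simpa only [inner_toLp] using this

end L2

/-! ### Periodic jets -/

/-- `f` has periodic weak gradient `g` in `L²(Ω)`: the pair is an `L²(Ω)`-limit of smooth periodic
functions and their gradients. -/
structure PerJet (f : ℝ × ℝ → ℝ) (g : Fin 2 → ℝ × ℝ → ℝ) : Prop where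
  memLp : MemLp f 2 (volume.restrict Ω)
  memLp_deriv : ∀ i, MemLp (g i) 2 (volume.restrict Ω)
  approx : ∃ ψ : ℕ → ℝ × ℝ → ℝ, (∀ n, SmoothPer (ψ n)) ∧ L2Tendsto atTop ψ f ∧
    ∀ i, L2Tendsto atTop (fun n => pd i (ψ n)) (g i)

/-- Second order version of `PerJet`; `H j i` is the derivative of `g j` in direction `i`. -/
structure PerJet2 (f : ℝ × ℝ → ℝ) (g : Fin 2 → ℝ × ℝ → ℝ) (H : Fin 2 → Fin 2 → ℝ × ℝ → ℝ) :
    Prop where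
  memLp : MemLp f 2 (volume.restrict Ω)
  memLp_deriv : ∀ i, MemLp (g i) 2 (volume.restrict Ω)
  memLp_deriv2 : ∀ j i, MemLp (H j i) 2 (volume.restrict Ω)
  approx : ∃ ψ : ℕ → ℝ × ℝ → ℝ, (∀ n, SmoothPer (ψ n)) ∧ L2Tendsto atTop ψ f ∧
    (∀ i, L2Tendsto atTop (fun n => pd i (ψ n)) (g i)) ∧
    ∀ j i, L2Tendsto atTop (fun n => pd i (pd j (ψ n))) (H j i)

theorem contDiff_pd {ψ : ℝ × ℝ → ℝ} (h : ContDiff ℝ ∞ ψ) (i : Fin 2) : ContDiff ℝ ∞ (pd i ψ) :=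
  (h.fderiv_right (m := ∞) (by simp)).clm_apply contDiff_const

theorem fderiv_add_period {ψ : ℝ × ℝ → ℝ} {v : ℝ × ℝ} (h : ∀ x, ψ (x + v) = ψ x) (x : ℝ × ℝ) :
    fderiv ℝ ψ (x + v) = fderiv ℝ ψ x := by
  rw [← fderiv_comp_add_right]
  simp only [h]

theorem SmoothPer.pd {ψ : ℝ × ℝ → ℝ} (h : SmoothPer ψ) (i : Fin 2) : SmoothPer (pd i ψ) :=
  ⟨contDiff_pd h.1 i, fun x => ⟨by
    rw [VKD.pd, VKD.pd, fderiv_add_period fun x => (h.2 x).1], by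
    rw [VKD.pd, VKD.pd, fderiv_add_period fun x => (h.2 x).2]⟩⟩

theorem memLp_of_continuous {f : ℝ × ℝ → ℝ} (hf : Continuous f) {K : Set (ℝ × ℝ)}
    (hK : IsCompact K) : MemLp f 2 (volume.restrict K) := by
  obtain ⟨C, hC⟩ := hK.exists_bound_of_continuousOn hf.continuousOn
  have : IsFiniteMeasure (volume.restrict K) :=
    ⟨by rw [Measure.restrict_apply_univ]; exact hK.measure_lt_top⟩
  exact MemLp.of_bound hf.aestronglyMeasurable C
    ((ae_restrict_iff' hK.measurableSet).2 (Eventually.of_forall hC))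

theorem SmoothPer.memLp {ψ : ℝ × ℝ → ℝ} (h : SmoothPer ψ) : MemLp ψ 2 (volume.restrict Ω) :=
  memLp_of_continuous h.1.continuous isCompact_Ω

/-! ### Weak derivatives -/

theorem HasWeakDeriv.mono {U V : Set (ℝ × ℝ)} {i : Fin 2} {f g : ℝ × ℝ → ℝ}
    (h : HasWeakDeriv V i f g) (hUV : U ⊆ V) :
    HasWeakDeriv U i f g := by
  refine ⟨h.1.mono_set hUV, h.2.1.mono_set hUV, fun ψ h1 h2 h3 => ?_⟩
  have key : ∀ k : ℝ × ℝ → ℝ, (∀ x, x ∉ tsupport ψ → k x = 0) →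
      ∫ x in U, k x = ∫ x in V, k x := by
    intro k hk
    rw [setIntegral_eq_integral_of_forall_compl_eq_zero fun x hx => hk x fun h => hx (h3 h),
      setIntegral_eq_integral_of_forall_compl_eq_zero fun x hx => hk x fun h => hx (hUV (h3 h))]
  rw [key, key, h.2.2 ψ h1 h2 (h3.trans hUV)]
  · intro x hx; rw [image_eq_zero_of_notMem_tsupport hx, mul_zero]
  · intro x hx
    have : x ∉ tsupport (fderiv ℝ ψ) := fun h => hx (tsupport_fderiv_subset ℝ h)
    rw [image_eq_zero_of_notMem_tsupport this]; simp

theorem HasWeakDeriv.congr {U : Set (ℝ × ℝ)} {i : Fin 2} {f f' g g' : ℝ × ℝ → ℝ}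
    (h : HasWeakDeriv U i f g) (hf : f =ᵐ[volume.restrict U] f')
    (hg : g =ᵐ[volume.restrict U] g') : HasWeakDeriv U i f' g' := by
  refine ⟨?_, ?_, fun ψ h1 h2 h3 => ?_⟩
  · intro x hx
    obtain ⟨s, hs, hi⟩ := h.1 x hx
    exact ⟨s ∩ U, inter_mem hs self_mem_nhdsWithin, (hi.mono_set inter_subset_left).congr_fun_ae
      (ae_mono (Measure.restrict_mono inter_subset_right le_rfl) hf)⟩
  · intro x hx
    obtain ⟨s, hs, hi⟩ := h.2.1 x hx
    exact ⟨s ∩ U, inter_mem hs self_mem_nhdsWithin, (hi.mono_set inter_subset_left).congr_fun_ae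
      (ae_mono (Measure.restrict_mono inter_subset_right le_rfl) hg)⟩
  · have := h.2.2 ψ h1 h2 h3
    rw [integral_congr_ae (g := fun x => f x * fderiv ℝ ψ x (dir i)), this,
      integral_congr_ae (f := fun x => g x * ψ x)]
    · filter_upwards [hg] with x hx
      rw [hx]
    · filter_upwards [hf] with x hx
      rw [hx]

theorem integrableOn_mul_of_tsupport {U : Set (ℝ × ℝ)} {f χ : ℝ × ℝ → ℝ}
    (hf : LocallyIntegrableOn f U) (hχ : Continuous χ) (hc : HasCompactSupport χ)
    (hs : tsupport χ ⊆ U) : IntegrableOn (fun x => f x * χ x) U := by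
  have h1 : IntegrableOn (fun x => f x * χ x) (tsupport χ) :=
    (hf.integrableOn_compact_subset hs hc.isCompact).mul_continuousOn hχ.continuousOn hc.isCompact
  have h2 : Integrable (fun x => f x * χ x) volume :=
    (integrableOn_iff_integrable_of_support_subset (fun x hx => by
      by_contra hn; exact hx (by simp [image_eq_zero_of_notMem_tsupport hn]))).1 h1
  exact h2.integrableOn

/-- The fundamental lemma of the calculus of variations, applied to `g - g'`. -/
theorem HasWeakDeriv.ae_unique {U : Set (ℝ × ℝ)} (hU : IsOpen U) {i : Fin 2}
    {f g g' : ℝ × ℝ → ℝ} (h : HasWeakDeriv U i f g) (h' : HasWeakDeriv U i f g') :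
    g =ᵐ[volume.restrict U] g' := by
  have := hU.ae_eq_zero_of_integral_contDiff_smul_eq_zero (μ := volume)
    (h.2.1.sub h'.2.1) (fun χ h1 h2 h3 => by
      have e := (h.2.2 χ h1 h2 h3).symm.trans (h'.2.2 χ h1 h2 h3)
      rw [neg_inj] at e
      have i1 := integrableOn_mul_of_tsupport h.2.1 h1.continuous h2 h3
      have i2 := integrableOn_mul_of_tsupport h'.2.1 h1.continuous h2 h3
      rw [← setIntegral_eq_integral_of_forall_compl_eq_zero (s := U) (fun x hx => by
        simp [image_eq_zero_of_notMem_tsupport fun hh => hx (h3 hh)])]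
      rw [← sub_eq_zero, ← integral_sub i1 i2] at e
      rw [← e]
      refine integral_congr_ae (Eventually.of_forall fun x => ?_)
      simp; ring)
  rw [Filter.EventuallyEq, ae_restrict_iff' hU.measurableSet]
  filter_upwards [this] with x hx hxU
  exact sub_eq_zero.1 (hx hxU)

theorem HasWeakDeriv.add {U : Set (ℝ × ℝ)} {i : Fin 2} {f g f' g' : ℝ × ℝ → ℝ}
    (h : HasWeakDeriv U i f g) (h' : HasWeakDeriv U i f' g') :
    HasWeakDeriv U i (fun x => f x + f' x) (fun x => g x + g' x) := by
  refine ⟨h.1.add h'.1, h.2.1.add h'.2.1, fun ψ h1 h2 h3 => ?_⟩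
  have hd : Continuous fun x => fderiv ℝ ψ x (dir i) := (contDiff_pd h1 i).continuous
  have hsub : tsupport (fun x => fderiv ℝ ψ x (dir i)) ⊆ tsupport ψ :=
    (closure_mono fun x hx => by
      simp only [Function.mem_support] at hx ⊢
      intro hz; rw [hz] at hx; simp at hx).trans (tsupport_fderiv_subset ℝ)
  have hdc : HasCompactSupport fun x => fderiv ℝ ψ x (dir i) :=
    h2.mono' ((subset_tsupport _).trans hsub)
  have hds := hsub.trans h3
  simp only [add_mul]
  rw [integral_add (integrableOn_mul_of_tsupport h.1 hd hdc hds)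
      (integrableOn_mul_of_tsupport h'.1 hd hdc hds),
    integral_add (integrableOn_mul_of_tsupport h.2.1 h1.continuous h2 h3)
      (integrableOn_mul_of_tsupport h'.2.1 h1.continuous h2 h3),
    h.2.2 ψ h1 h2 h3, h'.2.2 ψ h1 h2 h3]
  ring

theorem hasCompactSupport_pd {ψ : ℝ × ℝ → ℝ} (h2 : HasCompactSupport ψ) (i : Fin 2) :
    HasCompactSupport fun x => fderiv ℝ ψ x (dir i) :=
  (h2.fderiv ℝ).comp_left (g := fun L : ℝ × ℝ →L[ℝ] ℝ => L (dir i)) rfl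

theorem hasWeakDeriv_of_contDiff {f : ℝ × ℝ → ℝ} (hf : ContDiff ℝ ∞ f) (i : Fin 2) :
    HasWeakDeriv univ i f (pd i f) := by
  refine ⟨hf.continuous.locallyIntegrable.locallyIntegrableOn _,
    (contDiff_pd hf i).continuous.locallyIntegrable.locallyIntegrableOn _, fun ψ h1 h2 _ => ?_⟩
  rw [Measure.restrict_univ]
  have hcψ := h1.continuous
  have c1 : Continuous fun x => fderiv ℝ ψ x (dir i) := (contDiff_pd h1 i).continuous
  have c2 : Continuous fun x => fderiv ℝ f x (dir i) := (contDiff_pd hf i).continuous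
  exact integral_mul_fderiv_eq_neg_fderiv_mul_of_integrable
    ((c2.mul hcψ).integrable_of_hasCompactSupport h2.mul_left)
    ((hf.continuous.mul c1).integrable_of_hasCompactSupport (hasCompactSupport_pd h2 i).mul_left)
    ((hf.continuous.mul hcψ).integrable_of_hasCompactSupport h2.mul_left)
    (fun x _ => (hf.differentiable (by simp)) x) (fun x _ => (h1.differentiable (by simp)) x)

/-- The frontier of a convex set is null. Statements a.e. can thus move between Ω, where the energy
lives, and its interior, where weak derivatives are tested. -/
theorem restrict_interior_Ω : volume.restrict (interior Ω) = volume.restrict Ω := by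
  refine Measure.restrict_congr_set (interior_ae_eq_of_null_frontier ?_)
  exact ((convex_Icc _ _).prod (convex_Icc _ _)).addHaar_frontier volume

/-- Allows the derivative picked by choice to be replaced by any known one. -/
theorem weakDeriv_ae_eq {i : Fin 2} {f g : ℝ × ℝ → ℝ} (h : HasWeakDeriv (interior Ω) i f g) :
    weakDeriv i f =ᵐ[volume.restrict Ω] g := by
  have hex : ∃ g : ℝ × ℝ → ℝ, HasWeakDeriv (interior Ω) i f g := ⟨g, h⟩
  rw [weakDeriv, dif_pos hex, ← restrict_interior_Ω]
  exact hex.choose_spec.ae_unique isOpen_interior h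

/-! ### From `H^k_per` to jets -/

theorem L2Tendsto.congr_right {ι : Type*} {l : Filter ι} {F : ι → ℝ × ℝ → ℝ} {f f' : ℝ × ℝ → ℝ}
    (h : L2Tendsto l F f) (hf : f =ᵐ[volume.restrict Ω] f') : L2Tendsto l F f' := by
  refine Tendsto.congr (fun n => eLpNorm_congr_ae ?_) h
  filter_upwards [hf] with x hx
  simp [hx]

theorem MemHPer.exists_perJet {f : ℝ × ℝ → ℝ} (h : MemHPer 1 f) :
    ∃ g, PerJet f g ∧ ∀ i, HasWeakDeriv (interior Ω) i f (g i) := by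
  obtain ⟨F, hper, hF, hae⟩ := h
  choose hL g hw hg using hF
  have hFl := locallyIntegrable_of_memLp hL
  refine ⟨g, ⟨(hL _ isCompact_Ω).ae_eq hae, fun i => hg i _ isCompact_Ω,
    fun n => mollify n F, fun n => ⟨contDiff_mollify n hFl, isPeriodic_mollify n hper⟩,
    (tendsto_mollify hL).congr_right hae, fun i => ?_⟩, fun i => ?_⟩
  · simp only [pd_mollify _ (hw i)]
    exact tendsto_mollify (hg i)
  · exact ((hw i).mono (subset_univ _)).congr
      (by rwa [restrict_interior_Ω]) (ae_eq_refl _)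

/-- Mollification preserves periodicity and commutes with weak derivatives, so one sequence
approximates the function, its gradient and its Hessian simultaneously. -/
theorem MemHPer.exists_perJet2 {f : ℝ × ℝ → ℝ} (h : MemHPer 2 f) :
    ∃ g H, PerJet2 f g H ∧ (∀ i, HasWeakDeriv (interior Ω) i f (g i)) ∧
      ∀ j i, HasWeakDeriv (interior Ω) i (g j) (H j i) := by
  obtain ⟨F, hper, hF, hae⟩ := h
  choose hL g hw hg using hF
  choose hLg H hwH hH using hg
  have hFl := locallyIntegrable_of_memLp hL
  refine ⟨g, H, ⟨(hL _ isCompact_Ω).ae_eq hae, fun i => hLg i _ isCompact_Ω,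
    fun j i => hH j i _ isCompact_Ω,
    fun n => mollify n F, fun n => ⟨contDiff_mollify n hFl, isPeriodic_mollify n hper⟩,
    (tendsto_mollify hL).congr_right hae, fun i => ?_, fun j i => ?_⟩, fun i => ?_, fun j i => ?_⟩
  · simp only [pd_mollify _ (hw i)]
    exact tendsto_mollify (hLg i)
  · simp only [pd_mollify _ (hw j), pd_mollify _ (hwH j i)]
    exact tendsto_mollify (hH j i)
  · exact ((hw i).mono (subset_univ _)).congr
      (by rwa [restrict_interior_Ω]) (ae_eq_refl _)
  · exact (hwH j i).mono (subset_univ _)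

theorem PerJet2.perJet {f g H} (h : PerJet2 f g H) : PerJet f g := by
  obtain ⟨ψ, h1, h2, h3, h4⟩ := h.approx
  exact ⟨h.memLp, h.memLp_deriv, ψ, h1, h2, h3⟩

theorem PerJet2.perJet_deriv {f g H} (h : PerJet2 f g H) (j : Fin 2) : PerJet (g j) (H j) := by
  obtain ⟨ψ, h1, h2, h3, h4⟩ := h.approx
  exact ⟨h.memLp_deriv j, h.memLp_deriv2 j, fun n => pd j (ψ n), fun n => (h1 n).pd j, h3 j, h4 j⟩

/-! ### From jets to `H^k_per` -/

/-- Reduction of a point modulo the periods to the half-open cell inside `Ω`. -/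
def wrap (x : ℝ × ℝ) : ℝ × ℝ :=
  (2 * Real.pi * Int.fract (x.1 / (2 * Real.pi)), Int.fract (x.2 + 1 / 2) - 1 / 2)

theorem measurable_wrap : Measurable wrap := by
  unfold wrap
  exact (measurable_const.mul (measurable_fract.comp (measurable_fst.div_const _))).prodMk
    ((measurable_fract.comp (measurable_snd.add_const _)).sub_const _)

theorem wrap_mem (x : ℝ × ℝ) : wrap x ∈ Ω := by
  have h1 := Int.fract_nonneg (x.1 / (2 * Real.pi))
  have h2 := (Int.fract_lt_one (x.1 / (2 * Real.pi))).le
  have h3 := Int.fract_nonneg (x.2 + 1 / 2)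
  have h4 := (Int.fract_lt_one (x.2 + 1 / 2)).le
  have hp := Real.pi_pos
  refine ⟨⟨?_, ?_⟩, ⟨?_, ?_⟩⟩ <;> simp only [wrap]
  · positivity
  · nlinarith
  · linarith
  · linarith

/-- The lattice of periods. -/
def period (k : ℤ × ℤ) : ℝ × ℝ := (2 * Real.pi * k.1, k.2)

theorem wrap_add_period (x : ℝ × ℝ) :
    wrap x + period (⌊x.1 / (2 * Real.pi)⌋, ⌊x.2 + 1 / 2⌋) = x := by
  have hp := Real.pi_pos
  ext
  · simp only [wrap, period, Prod.fst_add, Int.fract]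
    field_simp; ring
  · simp only [wrap, period, Prod.snd_add, Int.fract]; ring

theorem IsPeriodic.add_period {f : ℝ × ℝ → ℝ} (h : IsPeriodic f) (k : ℤ × ℤ) (x : ℝ × ℝ) :
    f (x + period k) = f x := by
  have h1 : Function.Periodic f (2 * Real.pi, 0) := fun x => (h x).1
  have h2 : Function.Periodic f (0, 1) := fun x => (h x).2
  have e : period k = k.1 • ((2 * Real.pi, 0) : ℝ × ℝ) + k.2 • ((0, 1) : ℝ × ℝ) := by
    ext <;> simp [period, mul_comm]
  rw [e, ← add_assoc]
  exact ((h2.zsmul k.2) _).trans ((h1.zsmul k.1) x)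

theorem IsPeriodic.comp_wrap {f : ℝ × ℝ → ℝ} (h : IsPeriodic f) : f ∘ wrap = f := by
  ext x
  conv_rhs => rw [← wrap_add_period x]
  exact (h.add_period _ _).symm

theorem isPeriodic_comp_wrap (f : ℝ × ℝ → ℝ) : IsPeriodic (f ∘ wrap) := by
  intro x
  have hp := Real.pi_pos
  constructor
  · simp only [Function.comp, wrap, Prod.fst_add, Prod.snd_add, add_zero, add_div,
      div_self (show 2 * Real.pi ≠ 0 by positivity), Int.fract_add_one]
  · simp only [Function.comp, wrap, Prod.fst_add, Prod.snd_add, add_zero]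
    rw [add_right_comm, Int.fract_add_one]

theorem comp_wrap_ae_eq (f : ℝ × ℝ → ℝ) : f ∘ wrap =ᵐ[volume.restrict Ω] f := by
  rw [← restrict_interior_Ω]
  filter_upwards [ae_restrict_mem isOpen_interior.measurableSet] with x hx
  rw [Ω, interior_prod_eq, interior_Icc, interior_Icc] at hx
  have hp := Real.pi_pos
  obtain ⟨⟨h1, h2⟩, h3, h4⟩ := hx
  have : wrap x = x := by
    ext
    · simp only [wrap]
      rw [Int.fract_eq_self.2 ⟨by positivity, by rw [div_lt_one (by positivity)]; exact h2⟩]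
      field_simp
    · simp only [wrap]
      rw [Int.fract_eq_self.2 ⟨by linarith, by linarith⟩]; ring
  simp [this]

/-- A compact set meets finitely many period cells, and on each of them `wrap` is a translation into
Ω. -/
theorem exists_map_wrap_le {K : Set (ℝ × ℝ)} (hK : IsCompact K) :
    ∃ N : ℕ, (volume.restrict K).map wrap ≤ (N : ℝ≥0∞) • volume.restrict Ω := by
  obtain ⟨R, hR⟩ := hK.isBounded.exists_norm_le
  -- The margin 2 absorbs the rounding of the floors and the shift by 1/2 in z.
  set M : ℤ := ⌈R⌉ + 2
  set S : Finset (ℤ × ℤ) := Finset.Icc (-M) M ×ˢ Finset.Icc (-M) M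
  refine ⟨S.card, Measure.le_iff.2 fun A hA => ?_⟩
  rw [Measure.map_apply measurable_wrap hA,
    Measure.restrict_apply (measurable_wrap hA), Measure.smul_apply, Measure.restrict_apply hA]
  have hsub : wrap ⁻¹' A ∩ K ⊆ ⋃ k ∈ S, (fun x => x - period k) ⁻¹' (A ∩ Ω) := by
    rintro x ⟨hxA, hxK⟩
    simp only [mem_iUnion]
    refine ⟨(⌊x.1 / (2 * Real.pi)⌋, ⌊x.2 + 1 / 2⌋), ?_, ?_⟩
    · have hx := hR x hxK
      have h1 : |x.1| ≤ R := (norm_fst_le x).trans hx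
      have h2 : |x.2| ≤ R := (norm_snd_le x).trans hx
      have hc := Int.le_ceil R
      have hp : 1 < 2 * Real.pi := by linarith [Real.pi_gt_three]
      have h1' : |x.1 / (2 * Real.pi)| ≤ R := by
        rw [abs_div, abs_of_pos (show 0 < 2 * Real.pi by linarith)]
        exact (div_le_self (abs_nonneg _) hp.le).trans h1
      rw [abs_le] at h1' h2
      simp only [S, Finset.mem_product, Finset.mem_Icc, M]
      refine ⟨⟨Int.le_floor.2 ?_, ?_⟩, ⟨Int.le_floor.2 ?_, ?_⟩⟩
      · push_cast; linarith
      · have := Int.floor_le (x.1 / (2 * Real.pi))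
        have h3 : (⌊x.1 / (2 * Real.pi)⌋ : ℝ) ≤ ((⌈R⌉ + 2 : ℤ) : ℝ) := by push_cast; linarith
        exact_mod_cast h3
      · push_cast; linarith
      · have := Int.floor_le (x.2 + 1 / 2)
        have h3 : (⌊x.2 + 1 / 2⌋ : ℝ) ≤ ((⌈R⌉ + 2 : ℤ) : ℝ) := by push_cast; linarith
        exact_mod_cast h3
    · have : x - period (⌊x.1 / (2 * Real.pi)⌋, ⌊x.2 + 1 / 2⌋) = wrap x :=
        sub_eq_iff_eq_add.2 (wrap_add_period x).symm
      simp only [mem_preimage, this]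
      exact ⟨hxA, wrap_mem x⟩
  calc _ ≤ ∑ k ∈ S, volume ((fun x => x - period k) ⁻¹' (A ∩ Ω)) :=
        (measure_mono hsub).trans (measure_biUnion_finset_le _ _)
    _ = _ := by
        simp only [fun k => (measurePreserving_sub_right volume (period k)).measure_preimage
          (hA.inter measurableSet_Ω).nullMeasurableSet]
        simp

theorem exists_eLpNorm_comp_wrap_le {K : Set (ℝ × ℝ)} (hK : IsCompact K) :
    ∃ C : ℝ≥0∞, C ≠ ⊤ ∧ ∀ f : ℝ × ℝ → ℝ, AEStronglyMeasurable f (volume.restrict Ω) →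
      AEStronglyMeasurable (f ∘ wrap) (volume.restrict K) ∧
      eLpNorm (f ∘ wrap) 2 (volume.restrict K) ≤ C * eLpNorm f 2 (volume.restrict Ω) := by
  obtain ⟨N, hN⟩ := exists_map_wrap_le hK
  refine ⟨(N : ℝ≥0∞) ^ (1 / (2 : ℝ≥0∞).toReal),
    ENNReal.rpow_ne_top_of_nonneg (by norm_num) (by simp), fun f hf => ?_⟩
  have hfm : AEStronglyMeasurable f ((volume.restrict K).map wrap) :=
    (hf.smul_measure (N : ℝ≥0∞)).mono_measure hN
  refine ⟨hfm.comp_measurable measurable_wrap, ?_⟩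
  rw [← eLpNorm_map_measure hfm measurable_wrap.aemeasurable]
  refine (eLpNorm_mono_measure f hN).trans (le_of_eq ?_)
  rw [eLpNorm_smul_measure_of_ne_top (by norm_num)]
  simp

theorem memLp_comp_wrap {f : ℝ × ℝ → ℝ} (hf : MemLp f 2 (volume.restrict Ω)) {K : Set (ℝ × ℝ)}
    (hK : IsCompact K) : MemLp (f ∘ wrap) 2 (volume.restrict K) := by
  obtain ⟨C, hC, h⟩ := exists_eLpNorm_comp_wrap_le hK
  exact ⟨(h f hf.1).1, (h f hf.1).2.trans_lt (ENNReal.mul_lt_top hC.lt_top hf.2)⟩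

/-- The smooth approximants are periodic, hence unchanged by `wrap`. Their convergence on Ω
therefore gives convergence to the periodic extensions on the support of any test function, and
integration by parts passes to the limit without boundary terms. -/
theorem PerJet.hasWeakDeriv_comp_wrap {f g} (h : PerJet f g) (i : Fin 2) :
    HasWeakDeriv univ i (f ∘ wrap) (g i ∘ wrap) := by
  refine ⟨(locallyIntegrable_of_memLp fun K hK =>
      memLp_comp_wrap h.memLp hK).locallyIntegrableOn _,
    (locallyIntegrable_of_memLp fun K hK =>
      memLp_comp_wrap (h.memLp_deriv i) hK).locallyIntegrableOn _, fun χ h1 h2 _ => ?_⟩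
  obtain ⟨ψ, hψ, hψf, hψg⟩ := h.approx
  set K := tsupport χ
  have hK : IsCompact K := h2
  have c1 : Continuous fun x => fderiv ℝ χ x (dir i) := (contDiff_pd h1 i).continuous
  obtain ⟨C, hC, hCw⟩ := exists_eLpNorm_comp_wrap_le hK
  have lim : ∀ (F : ℕ → ℝ × ℝ → ℝ) (k χ' : ℝ × ℝ → ℝ), (∀ n, SmoothPer (F n)) →
      MemLp k 2 (volume.restrict Ω) → L2Tendsto atTop F k → Continuous χ' →
      Tendsto (fun n => ∫ x in K, F n x * χ' x) atTop (𝓝 (∫ x in K, (k ∘ wrap) x * χ' x)) := by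
    intro F k χ' hF hk hFk hχ'
    refine tendsto_integral_mul (fun n => memLp_of_continuous (hF n).1.continuous hK)
      (memLp_comp_wrap hk hK) (fun _ => memLp_of_continuous hχ' hK)
      (memLp_of_continuous hχ' hK) ?_ (by simp)
    have hz : Tendsto (fun n => C * eLpNorm (F n - k) 2 (volume.restrict Ω)) atTop (𝓝 (C * 0)) :=
      ENNReal.Tendsto.const_mul hFk (Or.inr hC)
    rw [mul_zero] at hz
    refine tendsto_of_tendsto_of_tendsto_of_le_of_le tendsto_const_nhds hz (fun _ => zero_le)
      fun n => ?_
    have := (hCw (F n - k) ((hF n).memLp.sub hk).1).2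
    rwa [show (F n - k) ∘ wrap = F n - k ∘ wrap by
      conv_rhs => rw [← (hF n).2.comp_wrap]
      rfl] at this
  have l1 := lim ψ f _ hψ h.memLp hψf c1
  have l2 := lim (fun n => pd i (ψ n)) (g i) χ (fun n => (hψ n).pd i) (h.memLp_deriv i)
    (hψg i) h1.continuous
  have red1 : ∀ k : ℝ × ℝ → ℝ, ∫ x in K, k x * fderiv ℝ χ x (dir i)
      = ∫ x in univ, k x * fderiv ℝ χ x (dir i) := fun k => by
    rw [Measure.restrict_univ]
    refine setIntegral_eq_integral_of_forall_compl_eq_zero fun x hx => ?_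
    have : x ∉ tsupport (fderiv ℝ χ) := fun h => hx (tsupport_fderiv_subset ℝ h)
    rw [image_eq_zero_of_notMem_tsupport this]; simp
  have red2 : ∀ k : ℝ × ℝ → ℝ, ∫ x in K, k x * χ x = ∫ x in univ, k x * χ x := fun k => by
    rw [Measure.restrict_univ]
    refine setIntegral_eq_integral_of_forall_compl_eq_zero fun x hx => ?_
    rw [image_eq_zero_of_notMem_tsupport hx]; simp
  simp only [red1, red2] at l1 l2
  refine tendsto_nhds_unique l1 (l2.neg.congr fun n => ?_)
  exact ((hasWeakDeriv_of_contDiff (hψ n).1 i).2.2 χ h1 h2 (subset_univ _)).symm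

theorem PerJet.memHPer {f g} (h : PerJet f g) : MemHPer 1 f :=
  ⟨f ∘ wrap, isPeriodic_comp_wrap f, ⟨fun _ hK => memLp_comp_wrap h.memLp hK, fun i =>
    ⟨g i ∘ wrap, h.hasWeakDeriv_comp_wrap i, fun _ hK => memLp_comp_wrap (h.memLp_deriv i) hK⟩⟩,
    comp_wrap_ae_eq f⟩

/-- The function and its derivatives may have unrelated approximating sequences; this is all that
weak limits of configurations provide. -/
theorem memHPer_two {f g} {H : Fin 2 → Fin 2 → ℝ × ℝ → ℝ} (h : PerJet f g)
    (hg : ∀ j, PerJet (g j) (H j)) : MemHPer 2 f :=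
  ⟨f ∘ wrap, isPeriodic_comp_wrap f, ⟨fun _ hK => memLp_comp_wrap h.memLp hK, fun i =>
    ⟨g i ∘ wrap, h.hasWeakDeriv_comp_wrap i, fun _ hK => memLp_comp_wrap (h.memLp_deriv i) hK,
      fun j => ⟨H i j ∘ wrap, (hg i).hasWeakDeriv_comp_wrap j,
        fun _ hK => memLp_comp_wrap ((hg i).memLp_deriv j) hK⟩⟩⟩, comp_wrap_ae_eq f⟩

theorem PerJet.hasWeakDeriv {f g} (h : PerJet f g) (i : Fin 2) :
    HasWeakDeriv (interior Ω) i f (g i) :=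
  ((h.hasWeakDeriv_comp_wrap i).mono (subset_univ _)).congr (by rw [restrict_interior_Ω]; exact comp_wrap_ae_eq f)
    (by rw [restrict_interior_Ω]; exact comp_wrap_ae_eq _)

theorem SmoothPer.perJet {ψ : ℝ × ℝ → ℝ} (h : SmoothPer ψ) : PerJet ψ (fun i => VKD.pd i ψ) :=
  ⟨h.memLp, fun i => (h.pd i).memLp, fun _ => ψ, fun _ => h, by simp [L2Tendsto],
    fun i => by simp [L2Tendsto]⟩

/-! ### One-dimensional inequalities -/

section OneDim

variable {a b : ℝ} {g g' : ℝ → ℝ}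

theorem integral_quadratic {f : ℝ → ℝ} (hf : Continuous f) (α β γ : ℝ) :
    ∫ t in a..b, (α * f t ^ 2 + β * f t + γ)
      = α * (∫ t in a..b, f t ^ 2) + β * (∫ t in a..b, f t) + (b - a) * γ := by
  have i1 := (continuous_const.fun_mul hf (f := fun _ => β)).intervalIntegrable (μ := volume) a b
  have i2 := (continuous_const.fun_mul (hf.fun_pow 2) (f := fun _ => α)).intervalIntegrable
    (μ := volume) a b
  rw [intervalIntegral.integral_add (i2.add i1) intervalIntegrable_const,
    intervalIntegral.integral_add i2 i1, intervalIntegral.integral_const_mul,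
    intervalIntegral.integral_const_mul, intervalIntegral.integral_const, smul_eq_mul]

theorem sq_integral_le {f : ℝ → ℝ} (hab : a ≤ b) (hf : Continuous f) :
    (∫ t in a..b, f t) ^ 2 ≤ (b - a) * ∫ t in a..b, f t ^ 2 := by
  rcases hab.eq_or_lt with rfl | hlt
  · simp
  set m := (∫ t in a..b, f t) / (b - a)
  have hm : m * (b - a) = ∫ t in a..b, f t := div_mul_cancel₀ _ (sub_pos.2 hlt).ne'
  have h : 0 ≤ ∫ t in a..b, (f t - m) ^ 2 :=
    intervalIntegral.integral_nonneg hab fun _ _ => sq_nonneg _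
  have e : ∫ t in a..b, (f t - m) ^ 2
      = (∫ t in a..b, f t ^ 2) - 2 * m * (∫ t in a..b, f t) + (b - a) * m ^ 2 := by
    rw [show (fun t => (f t - m) ^ 2) = fun t => 1 * f t ^ 2 + (-(2 * m)) * f t + m ^ 2 by
      ext t; ring, integral_quadratic hf]
    ring
  rw [e] at h
  have hp := sub_pos.2 hlt
  rw [← hm] at h ⊢
  nlinarith [mul_nonneg hp.le h]

theorem sq_sub_le_of_hasDerivAt (hg : ∀ t, HasDerivAt g (g' t) t) (hc : Continuous g')
    {x y : ℝ} (hx : x ∈ Icc a b) (hy : y ∈ Icc a b) :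
    (g x - g y) ^ 2 ≤ (b - a) * ∫ t in a..b, g' t ^ 2 := by
  wlog hxy : y ≤ x generalizing x y
  · have := this hy hx (le_of_not_ge hxy)
    nlinarith
  rw [← intervalIntegral.integral_eq_sub_of_hasDerivAt (fun t _ => hg t)
    (hc.intervalIntegrable _ _)]
  have hn : 0 ≤ᵐ[volume.restrict (Ioc a b)] fun t => g' t ^ 2 :=
    Eventually.of_forall fun _ => sq_nonneg _
  calc (∫ t in y..x, g' t) ^ 2 ≤ (x - y) * ∫ t in y..x, g' t ^ 2 := sq_integral_le hxy hc
    _ ≤ (b - a) * ∫ t in a..b, g' t ^ 2 := by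
      gcongr
      · exact intervalIntegral.integral_nonneg hxy fun _ _ => sq_nonneg _
      · linarith [hx.1.trans hx.2]
      · exact hx.2
      · exact hy.1
      · exact intervalIntegral.integral_mono_interval hy.1 hxy hx.2 hn
          ((hc.fun_pow 2).intervalIntegrable _ _)

theorem abs_sub_le_of_hasDerivAt (hg : ∀ t, HasDerivAt g (g' t) t) (hc : Continuous g')
    {x y : ℝ} (hx : x ∈ Icc a b) (hy : y ∈ Icc a b) :
    |g x - g y| ≤ ∫ t in a..b, |g' t| := by
  wlog hxy : y ≤ x generalizing x y
  · rw [abs_sub_comm]; exact this hy hx (le_of_not_ge hxy)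
  rw [← intervalIntegral.integral_eq_sub_of_hasDerivAt (fun t _ => hg t)
    (hc.intervalIntegrable _ _)]
  exact (intervalIntegral.abs_integral_le_integral_abs hxy).trans
    (intervalIntegral.integral_mono_interval hy.1 hxy hx.2
      (Eventually.of_forall fun _ => abs_nonneg _) (hc.abs.intervalIntegrable _ _))

theorem mul_le_integral_add (hg : ∀ t, HasDerivAt g (g' t) t) (hc : Continuous g')
    {x : ℝ} (hx : x ∈ Icc a b) :
    (b - a) * g x ≤ (∫ t in a..b, g t) + (b - a) * ∫ t in a..b, |g' t| := by
  have hab := hx.1.trans hx.2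
  have hgc : Continuous g := continuous_iff_continuousAt.2 fun t => (hg t).continuousAt
  have := intervalIntegral.integral_mono_on hab (f := fun _ => g x)
    (g := fun t => g t + ∫ t in a..b, |g' t|) (intervalIntegrable_const (μ := volume))
    ((hgc.intervalIntegrable _ _).add (intervalIntegrable_const (μ := volume))) (fun t ht => by
      have := (abs_le.1 (abs_sub_le_of_hasDerivAt hg hc hx ht)).2
      linarith)
  rw [intervalIntegral.integral_add (hgc.intervalIntegrable _ _) intervalIntegrable_const] at this
  simpa using this

/-- Integrate (g x − g y)² ≤ V first in y and then in x; the cross term becomes the square of the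
integral. -/
theorem integral_sq_le_of_osc {V : ℝ} (hab : a ≤ b) (hgc : Continuous g)
    (hV : ∀ x ∈ Icc a b, ∀ y ∈ Icc a b, (g x - g y) ^ 2 ≤ V) :
    (b - a) * ∫ t in a..b, g t ^ 2 ≤ (∫ t in a..b, g t) ^ 2 + (b - a) ^ 2 / 2 * V := by
  set I := ∫ t in a..b, g t with hI
  set J := ∫ t in a..b, g t ^ 2 with hJ
  have s1 : ∀ x ∈ Icc a b, (b - a) * g x ^ 2 - 2 * g x * I + J ≤ (b - a) * V := by
    intro x hx
    have := intervalIntegral.integral_mono_on hab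
      (f := fun t => 1 * g t ^ 2 + (-(2 * g x)) * g t + g x ^ 2) (g := fun _ => V)
      ((by fun_prop : Continuous fun t => 1 * g t ^ 2 + (-(2 * g x)) * g t
        + g x ^ 2).intervalIntegrable _ _)
      (intervalIntegrable_const (μ := volume)) (fun t ht => by have := hV x hx t ht; nlinarith)
    rw [integral_quadratic hgc, intervalIntegral.integral_const, smul_eq_mul] at this
    linarith
  have := intervalIntegral.integral_mono_on hab
    (f := fun x => (b - a) * g x ^ 2 + (-(2 * I)) * g x + J) (g := fun _ => (b - a) * V)
    ((by fun_prop : Continuous fun x => (b - a) * g x ^ 2 + (-(2 * I)) * g x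
      + J).intervalIntegrable _ _)
    (intervalIntegrable_const (μ := volume)) (fun t ht => by have := s1 t ht; linarith)
  rw [integral_quadratic hgc, intervalIntegral.integral_const, smul_eq_mul, ← hI, ← hJ] at this
  linarith

end OneDim

/-! ### Partial derivatives and integrals over rectangles -/

theorem hasDerivAt_fst {ψ : ℝ × ℝ → ℝ} (h : ContDiff ℝ ∞ ψ) (x y : ℝ) :
    HasDerivAt (fun t => ψ (t, y)) (pd 0 ψ (x, y)) x := by
  have h1 := ((h.differentiable (by simp)) (x, y)).hasFDerivAt
  have h2 : HasDerivAt (fun t : ℝ => (t, y)) ((1 : ℝ), (0 : ℝ)) x :=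
    (hasDerivAt_id x).prodMk (hasDerivAt_const x y)
  exact h1.comp_hasDerivAt x h2

theorem hasDerivAt_snd {ψ : ℝ × ℝ → ℝ} (h : ContDiff ℝ ∞ ψ) (x y : ℝ) :
    HasDerivAt (fun t => ψ (x, t)) (pd 1 ψ (x, y)) y := by
  have h1 := ((h.differentiable (by simp)) (x, y)).hasFDerivAt
  have h2 : HasDerivAt (fun t : ℝ => (x, t)) ((0 : ℝ), (1 : ℝ)) y :=
    (hasDerivAt_const y x).prodMk (hasDerivAt_id y)
  exact h1.comp_hasDerivAt y h2

section Rect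

variable {a b c d : ℝ} {f : ℝ × ℝ → ℝ}

theorem continuous_inner_snd (hf : Continuous f) : Continuous fun x => ∫ y in c..d, f (x, y) :=
  intervalIntegral.continuous_parametric_intervalIntegral_of_continuous'
    (f := fun x y => f (x, y)) hf c d

theorem continuous_inner_fst (hf : Continuous f) : Continuous fun y => ∫ x in a..b, f (x, y) :=
  intervalIntegral.continuous_parametric_intervalIntegral_of_continuous'
    (f := fun y x => f (x, y)) (hf.comp continuous_swap) a b

theorem rect_integral (hab : a ≤ b) (hcd : c ≤ d) (hf : Continuous f) :
    ∫ x in Icc a b ×ˢ Icc c d, f x = ∫ x in a..b, ∫ y in c..d, f (x, y) := by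
  rw [Measure.volume_eq_prod, setIntegral_prod _
    (hf.continuousOn.integrableOn_compact (isCompact_Icc.prod isCompact_Icc)),
    intervalIntegral.integral_of_le hab, integral_Icc_eq_integral_Ioc]
  simp only [integral_Icc_eq_integral_Ioc, intervalIntegral.integral_of_le hcd]

theorem rect_integral_swap (hab : a ≤ b) (hcd : c ≤ d) (hf : Continuous f) :
    ∫ x in Icc a b ×ˢ Icc c d, f x = ∫ y in c..d, ∫ x in a..b, f (x, y) := by
  rw [rect_integral hab hcd hf]
  simp only [intervalIntegral.integral_of_le hab, intervalIntegral.integral_of_le hcd]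
  refine integral_integral_swap (f := fun x y => f (x, y)) ?_
  rw [Measure.prod_restrict]
  exact (hf.continuousOn.integrableOn_compact (isCompact_Icc.prod isCompact_Icc)).mono_set
    (prod_mono Ioc_subset_Icc_self Ioc_subset_Icc_self)

/-- The one-dimensional estimate is used on each horizontal line and again for the horizontal
integrals `G`, whose oscillation is controlled by the vertical derivative. The explicit quadratic
dependence on the side lengths is what makes subdivision effective in the compactness proof. -/
theorem poincare_rect {ψ : ℝ × ℝ → ℝ} (hab : a < b) (hcd : c < d) (h : ContDiff ℝ ∞ ψ) :
    ∫ x in Icc a b ×ˢ Icc c d, ψ x ^ 2 ≤ (∫ x in Icc a b ×ˢ Icc c d, ψ x) ^ 2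
        / ((b - a) * (d - c)) + (b - a) ^ 2 / 2 * (∫ x in Icc a b ×ˢ Icc c d, pd 0 ψ x ^ 2)
        + (d - c) ^ 2 / 2 * ∫ x in Icc a b ×ˢ Icc c d, pd 1 ψ x ^ 2 := by
  have hc := h.continuous
  have hc0 := (contDiff_pd h 0).continuous
  have hc1 := (contDiff_pd h 1).continuous
  rw [rect_integral_swap hab.le hcd.le (hc.fun_pow 2), rect_integral_swap hab.le hcd.le hc,
    rect_integral_swap hab.le hcd.le (hc0.fun_pow 2), rect_integral hab.le hcd.le (hc1.fun_pow 2)]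
  set G : ℝ → ℝ := fun y => ∫ x in a..b, ψ (x, y) with hG
  have hGc : Continuous G := continuous_inner_fst hc
  have cs : ∀ y, Continuous fun x => ψ (x, y) := fun y => hc.comp (by fun_prop)
  have cs1 : ∀ x, Continuous fun y => pd 1 ψ (x, y) := fun y => hc1.comp (by fun_prop)
  have cs0 : ∀ y, Continuous fun x => pd 0 ψ (x, y) := fun y => hc0.comp (by fun_prop)
  have cB : Continuous fun x => ∫ y in c..d, pd 1 ψ (x, y) ^ 2 := continuous_inner_snd (hc1.fun_pow 2)
  have cA : Continuous fun y => ∫ x in a..b, pd 0 ψ (x, y) ^ 2 := continuous_inner_fst (hc0.fun_pow 2)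
  have cP : Continuous fun y => ∫ x in a..b, ψ (x, y) ^ 2 := continuous_inner_fst (hc.fun_pow 2)
  have hs := sub_pos.2 hab
  have ht := sub_pos.2 hcd
  have h1 : ∀ y, (b - a) * ∫ x in a..b, ψ (x, y) ^ 2
      ≤ G y ^ 2 + (b - a) ^ 2 / 2 * ((b - a) * ∫ x in a..b, pd 0 ψ (x, y) ^ 2) := fun y =>
    integral_sq_le_of_osc hab.le (cs y) fun u hu v hv =>
      sq_sub_le_of_hasDerivAt (fun t => hasDerivAt_fst h t y) (cs0 y) hu hv
  have h2 : ∀ u ∈ Icc c d, ∀ v ∈ Icc c d, (G u - G v) ^ 2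
      ≤ (b - a) * ∫ x in a..b, (d - c) * ∫ y in c..d, pd 1 ψ (x, y) ^ 2 := by
    intro u hu v hv
    have e : G u - G v = ∫ x in a..b, (ψ (x, u) - ψ (x, v)) :=
      (intervalIntegral.integral_sub ((cs u).intervalIntegrable _ _)
        ((cs v).intervalIntegrable _ _)).symm
    rw [e]
    refine (sq_integral_le hab.le ((cs u).sub (cs v))).trans ?_
    gcongr
    refine intervalIntegral.integral_mono_on hab.le ((((cs u).sub (cs v)).fun_pow 2).intervalIntegrable
      _ _) ((cB.const_mul _).intervalIntegrable _ _) fun x _ => ?_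
    exact sq_sub_le_of_hasDerivAt (fun t => hasDerivAt_snd h x t) (cs1 x) hu hv
  have h3 := integral_sq_le_of_osc hcd.le hGc h2
  have h4 := intervalIntegral.integral_mono_on hcd.le
    ((cP.const_mul _).intervalIntegrable (μ := volume) _ _)
    (((hGc.fun_pow 2).add ((cA.const_mul _).const_mul _)).intervalIntegrable c d) (fun y _ => h1 y)
  simp only [Pi.add_apply] at h4
  rw [intervalIntegral.integral_add ((hGc.fun_pow 2).intervalIntegrable _ _)
    (((cA.const_mul _).const_mul _).intervalIntegrable _ _)] at h4
  simp only [intervalIntegral.integral_const_mul] at h3 h4 ⊢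
  have hst := mul_pos hs ht
  rw [← mul_le_mul_iff_right₀ hst]
  have e : (b - a) * (d - c) * ((∫ y in c..d, G y) ^ 2 / ((b - a) * (d - c)))
      = (∫ y in c..d, G y) ^ 2 := by field_simp
  rw [mul_add, mul_add, e]
  nlinarith [mul_le_mul_of_nonneg_left h4 ht.le]

end Rect

theorem pi2_pos : (0 : ℝ) < 2 * Real.pi := by positivity

theorem integral_Ω {f : ℝ × ℝ → ℝ} (hf : Continuous f) :
    ∫ x in Ω, f x = ∫ x in (0)..(2 * Real.pi), ∫ y in (-(1 / 2))..(1 / 2), f (x, y) :=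
  rect_integral pi2_pos.le (by norm_num) hf

theorem integral_Ω_swap {f : ℝ × ℝ → ℝ} (hf : Continuous f) :
    ∫ x in Ω, f x = ∫ y in (-(1 / 2))..(1 / 2), ∫ x in (0)..(2 * Real.pi), f (x, y) :=
  rect_integral_swap pi2_pos.le (by norm_num) hf

theorem integral_slice_pd_one {ψ : ℝ × ℝ → ℝ} (h : SmoothPer ψ) (x : ℝ) :
    ∫ y in (-(1 / 2))..(1 / 2), pd 1 ψ (x, y) = 0 := by
  rw [intervalIntegral.integral_eq_sub_of_hasDerivAt (fun t _ => hasDerivAt_snd h.1 x t)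
    (((contDiff_pd h.1 1).continuous.comp (by fun_prop : Continuous fun y : ℝ =>
      (x, y))).intervalIntegrable _ _)]
  have := (h.2 (x, -(1 / 2))).2
  rw [show ((x, -(1 / 2)) : ℝ × ℝ) + (0, 1) = (x, 1 / 2) by ext <;> norm_num] at this
  rw [this, sub_self]

theorem integral_slice_pd_zero {ψ : ℝ × ℝ → ℝ} (h : SmoothPer ψ) (y : ℝ) :
    ∫ x in (0)..(2 * Real.pi), pd 0 ψ (x, y) = 0 := by
  rw [intervalIntegral.integral_eq_sub_of_hasDerivAt (fun t _ => hasDerivAt_fst h.1 t y)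
    (((contDiff_pd h.1 0).continuous.comp (by fun_prop : Continuous fun x : ℝ =>
      (x, y))).intervalIntegrable _ _)]
  have := (h.2 (0, y)).1
  rw [show ((0, y) : ℝ × ℝ) + (2 * Real.pi, 0) = (2 * Real.pi, y) by ext <;> norm_num] at this
  rw [this, sub_self]

theorem integral_pd {ψ : ℝ × ℝ → ℝ} (h : SmoothPer ψ) (i : Fin 2) : ∫ x in Ω, pd i ψ x = 0 := by
  fin_cases i
  · change ∫ x in Ω, pd 0 ψ x = 0
    rw [integral_Ω_swap (contDiff_pd h.1 0).continuous]
    simp only [integral_slice_pd_zero h, intervalIntegral.integral_zero]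
  · change ∫ x in Ω, pd 1 ψ x = 0
    rw [integral_Ω (contDiff_pd h.1 1).continuous]
    simp only [integral_slice_pd_one h, intervalIntegral.integral_zero]

theorem SmoothPer.mul {f g : ℝ × ℝ → ℝ} (hf : SmoothPer f) (hg : SmoothPer g) :
    SmoothPer (fun x => f x * g x) :=
  ⟨hf.1.mul hg.1, fun x => ⟨by
    simp only [(hf.2 x).1, (hg.2 x).1], by simp only [(hf.2 x).2, (hg.2 x).2]⟩⟩

theorem pd_mul {f g : ℝ × ℝ → ℝ} (hf : ContDiff ℝ ∞ f) (hg : ContDiff ℝ ∞ g) (i : Fin 2)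
    (x : ℝ × ℝ) : pd i (fun x => f x * g x) x = f x * pd i g x + g x * pd i f x := by
  rw [pd, fderiv_fun_mul (hf.differentiable (by simp) x) (hg.differentiable (by simp) x)]
  simp [pd]

theorem pd_comm {f : ℝ × ℝ → ℝ} (hf : ContDiff ℝ ∞ f) (i j : Fin 2) (x : ℝ × ℝ) :
    pd i (pd j f) x = pd j (pd i f) x := by
  have hd : DifferentiableAt ℝ (fderiv ℝ f) x :=
    ((hf.fderiv_right (m := ∞) (by simp)).differentiable (by simp)) x
  have e : ∀ i j : Fin 2, pd i (pd j f) x = fderiv ℝ (fderiv ℝ f) x (dir i) (dir j) := by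
    intro i j
    change fderiv ℝ (fun y => fderiv ℝ f y (dir j)) x (dir i) = _
    rw [fderiv_clm_apply hd (differentiableAt_const _)]
    simp
  rw [e, e]
  exact (hf.contDiffAt.isSymmSndFDerivAt (by
    simpa using (WithTop.coe_le_coe.2 (le_top : (2 : ℕ∞) ≤ ⊤)))) _ _

/-- Both ∂_θ(b ∂_z a) and ∂_z(b ∂_θ a) have integral zero, and their mixed second derivatives cancel
on subtraction. -/
theorem korn_smooth {a b : ℝ × ℝ → ℝ} (ha : SmoothPer a) (hb : SmoothPer b) :
    ∫ x in Ω, pd 0 b x * pd 1 a x = ∫ x in Ω, pd 1 b x * pd 0 a x := by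
  have ca : ∀ i, Continuous (pd i a) := fun i => (contDiff_pd ha.1 i).continuous
  have cb : ∀ i, Continuous (pd i b) := fun i => (contDiff_pd hb.1 i).continuous
  have ii : ∀ f : ℝ × ℝ → ℝ, Continuous f → IntegrableOn f Ω := fun f hf =>
    hf.continuousOn.integrableOn_compact isCompact_Ω
  have h1 := integral_pd (hb.mul (ha.pd 1)) 0
  have h2 := integral_pd (hb.mul (ha.pd 0)) 1
  simp only [pd_mul hb.1 (ha.pd _).1] at h1 h2
  have c10 : Continuous (pd 0 (pd 1 a)) := (contDiff_pd (ha.pd 1).1 0).continuous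
  have c01 : Continuous (pd 1 (pd 0 a)) := (contDiff_pd (ha.pd 0).1 1).continuous
  rw [integral_add (ii _ (hb.1.continuous.fun_mul c10)) (ii _ ((ca 1).fun_mul (cb 0)))] at h1
  rw [integral_add (ii _ (hb.1.continuous.fun_mul c01)) (ii _ ((ca 0).fun_mul (cb 1)))] at h2
  simp only [pd_comm ha.1 0 1] at h1
  simp only [mul_comm (pd _ b _)]
  linarith

/-! ### Inequalities for jets -/

theorem integrableOn_Ω {f : ℝ × ℝ → ℝ} (hf : Continuous f) : IntegrableOn f Ω :=
  hf.continuousOn.integrableOn_compact isCompact_Ω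

/-- The value of g² at a point is at most its mean plus ∫|2 g g'|; because the interval has length
at least 1, the mean is at most the integral. -/
theorem sq_le_of_slice {a b : ℝ} {g g' : ℝ → ℝ} (hab : 1 ≤ b - a)
    (hg : ∀ t, HasDerivAt g (g' t) t) (hc : Continuous g') {x : ℝ} (hx : x ∈ Icc a b) :
    g x ^ 2 ≤ ∫ t in a..b, (2 * g t ^ 2 + g' t ^ 2) := by
  have hgc : Continuous g := continuous_iff_continuousAt.2 fun t => (hg t).continuousAt
  have hle : a ≤ b := by linarith
  have h1 : ∀ t, HasDerivAt (fun t => g t ^ 2) (2 * g t * g' t) t := fun t => by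
    simpa using (hg t).fun_pow 2
  have h2 := mul_le_integral_add h1 ((continuous_const.mul hgc).mul hc) hx
  have h3 : ∫ t in a..b, |2 * g t * g' t| ≤ ∫ t in a..b, (g t ^ 2 + g' t ^ 2) := by
    refine intervalIntegral.integral_mono_on hle
      ((by fun_prop : Continuous fun t => |2 * g t * g' t|).intervalIntegrable _ _)
      ((by fun_prop : Continuous fun t => g t ^ 2 + g' t ^ 2).intervalIntegrable _ _)
      fun t _ => ?_
    rw [abs_le]
    constructor <;> nlinarith [sq_nonneg (g t + g' t), sq_nonneg (g t - g' t)]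
  have i1 : IntervalIntegrable (fun t => g t ^ 2) volume a b :=
    (hgc.fun_pow 2).intervalIntegrable _ _
  have i2 : IntervalIntegrable (fun t => g' t ^ 2) volume a b :=
    (hc.fun_pow 2).intervalIntegrable _ _
  rw [intervalIntegral.integral_add i1 i2] at h3
  rw [intervalIntegral.integral_add (i1.const_mul _) i2, intervalIntegral.integral_const_mul]
  have p1 : 0 ≤ ∫ t in a..b, g t ^ 2 :=
    intervalIntegral.integral_nonneg hle fun _ _ => sq_nonneg _
  have p2 : 0 ≤ ∫ t in a..b, g' t ^ 2 :=
    intervalIntegral.integral_nonneg hle fun _ _ => sq_nonneg _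
  have h4 := mul_le_mul_of_nonneg_left h3 (by linarith : 0 ≤ b - a)
  have h5 : (b - a) * g x ^ 2 ≤ (b - a) * (2 * (∫ t in a..b, g t ^ 2) + ∫ t in a..b, g' t ^ 2) := by
    nlinarith
  exact le_of_mul_le_mul_left h5 (by linarith)

/-- The slice estimate bounds ψ² once by a function of θ alone and once by a function of z alone.
Hence ψ⁴ is at most a product that Fubini factorises. -/
theorem ladyzhenskaya_smooth {ψ : ℝ × ℝ → ℝ} (h : ContDiff ℝ ∞ ψ) :
    ∫ x in Ω, ψ x ^ 4 ≤ 4 * ((∫ x in Ω, ψ x ^ 2) + (∫ x in Ω, pd 0 ψ x ^ 2)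
      + ∫ x in Ω, pd 1 ψ x ^ 2) ^ 2 := by
  have hc := h.continuous
  have hc0 := (contDiff_pd h 0).continuous
  have hc1 := (contDiff_pd h 1).continuous
  have k0 : Continuous fun x => 2 * ψ x ^ 2 + pd 0 ψ x ^ 2 := by fun_prop
  have k1 : Continuous fun x => 2 * ψ x ^ 2 + pd 1 ψ x ^ 2 := by fun_prop
  set P : ℝ → ℝ := fun y => ∫ x in (0)..(2 * Real.pi), (2 * ψ (x, y) ^ 2 + pd 0 ψ (x, y) ^ 2)
  set Q : ℝ → ℝ := fun x => ∫ y in (-(1 / 2))..(1 / 2), (2 * ψ (x, y) ^ 2 + pd 1 ψ (x, y) ^ 2)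
  have hP : Continuous P := continuous_inner_fst k0
  have hQ : Continuous Q := continuous_inner_snd k1
  have hPQ : ∫ x in Ω, ψ x ^ 4 ≤ ∫ x in Ω, Q x.1 * P x.2 := by
    refine setIntegral_mono_on (integrableOn_Ω (hc.fun_pow 4)) (integrableOn_Ω (by fun_prop))
      measurableSet_Ω fun x hx => ?_
    have e1 : ψ x ^ 2 ≤ P x.2 := sq_le_of_slice (g := fun t => ψ (t, x.2))
      (by linarith [Real.pi_gt_three]) (fun t => hasDerivAt_fst h t x.2)
      (hc0.comp (by fun_prop)) hx.1
    have e2 : ψ x ^ 2 ≤ Q x.1 := sq_le_of_slice (g := fun t => ψ (x.1, t))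
      (by norm_num) (fun t => hasDerivAt_snd h x.1 t) (hc1.comp (by fun_prop)) hx.2
    calc ψ x ^ 4 = ψ x ^ 2 * ψ x ^ 2 := by ring
      _ ≤ _ := mul_le_mul e2 e1 (sq_nonneg _) ((sq_nonneg _).trans e2)
  have e : ∫ x in Ω, Q x.1 * P x.2 = (∫ x in Ω, (2 * ψ x ^ 2 + pd 1 ψ x ^ 2))
      * ∫ x in Ω, (2 * ψ x ^ 2 + pd 0 ψ x ^ 2) := by
    rw [integral_Ω (by fun_prop), integral_Ω k1, integral_Ω_swap k0]
    simp only [intervalIntegral.integral_const_mul]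
    rw [intervalIntegral.integral_mul_const]
  have i0 := integrableOn_Ω (hc.fun_pow 2)
  rw [e, integral_add (i0.const_mul _) (integrableOn_Ω (hc0.fun_pow 2)),
    integral_add (i0.const_mul _) (integrableOn_Ω (hc1.fun_pow 2)), integral_const_mul] at hPQ
  have n0 : 0 ≤ ∫ x in Ω, ψ x ^ 2 := integral_nonneg fun _ => sq_nonneg _
  have n1 : 0 ≤ ∫ x in Ω, pd 0 ψ x ^ 2 := integral_nonneg fun _ => sq_nonneg _
  have n2 : 0 ≤ ∫ x in Ω, pd 1 ψ x ^ 2 := integral_nonneg fun _ => sq_nonneg _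
  nlinarith [mul_nonneg n0 n1, mul_nonneg n0 n2, mul_nonneg n1 n2, sq_nonneg (∫ x in Ω, pd 0 ψ x ^ 2), sq_nonneg (∫ x in Ω, pd 1 ψ x ^ 2)]

theorem L2Tendsto.restrict {ι : Type*} {l : Filter ι} {F : ι → ℝ × ℝ → ℝ} {f : ℝ × ℝ → ℝ}
    (h : L2Tendsto l F f) {Q : Set (ℝ × ℝ)} (hQ : Q ⊆ Ω) :
    Tendsto (fun n => eLpNorm (F n - f) 2 (volume.restrict Q)) l (𝓝 0) :=
  tendsto_of_tendsto_of_tendsto_of_le_of_le tendsto_const_nhds h (fun _ => zero_le)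
    fun _ => eLpNorm_mono_measure _ (Measure.restrict_mono hQ le_rfl)

theorem L2Tendsto.integral_mul {ι : Type*} {l : Filter ι} {F G : ι → ℝ × ℝ → ℝ}
    {f g : ℝ × ℝ → ℝ} (h : L2Tendsto l F f) (h' : L2Tendsto l G g)
    (hF : ∀ n, MemLp (F n) 2 (volume.restrict Ω)) (hf : MemLp f 2 (volume.restrict Ω))
    (hG : ∀ n, MemLp (G n) 2 (volume.restrict Ω)) (hg : MemLp g 2 (volume.restrict Ω)) :
    Tendsto (fun n => ∫ x in Ω, F n x * G n x) l (𝓝 (∫ x in Ω, f x * g x)) :=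
  tendsto_integral_mul hF hf hG hg h h'

theorem l2Tendsto_const {ι : Type*} {l : Filter ι} (f : ℝ × ℝ → ℝ) :
    L2Tendsto l (fun _ => f) f := by
  simp [L2Tendsto, tendsto_const_nhds]

theorem L2Tendsto.integral_sq {ι : Type*} {l : Filter ι} {F : ι → ℝ × ℝ → ℝ}
    {f : ℝ × ℝ → ℝ} (h : L2Tendsto l F f)
    (hF : ∀ n, MemLp (F n) 2 (volume.restrict Ω)) (hf : MemLp f 2 (volume.restrict Ω)) :
    Tendsto (fun n => ∫ x in Ω, F n x ^ 2) l (𝓝 (∫ x in Ω, f x ^ 2)) := by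
  simpa only [pow_two] using h.integral_mul h hF hf hF hf

theorem PerJet.integral_deriv {f g} (h : PerJet f g) (i : Fin 2) : ∫ x in Ω, g i x = 0 := by
  obtain ⟨ψ, hψ, -, hg⟩ := h.approx
  have := (hg i).integral_mul (l2Tendsto_const fun _ => 1) (fun n => ((hψ n).pd i).memLp)
    (h.memLp_deriv i) (fun _ => memLp_const 1) (memLp_const 1)
  simp only [mul_one, fun n => integral_pd (hψ n) i] at this
  exact (tendsto_nhds_unique this tendsto_const_nhds)

theorem memLp_indicator_fst {T : Set ℝ} (hT : MeasurableSet T) :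
    MemLp (fun x : ℝ × ℝ => T.indicator (fun _ => (1 : ℝ)) x.1) 2 (volume.restrict Ω) := by
  refine MemLp.of_bound ((measurable_const.indicator hT).comp
    measurable_fst).aestronglyMeasurable 1 (Eventually.of_forall fun x => ?_)
  refine (norm_indicator_le_norm_self (f := fun _ : ℝ => (1 : ℝ)) _).trans (by simp)

/-- On every line θ = const the z-derivative of a periodic function has mean zero, so a weight
depending on θ alone is harmless. This removes the axial displacement from the axial strain on any
chosen set of slices. -/
theorem PerJet.integral_strip {f g} (h : PerJet f g) {T : Set ℝ} (hT : MeasurableSet T) :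
    ∫ x in Ω, T.indicator (fun _ => (1 : ℝ)) x.1 * g 1 x = 0 := by
  obtain ⟨ψ, hψ, -, hg⟩ := h.approx
  have := (l2Tendsto_const _).integral_mul (hg 1) (fun _ => memLp_indicator_fst hT)
    (memLp_indicator_fst hT) (fun n => ((hψ n).pd 1).memLp) (h.memLp_deriv 1)
  refine tendsto_nhds_unique this (tendsto_const_nhds.congr fun n => ?_)
  have hi : IntegrableOn (fun x : ℝ × ℝ => T.indicator (fun _ => (1 : ℝ)) x.1 * pd 1 (ψ n) x) Ω :=
    (memLp_indicator_fst hT).integrable_mul ((hψ n).pd 1).memLp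
  rw [Ω, Measure.volume_eq_prod, setIntegral_prod _ hi]
  simp only [integral_const_mul, integral_Icc_eq_integral_Ioc,
    ← intervalIntegral.integral_of_le (show -(1 / 2 : ℝ) ≤ 1 / 2 by norm_num),
    integral_slice_pd_one (hψ n), mul_zero, integral_zero]

theorem PerJet.korn {a b : ℝ × ℝ → ℝ} {ga gb : Fin 2 → ℝ × ℝ → ℝ} (ha : PerJet a ga)
    (hb : PerJet b gb) : ∫ x in Ω, gb 0 x * ga 1 x = ∫ x in Ω, gb 1 x * ga 0 x := by
  obtain ⟨ψ, hψ, -, hg⟩ := ha.approx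
  obtain ⟨χ, hχ, -, hk⟩ := hb.approx
  have key := fun i j => (hk i).integral_mul (hg j) (fun n => ((hχ n).pd i).memLp)
    (hb.memLp_deriv i) (fun n => ((hψ n).pd j).memLp) (ha.memLp_deriv j)
  exact tendsto_nhds_unique (key 0 1)
    ((key 1 0).congr fun n => (korn_smooth (hψ n) (hχ n)).symm)

theorem PerJet.poincare {f g} (h : PerJet f g) {a b c d : ℝ} (hab : a < b) (hcd : c < d)
    (hQ : Icc a b ×ˢ Icc c d ⊆ Ω) :
    ∫ x in Icc a b ×ˢ Icc c d, f x ^ 2 ≤ (∫ x in Icc a b ×ˢ Icc c d, f x) ^ 2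
        / ((b - a) * (d - c)) + (b - a) ^ 2 / 2 * (∫ x in Icc a b ×ˢ Icc c d, g 0 x ^ 2)
        + (d - c) ^ 2 / 2 * ∫ x in Icc a b ×ˢ Icc c d, g 1 x ^ 2 := by
  obtain ⟨ψ, hψ, hf, hg⟩ := h.approx
  set Q := Icc a b ×ˢ Icc c d
  have hm : volume.restrict Q ≤ volume.restrict Ω := Measure.restrict_mono hQ le_rfl
  have : IsFiniteMeasure (volume.restrict Q) :=
    ⟨(hm univ).trans_lt (measure_lt_top _ _)⟩
  have lim : ∀ {F : ℕ → ℝ × ℝ → ℝ} {k : ℝ × ℝ → ℝ}, (∀ n, SmoothPer (F n)) →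
      MemLp k 2 (volume.restrict Ω) → L2Tendsto atTop F k →
      Tendsto (fun n => ∫ x in Q, F n x ^ 2) atTop (𝓝 (∫ x in Q, k x ^ 2)) := by
    intro F k hF hk hFk
    have := tendsto_integral_mul (fun n => (hF n).memLp.mono_measure hm) (hk.mono_measure hm)
      (fun n => (hF n).memLp.mono_measure hm) (hk.mono_measure hm)
      (hFk.restrict hQ) (hFk.restrict hQ)
    simpa only [pow_two] using this
  have l0 : Tendsto (fun n => ∫ x in Q, ψ n x) atTop (𝓝 (∫ x in Q, f x)) := by
    have := tendsto_integral_mul (fun n => (hψ n).memLp.mono_measure hm)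
      (h.memLp.mono_measure hm) (G := fun _ _ => (1 : ℝ)) (g := fun _ => 1)
      (fun n => memLp_const 1) (memLp_const 1) (hf.restrict hQ) (by simp)
    simpa only [mul_one] using this
  exact le_of_tendsto_of_tendsto' (lim hψ h.memLp hf)
    ((((l0.pow 2).div_const _).add ((lim (fun n => (hψ n).pd 0) (h.memLp_deriv 0)
      (hg 0)).const_mul _)).add ((lim (fun n => (hψ n).pd 1) (h.memLp_deriv 1)
      (hg 1)).const_mul _)) fun n => poincare_rect hab hcd (hψ n).1

theorem lintegral_enorm_pow_four {f : ℝ × ℝ → ℝ} (hi : IntegrableOn (fun x => f x ^ 4) Ω) :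
    ∫⁻ x in Ω, ‖f x‖ₑ ^ 4 = ENNReal.ofReal (∫ x in Ω, f x ^ 4) := by
  rw [ofReal_integral_eq_lintegral_ofReal hi (Eventually.of_forall fun x => by positivity)]
  refine lintegral_congr fun x => ?_
  rw [← enorm_pow, Real.enorm_eq_ofReal (by positivity)]

/-- Fatou's lemma along an a.e. convergent subsequence of the approximants. -/
theorem PerJet.ladyzhenskaya {f g} (h : PerJet f g) :
    IntegrableOn (fun x => f x ^ 4) Ω ∧
    ∫ x in Ω, f x ^ 4 ≤ 4 * ((∫ x in Ω, f x ^ 2) + (∫ x in Ω, g 0 x ^ 2)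
      + ∫ x in Ω, g 1 x ^ 2) ^ 2 := by
  obtain ⟨ψ, hψ, hf, hg⟩ := h.approx
  set B := 4 * ((∫ x in Ω, f x ^ 2) + (∫ x in Ω, g 0 x ^ 2) + ∫ x in Ω, g 1 x ^ 2) ^ 2
  have hlim : Tendsto (fun n => 4 * ((∫ x in Ω, ψ n x ^ 2) + (∫ x in Ω, pd 0 (ψ n) x ^ 2)
      + ∫ x in Ω, pd 1 (ψ n) x ^ 2) ^ 2) atTop (𝓝 B) :=
    ((((hf.integral_sq (fun n => (hψ n).memLp) h.memLp).add
      ((hg 0).integral_sq (fun n => ((hψ n).pd 0).memLp) (h.memLp_deriv 0))).add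
      ((hg 1).integral_sq (fun n => ((hψ n).pd 1).memLp) (h.memLp_deriv 1))).pow 2).const_mul 4
  have him := tendstoInMeasure_of_tendsto_eLpNorm (by norm_num)
    (fun n => (hψ n).memLp.1) h.memLp.1 hf
  obtain ⟨ns, hns, hae⟩ := him.exists_seq_tendsto_ae
  have hB : 0 ≤ B := by positivity
  have key : ∫⁻ x in Ω, ‖f x‖ₑ ^ 4 ≤ ENNReal.ofReal B := by
    calc ∫⁻ x in Ω, ‖f x‖ₑ ^ 4
        ≤ ∫⁻ x in Ω, liminf (fun n => ‖ψ (ns n) x‖ₑ ^ 4) atTop := by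
          refine lintegral_mono_ae ?_
          filter_upwards [hae] with x hx
          exact (((ENNReal.continuous_pow 4).tendsto _).comp
            ((continuous_enorm.tendsto _).comp hx)).liminf_eq.ge
      _ ≤ liminf (fun n => ∫⁻ x in Ω, ‖ψ (ns n) x‖ₑ ^ 4) atTop :=
          lintegral_liminf_le fun n => ((hψ _).1.continuous.measurable.enorm.pow_const 4)
      _ ≤ liminf (fun n => ENNReal.ofReal (4 * ((∫ x in Ω, ψ (ns n) x ^ 2)
            + (∫ x in Ω, pd 0 (ψ (ns n)) x ^ 2) + ∫ x in Ω, pd 1 (ψ (ns n)) x ^ 2) ^ 2)) atTop := by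
          refine liminf_le_liminf (Eventually.of_forall fun n => ?_)
          rw [lintegral_enorm_pow_four (integrableOn_Ω ((hψ _).1.continuous.fun_pow 4))]
          exact ENNReal.ofReal_le_ofReal (ladyzhenskaya_smooth (hψ _).1)
      _ = ENNReal.ofReal B :=
          ((ENNReal.continuous_ofReal.tendsto _).comp (hlim.comp hns.tendsto_atTop)).liminf_eq
  have hi : IntegrableOn (fun x => f x ^ 4) Ω := by
    refine ⟨h.memLp.1.pow 4, ?_⟩
    rw [HasFiniteIntegral]
    simp only [enorm_pow]
    exact key.trans_lt ENNReal.ofReal_lt_top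
  refine ⟨hi, ?_⟩
  rw [lintegral_enorm_pow_four hi] at key
  exact (ENNReal.ofReal_le_ofReal_iff hB).1 key

theorem PerJet.memLp_mul {f k g l} (hf : PerJet f g) (hk : PerJet k l) :
    MemLp (fun x => f x * k x) 2 (volume.restrict Ω) ∧
      ∫ x in Ω, (f x * k x) ^ 2 ≤ (∫ x in Ω, f x ^ 4) + ∫ x in Ω, k x ^ 4 := by
  have hm : AEStronglyMeasurable (fun x => f x * k x) (volume.restrict Ω) :=
    hf.memLp.1.mul hk.memLp.1
  have i1 := hf.ladyzhenskaya.1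
  have i2 := hk.ladyzhenskaya.1
  have hb : ∀ x, (f x * k x) ^ 2 ≤ f x ^ 4 + k x ^ 4 := fun x => by
    nlinarith [sq_nonneg (f x ^ 2 - k x ^ 2), sq_nonneg (f x ^ 2), sq_nonneg (k x ^ 2)]
  have hi : IntegrableOn (fun x => (f x * k x) ^ 2) Ω :=
    (i1.add i2).mono' (hm.pow 2) (Eventually.of_forall fun x => by
      rw [Real.norm_of_nonneg (sq_nonneg _)]; exact hb x)
  refine ⟨(memLp_two_iff_integrable_sq hm).2 hi, ?_⟩
  rw [← integral_add i1 i2]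
  exact integral_mono hi (i1.add i2) hb

/-! ### Weak limits along an ultrafilter -/

/-- The ultrafilter along which minimizing sequences converge. -/
def uf : Filter ℕ := (hyperfilter ℕ : Filter ℕ)

instance : uf.NeBot := inferInstanceAs (hyperfilter ℕ : Filter ℕ).NeBot

theorem uf_le_atTop : uf ≤ atTop := Nat.hyperfilter_le_atTop

/-- Compactness of [−C, C] in ultrafilter form; this takes the place of extracting subsequences. -/
theorem exists_tendsto_uf {a : ℕ → ℝ} {C : ℝ} (h : ∀ n, |a n| ≤ C) :
    ∃ x, Tendsto a uf (𝓝 x) := by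
  obtain ⟨x, -, hx⟩ := (isCompact_Icc (a := -C) (b := C)).ultrafilter_le_nhds
    ((hyperfilter ℕ).map a) (by
      rw [le_principal_iff]
      exact Eventually.of_forall (f := ((hyperfilter ℕ : Ultrafilter ℕ) : Filter ℕ))
        fun n => abs_le.1 (h n))
  exact ⟨x, hx⟩

/-- The limit of the functionals ⟨x n, ·⟩ along the ultrafilter is linear and bounded, so the Riesz
theorem represents it. -/
theorem exists_weak_limit {H : Type*} [NormedAddCommGroup H] [InnerProductSpace ℝ H]
    [CompleteSpace H] {x : ℕ → H} {C : ℝ} (h : ∀ n, ‖x n‖ ≤ C) :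
    ∃ y, ∀ z, Tendsto (fun n => inner ℝ (x n) z) uf (𝓝 (inner ℝ y z)) := by
  have hb : ∀ z n, |inner ℝ (x n) z| ≤ C * ‖z‖ := fun z n =>
    (abs_real_inner_le_norm _ _).trans (mul_le_mul_of_nonneg_right (h n) (norm_nonneg _))
  choose L hL using fun z => exists_tendsto_uf (hb z)
  let Lm : H →ₗ[ℝ] ℝ :=
    { toFun := L
      map_add' := fun z w => tendsto_nhds_unique (hL (z + w)) (by
        simpa only [inner_add_right] using (hL z).add (hL w))
      map_smul' := fun c z => tendsto_nhds_unique (hL (c • z)) (by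
        simpa only [inner_smul_right, smul_eq_mul, RingHom.id_apply] using (hL z).const_mul c) }
  let Lc : StrongDual ℝ H := Lm.mkContinuous C fun z =>
    le_of_tendsto (hL z).norm (Eventually.of_forall fun n => hb z n)
  refine ⟨(InnerProductSpace.toDual ℝ H).symm Lc, fun z => ?_⟩
  rw [InnerProductSpace.toDual_symm_apply]
  exact hL z

/-- Weak convergence in `L²(Ω)` along the fixed ultrafilter. -/
def WTendsto (F : ℕ → ℝ × ℝ → ℝ) (f : ℝ × ℝ → ℝ) : Prop :=
  ∀ g, MemLp g 2 (volume.restrict Ω) →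
    Tendsto (fun n => ∫ x in Ω, F n x * g x) uf (𝓝 (∫ x in Ω, f x * g x))

theorem norm_toLp_sq {f : ℝ × ℝ → ℝ} (hf : MemLp f 2 (volume.restrict Ω)) :
    ‖hf.toLp f‖ ^ 2 = ∫ x in Ω, f x ^ 2 := by
  rw [← real_inner_self_eq_norm_sq, inner_toLp]
  simp only [pow_two]

theorem exists_wTendsto {F : ℕ → ℝ × ℝ → ℝ} (hF : ∀ n, MemLp (F n) 2 (volume.restrict Ω))
    {C : ℝ} (hC : ∀ n, ∫ x in Ω, F n x ^ 2 ≤ C) :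
    ∃ f, MemLp f 2 (volume.restrict Ω) ∧ WTendsto F f := by
  obtain ⟨y, hy⟩ := exists_weak_limit (x := fun n => (hF n).toLp (F n)) (C := √C) fun n =>
    Real.le_sqrt_of_sq_le ((norm_toLp_sq (hF n)).trans_le (hC n))
  refine ⟨y, Lp.memLp y, fun g hg => ?_⟩
  have := hy (hg.toLp g)
  simp only [inner_toLp] at this
  rwa [← inner_toLp (Lp.memLp y) hg, Lp.toLp_coeFn]

theorem WTendsto.setIntegral {F : ℕ → ℝ × ℝ → ℝ} {f : ℝ × ℝ → ℝ} (h : WTendsto F f)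
    {Q : Set (ℝ × ℝ)} (hQ : MeasurableSet Q) (hQΩ : Q ⊆ Ω) :
    Tendsto (fun n => ∫ x in Q, F n x) uf (𝓝 (∫ x in Q, f x)) := by
  have := h (Q.indicator fun _ => 1) ((memLp_const 1).indicator hQ)
  have e : ∀ k : ℝ × ℝ → ℝ, ∫ x in Ω, k x * Q.indicator (fun _ => 1) x = ∫ x in Q, k x := by
    intro k
    have : (fun x => k x * Q.indicator (fun _ => (1 : ℝ)) x) = Q.indicator k := by
      ext x; by_cases hx : x ∈ Q <;> simp [hx]
    rw [this, integral_indicator hQ, Measure.restrict_restrict hQ, inter_eq_left.2 hQΩ]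
  simpa only [e] using this

/-- Integrate 2Ff − f² ≤ F²; the left-hand side is linear in F and passes to the weak limit. -/
theorem integral_sq_le_of_wTendsto {F : ℕ → ℝ × ℝ → ℝ} {f : ℝ × ℝ → ℝ} (h : WTendsto F f)
    (hF : ∀ n, MemLp (F n) 2 (volume.restrict Ω)) (hf : MemLp f 2 (volume.restrict Ω))
    {a : ℝ} (ha : Tendsto (fun n => ∫ x in Ω, F n x ^ 2) uf (𝓝 a)) : ∫ x in Ω, f x ^ 2 ≤ a := by
  have h1 := (h f hf).const_mul 2
  have h2 : Tendsto (fun n => 2 * (∫ x in Ω, F n x * f x) - ∫ x in Ω, f x ^ 2) uf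
      (𝓝 (∫ x in Ω, f x ^ 2)) := by
    have := h1.sub_const (∫ x in Ω, f x ^ 2)
    simp only [← pow_two] at this
    convert this using 2
    ring
  refine le_of_tendsto_of_tendsto' h2 ha fun n => ?_
  have i1 : IntegrableOn (fun x => F n x * f x) Ω := (hF n).integrable_mul hf
  have i2 : IntegrableOn (fun x => f x ^ 2) Ω := hf.integrable_sq
  rw [← integral_const_mul, ← integral_sub (i1.const_mul 2) i2]
  exact integral_mono ((i1.const_mul 2).sub i2) (hF n).integrable_sq fun x => by
    change 2 * (F n x * f x) - f x ^ 2 ≤ F n x ^ 2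
    nlinarith [sq_nonneg (F n x - f x)]

theorem integrableOn_of_memLp {f : ℝ × ℝ → ℝ} (hf : MemLp f 2 (volume.restrict Ω)) :
    IntegrableOn f Ω := hf.integrable (by norm_num)

theorem setIntegral_Ω_eq {f : ℝ × ℝ → ℝ} {s : Set (ℝ × ℝ)} (hs : MeasurableSet s) :
    ∫ x in s, f x ∂(volume.restrict Ω) = ∫ x in s ∩ Ω, f x := by
  rw [Measure.restrict_restrict hs]

/-- Boundedness provides some weak limit, and set integrals identify it. This form suits the
strains, whose quadratic part is only known to converge when integrated over sets. -/
theorem wTendsto_of_setIntegral {F : ℕ → ℝ × ℝ → ℝ} {f : ℝ × ℝ → ℝ}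
    (hF : ∀ n, MemLp (F n) 2 (volume.restrict Ω)) {C : ℝ} (hC : ∀ n, ∫ x in Ω, F n x ^ 2 ≤ C)
    (hf : IntegrableOn f Ω) (h : ∀ Q, MeasurableSet Q → Q ⊆ Ω →
      Tendsto (fun n => ∫ x in Q, F n x) uf (𝓝 (∫ x in Q, f x))) :
    MemLp f 2 (volume.restrict Ω) ∧ WTendsto F f := by
  obtain ⟨k, hk, hFk⟩ := exists_wTendsto hF hC
  have hae : k =ᵐ[volume.restrict Ω] f := by
    refine (integrableOn_of_memLp hk).ae_eq_of_forall_setIntegral_eq _ _ hf fun s hs _ => ?_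
    rw [setIntegral_Ω_eq hs, setIntegral_Ω_eq hs]
    have hm := hs.inter measurableSet_Ω
    exact tendsto_nhds_unique (hFk.setIntegral hm inter_subset_right) (h _ hm inter_subset_right)
  refine ⟨hk.ae_eq hae, fun g hg => ?_⟩
  rw [← integral_congr_ae (f := fun x => k x * g x)]
  · exact hFk g hg
  · filter_upwards [hae] with x hx
    rw [hx]

/-- Testing with indicators turns the pointwise bound into inequalities between set integrals. -/
theorem WTendsto.le_ae {F : ℕ → ℝ × ℝ → ℝ} {f : ℝ × ℝ → ℝ} (h : WTendsto F f)
    (hF : ∀ n, MemLp (F n) 2 (volume.restrict Ω)) (hf : MemLp f 2 (volume.restrict Ω)) {c : ℝ}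
    (hc : ∀ n, ∀ᵐ x ∂(volume.restrict Ω), c ≤ F n x) : ∀ᵐ x ∂(volume.restrict Ω), c ≤ f x := by
  refine ae_le_of_forall_setIntegral_le (f := fun _ => c) (integrable_const c)
    (integrableOn_of_memLp hf) fun s hs _ => ?_
  rw [setIntegral_Ω_eq hs, setIntegral_Ω_eq hs]
  refine ge_of_tendsto (h.setIntegral (hs.inter measurableSet_Ω) inter_subset_right)
    (Eventually.of_forall fun n => ?_)
  have hm : volume.restrict (s ∩ Ω) ≤ volume.restrict Ω :=
    Measure.restrict_mono inter_subset_right le_rfl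
  exact integral_mono_ae ((integrable_const c).mono_measure hm)
    (Integrable.mono_measure (integrableOn_of_memLp (hF n)) hm) (ae_mono hm (hc n))

theorem WTendsto.neg {F : ℕ → ℝ × ℝ → ℝ} {f : ℝ × ℝ → ℝ} (h : WTendsto F f) :
    WTendsto (fun n x => -F n x) (fun x => -f x) := fun g hg => by
  simpa only [neg_mul, integral_neg] using (h g hg).neg

theorem WTendsto.sub_const {F : ℕ → ℝ × ℝ → ℝ} {f : ℝ × ℝ → ℝ} (h : WTendsto F f)
    (hF : ∀ n, MemLp (F n) 2 (volume.restrict Ω)) (hf : MemLp f 2 (volume.restrict Ω)) (c : ℝ) :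
    WTendsto (fun n x => F n x - c) (fun x => f x - c) := fun g hg => by
  have e : ∀ k, MemLp k 2 (volume.restrict Ω) → ∫ x in Ω, (k x - c) * g x
      = (∫ x in Ω, k x * g x) - c * ∫ x in Ω, g x := fun k hk => by
    have i : Integrable (fun x => k x * g x) (volume.restrict Ω) := hk.integrable_mul hg
    simp only [sub_mul]
    rw [integral_sub i ((integrableOn_of_memLp hg).const_mul c),
      integral_const_mul]
  simp only [e _ (hF _), e _ hf]
  exact (h g hg).sub_const _

theorem WTendsto.eLpNorm_top_le {F : ℕ → ℝ × ℝ → ℝ} {f : ℝ × ℝ → ℝ} (h : WTendsto F f)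
    (hF : ∀ n, MemLp (F n) 2 (volume.restrict Ω)) (hf : MemLp f 2 (volume.restrict Ω))
    {m : ℝ≥0∞} (hm : ∀ n, eLpNorm (F n) ⊤ (volume.restrict Ω) ≤ m) :
    eLpNorm f ⊤ (volume.restrict Ω) ≤ m := by
  rcases eq_or_ne m ⊤ with rfl | hmt
  · exact le_top
  have hb : ∀ n, ∀ᵐ x ∂(volume.restrict Ω), ‖F n x‖ ≤ m.toReal := fun n => by
    have := ae_le_eLpNormEssSup (f := F n) (μ := volume.restrict Ω)
    filter_upwards [this] with x hx
    rw [← toReal_enorm]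
    exact ENNReal.toReal_mono hmt (hx.trans (by rw [← eLpNorm_exponent_top]; exact hm n))
  have h1 := h.le_ae hF hf (c := -m.toReal) fun n => by
    filter_upwards [hb n] with x hx
    exact (abs_le.1 hx).1
  have h2 := h.neg.le_ae (fun n => (hF n).neg) hf.neg (c := -m.toReal) fun n => by
    filter_upwards [hb n] with x hx
    exact neg_le_neg (abs_le.1 hx).2
  rw [eLpNorm_exponent_top]
  refine eLpNormEssSup_le_of_ae_enorm_bound ?_
  filter_upwards [h1, h2] with x hx1 hx2
  rw [← ofReal_norm, ← ENNReal.ofReal_toReal hmt]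
  exact ENNReal.ofReal_le_ofReal (abs_le.2 ⟨hx1, neg_le_neg_iff.1 hx2⟩)

/-! ### Weak closedness of jets -/

/-- Triples of `L²(Ω)` functions. -/
abbrev Triple := PiLp 2 (fun _ : Fin 3 => Lp ℝ 2 (volume.restrict Ω))

/-- First order jets of smooth periodic functions. -/
def smoothJets : Submodule ℝ Triple where
  carrier := {v | ∃ ψ, SmoothPer ψ ∧ v 0 =ᵐ[volume.restrict Ω] ψ ∧
    ∀ i : Fin 2, v i.succ =ᵐ[volume.restrict Ω] pd i ψ}
  zero_mem' := by
    refine ⟨fun _ => 0, ⟨contDiff_const, fun x => ⟨rfl, rfl⟩⟩, Lp.coeFn_zero _ _ _, fun i => ?_⟩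
    filter_upwards [Lp.coeFn_zero ℝ 2 (volume.restrict Ω)] with x hx
    rw [PiLp.zero_apply, hx]
    simp [pd]
  add_mem' := by
    rintro v w ⟨ψ, hψ, h0, h1⟩ ⟨χ, hχ, k0, k1⟩
    refine ⟨fun x => ψ x + χ x, ⟨hψ.1.add hχ.1, fun x => ⟨by simp only [(hψ.2 x).1, (hχ.2 x).1],
      by simp only [(hψ.2 x).2, (hχ.2 x).2]⟩⟩, ?_, fun i => ?_⟩
    · filter_upwards [Lp.coeFn_add (v 0) (w 0), h0, k0] with x hx a b
      rw [PiLp.add_apply, hx, Pi.add_apply, a, b]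
    · filter_upwards [Lp.coeFn_add (v i.succ) (w i.succ), h1 i, k1 i] with x hx a b
      rw [PiLp.add_apply, hx, Pi.add_apply, a, b, pd, pd, pd,
        fderiv_fun_add (hψ.1.differentiable (by simp) x) (hχ.1.differentiable (by simp) x)]
      rfl
  smul_mem' := by
    rintro c v ⟨ψ, hψ, h0, h1⟩
    refine ⟨fun x => c * ψ x, ⟨contDiff_const.mul hψ.1, fun x => ⟨by simp only [(hψ.2 x).1],
      by simp only [(hψ.2 x).2]⟩⟩, ?_, fun i => ?_⟩
    · filter_upwards [Lp.coeFn_smul c (v 0), h0] with x hx a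
      rw [PiLp.smul_apply, hx, Pi.smul_apply, a, smul_eq_mul]
    · filter_upwards [Lp.coeFn_smul c (v i.succ), h1 i] with x hx a
      rw [PiLp.smul_apply, hx, Pi.smul_apply, a, pd, pd,
        fderiv_const_mul (hψ.1.differentiable (by simp) x)]
      rfl

/-- The jet `(f, g 0, g 1)` as a triple of `L²(Ω)` functions. -/
def jetTriple {f : ℝ × ℝ → ℝ} {g : Fin 2 → ℝ × ℝ → ℝ} (hf : MemLp f 2 (volume.restrict Ω))
    (hg : ∀ i, MemLp (g i) 2 (volume.restrict Ω)) : Triple :=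
  WithLp.toLp 2 (Fin.cons (hf.toLp f) fun i => (hg i).toLp (g i))

/-- Describes jets as a closed subspace of a Hilbert space, so that orthogonality becomes available.
-/
theorem perJet_iff {f : ℝ × ℝ → ℝ} {g : Fin 2 → ℝ × ℝ → ℝ} (hf : MemLp f 2 (volume.restrict Ω))
    (hg : ∀ i, MemLp (g i) 2 (volume.restrict Ω)) :
    PerJet f g ↔ jetTriple hf hg ∈ smoothJets.topologicalClosure := by
  rw [← SetLike.mem_coe, Submodule.topologicalClosure_coe, mem_closure_iff_seq_limit]
  constructor
  · rintro ⟨-, -, ψ, hψ, h0, h1⟩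
    refine ⟨fun n => jetTriple (hψ n).memLp fun i => ((hψ n).pd i).memLp, fun n =>
      ⟨ψ n, hψ n, (hψ n).memLp.coeFn_toLp, fun i => ((hψ n).pd i).memLp.coeFn_toLp⟩, ?_⟩
    refine ((PiLp.continuous_toLp 2 _).tendsto _).comp (tendsto_pi_nhds.2 fun j => ?_)
    refine Fin.cases ?_ (fun i => ?_) j
    · exact tendsto_toLp (fun n => (hψ n).memLp) hf h0
    · exact tendsto_toLp (fun n => ((hψ n).pd i).memLp) (hg i) (h1 i)
  · rintro ⟨v, hv, hlim⟩
    choose ψ hψ h0 h1 using hv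
    have hc : ∀ j, Tendsto (fun n => v n j) atTop (𝓝 (jetTriple hf hg j)) := fun j =>
      ((tendsto_pi_nhds.1 (((PiLp.continuous_ofLp 2 _).tendsto _).comp hlim)) j)
    refine ⟨hf, hg, ψ, hψ, ?_, fun i => ?_⟩
    · have := (Lp.tendsto_Lp_iff_tendsto_eLpNorm' _ _).1 (hc 0)
      refine this.congr fun n => eLpNorm_congr_ae ?_
      filter_upwards [h0 n, hf.coeFn_toLp] with x a b
      rw [Pi.sub_apply, Pi.sub_apply, a]
      exact congrArg _ b
    · have := (Lp.tendsto_Lp_iff_tendsto_eLpNorm' _ _).1 (hc i.succ)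
      refine this.congr fun n => eLpNorm_congr_ae ?_
      filter_upwards [h1 n i, (hg i).coeFn_toLp] with x a b
      rw [Pi.sub_apply, Pi.sub_apply, a]
      exact congrArg _ b

/-- A closed subspace is its own double orthogonal complement. Membership is then a family of linear
equations, and these survive weak limits. -/
theorem PerJet.of_wTendsto {F : ℕ → ℝ × ℝ → ℝ} {G : ℕ → Fin 2 → ℝ × ℝ → ℝ} {f : ℝ × ℝ → ℝ}
    {g : Fin 2 → ℝ × ℝ → ℝ} (h : ∀ n, PerJet (F n) (G n))
    (hf : MemLp f 2 (volume.restrict Ω)) (hg : ∀ i, MemLp (g i) 2 (volume.restrict Ω))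
    (hF : WTendsto F f) (hG : ∀ i, WTendsto (fun n => G n i) (g i)) : PerJet f g := by
  rw [perJet_iff hf hg, ← Submodule.orthogonal_orthogonal_eq_closure,
    Submodule.mem_orthogonal']
  intro w hw
  have hz : ∀ n, inner ℝ (jetTriple (h n).memLp (h n).memLp_deriv) w = 0 := fun n => by
    have := (perJet_iff (h n).memLp (h n).memLp_deriv).1 (h n)
    rw [← Submodule.orthogonal_orthogonal_eq_closure, Submodule.mem_orthogonal'] at this
    exact this w hw
  have e : ∀ {f : ℝ × ℝ → ℝ} {g : Fin 2 → ℝ × ℝ → ℝ} (hf : MemLp f 2 (volume.restrict Ω))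
      (hg : ∀ i, MemLp (g i) 2 (volume.restrict Ω)), inner ℝ (jetTriple hf hg) w
      = (∫ x in Ω, f x * w 0 x) + ∑ i : Fin 2, ∫ x in Ω, g i x * w i.succ x := by
    intro f g hf hg
    rw [PiLp.inner_apply, Fin.sum_univ_succ]
    congr 1
    · rw [← inner_toLp hf (Lp.memLp (w 0)), Lp.toLp_coeFn]; rfl
    · refine Finset.sum_congr rfl fun i _ => ?_
      rw [← inner_toLp (hg i) (Lp.memLp (w i.succ)), Lp.toLp_coeFn]; rfl
  simp only [e] at hz ⊢
  refine tendsto_nhds_unique ((hF _ (Lp.memLp (w 0))).add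
    (tendsto_finsetSum _ fun i _ => hG i _ (Lp.memLp (w i.succ)))) ?_
  simp only [hz]
  exact tendsto_const_nhds

theorem PerJet.sub {f f' g g'} (h : PerJet f g) (h' : PerJet f' g') :
    PerJet (f - f') (fun i => g i - g' i) := by
  rw [perJet_iff (h.memLp.sub h'.memLp) (fun i => (h.memLp_deriv i).sub (h'.memLp_deriv i))]
  have := Submodule.sub_mem _ ((perJet_iff h.memLp h.memLp_deriv).1 h)
    ((perJet_iff h'.memLp h'.memLp_deriv).1 h')
  convert this using 1
  ext1 j
  refine Fin.cases ?_ (fun i => ?_) j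
  · exact MemLp.toLp_sub h.memLp h'.memLp
  · exact MemLp.toLp_sub (h.memLp_deriv i) (h'.memLp_deriv i)

/-! ### Compactness -/

theorem setIntegral_split_fst {f : ℝ × ℝ → ℝ} {a m b : ℝ} {S : Set ℝ} (hS : MeasurableSet S)
    (h1 : a ≤ m) (h2 : m ≤ b) (hf : IntegrableOn f (Icc a b ×ˢ S)) :
    ∫ x in Icc a b ×ˢ S, f x = (∫ x in Icc a m ×ˢ S, f x) + ∫ x in Icc m b ×ˢ S, f x := by
  have e : (Ioc m b ×ˢ S : Set (ℝ × ℝ)) =ᵐ[volume] (Icc m b ×ˢ S : Set (ℝ × ℝ)) :=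
    Measure.set_prod_ae_eq Ioc_ae_eq_Icc (ae_eq_refl _)
  have hu : Icc a b ×ˢ S = Icc a m ×ˢ S ∪ Ioc m b ×ˢ S := by
    rw [← union_prod, Icc_union_Ioc_eq_Icc h1 h2]
  rw [← setIntegral_congr_set e, hu]
  rw [hu] at hf
  refine setIntegral_union (disjoint_prod.2 (Or.inl ?_)) (measurableSet_Ioc.prod hS)
    (hf.mono_set subset_union_left) (hf.mono_set subset_union_right)
  exact disjoint_left.2 fun x hx hx' => not_lt.2 hx.2 hx'.1

theorem setIntegral_split_snd {f : ℝ × ℝ → ℝ} {c m d : ℝ} {S : Set ℝ} (hS : MeasurableSet S)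
    (h1 : c ≤ m) (h2 : m ≤ d) (hf : IntegrableOn f (S ×ˢ Icc c d)) :
    ∫ x in S ×ˢ Icc c d, f x = (∫ x in S ×ˢ Icc c m, f x) + ∫ x in S ×ˢ Icc m d, f x := by
  have e : (S ×ˢ Ioc m d : Set (ℝ × ℝ)) =ᵐ[volume] (S ×ˢ Icc m d : Set (ℝ × ℝ)) :=
    Measure.set_prod_ae_eq (ae_eq_refl _) Ioc_ae_eq_Icc
  have hu : S ×ˢ Icc c d = S ×ˢ Icc c m ∪ S ×ˢ Ioc m d := by
    rw [← prod_union, Icc_union_Ioc_eq_Icc h1 h2]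
  rw [← setIntegral_congr_set e, hu]
  rw [hu] at hf
  refine setIntegral_union (disjoint_prod.2 (Or.inr ?_)) (hS.prod measurableSet_Ioc)
    (hf.mono_set subset_union_left) (hf.mono_set subset_union_right)
  exact disjoint_left.2 fun x hx hx' => not_lt.2 hx.2 hx'.1

/-- Poincaré on each of the 4^k pieces has a constant smaller by the factor 4^{-k}, while the
finitely many means tend to zero by weak convergence. The induction cuts the rectangle into
quarters. -/
theorem rellich_rect {v : ℕ → ℝ × ℝ → ℝ} {g : ℕ → Fin 2 → ℝ × ℝ → ℝ} (h : ∀ n, PerJet (v n) (g n))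
    (h0 : WTendsto v fun _ => 0) (k : ℕ) : ∀ {a b c d : ℝ}, a < b → c < d →
      Icc a b ×ˢ Icc c d ⊆ Ω → ∀ ε > 0, ∀ᶠ n in uf, ∫ x in Icc a b ×ˢ Icc c d, v n x ^ 2
        ≤ ε + (1 / 4) ^ k * ((b - a) ^ 2 / 2 * (∫ x in Icc a b ×ˢ Icc c d, g n 0 x ^ 2)
          + (d - c) ^ 2 / 2 * ∫ x in Icc a b ×ˢ Icc c d, g n 1 x ^ 2) := by
  induction k with
  | zero =>
    intro a b c d hab hcd hQ ε hε
    have h1 := ((h0.setIntegral (measurableSet_Icc.prod measurableSet_Icc) hQ).pow 2).div_const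
      ((b - a) * (d - c))
    simp only [integral_zero, ne_eq, OfNat.ofNat_ne_zero, not_false_eq_true, zero_pow,
      zero_div] at h1
    filter_upwards [h1.eventually (gt_mem_nhds hε)] with n hn
    have := (h n).poincare hab hcd hQ
    rw [pow_zero, one_mul]
    linarith
  | succ k ih =>
    intro a b c d hab hcd hQ ε hε
    set p := (a + b) / 2
    set q := (c + d) / 2
    have hp1 : a < p := by simp only [p]; linarith
    have hp2 : p < b := by simp only [p]; linarith
    have hq1 : c < q := by simp only [q]; linarith
    have hq2 : q < d := by simp only [q]; linarith
    have sub : ∀ {a' b' c' d' : ℝ}, a ≤ a' → b' ≤ b → c ≤ c' → d' ≤ d →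
        Icc a' b' ×ˢ Icc c' d' ⊆ Icc a b ×ˢ Icc c d := fun h1 h2 h3 h4 =>
      prod_mono (Icc_subset_Icc h1 h2) (Icc_subset_Icc h3 h4)
    have e4 : 0 < ε / 4 := by linarith
    have A := ih hp1 hq1 ((sub le_rfl hp2.le le_rfl hq2.le).trans hQ) _ e4
    have B := ih hp1 hq2 ((sub le_rfl hp2.le hq1.le le_rfl).trans hQ) _ e4
    have C := ih hp2 hq1 ((sub hp1.le le_rfl le_rfl hq2.le).trans hQ) _ e4
    have D := ih hp2 hq2 ((sub hp1.le le_rfl hq1.le le_rfl).trans hQ) _ e4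
    have split : ∀ f : ℝ × ℝ → ℝ, MemLp f 2 (volume.restrict Ω) →
        ∫ x in Icc a b ×ˢ Icc c d, f x ^ 2 =
          (∫ x in Icc a p ×ˢ Icc c q, f x ^ 2) + (∫ x in Icc a p ×ˢ Icc q d, f x ^ 2)
          + (∫ x in Icc p b ×ˢ Icc c q, f x ^ 2) + ∫ x in Icc p b ×ˢ Icc q d, f x ^ 2 := by
      intro f hf
      have hi : IntegrableOn (fun x => f x ^ 2) Ω := hf.integrable_sq
      rw [setIntegral_split_fst measurableSet_Icc hp1.le hp2.le (hi.mono_set hQ),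
        setIntegral_split_snd measurableSet_Icc hq1.le hq2.le
          (hi.mono_set ((sub le_rfl hp2.le le_rfl le_rfl).trans hQ)),
        setIntegral_split_snd measurableSet_Icc hq1.le hq2.le
          (hi.mono_set ((sub hp1.le le_rfl le_rfl le_rfl).trans hQ))]
      ring
    filter_upwards [A, B, C, D] with n hA hB hC hD
    rw [split _ (h n).memLp, split _ ((h n).memLp_deriv 0), split _ ((h n).memLp_deriv 1)]
    have s1 : p - a = (b - a) / 2 := by simp only [p]; ring
    have s2 : b - p = (b - a) / 2 := by simp only [p]; ring
    have s3 : q - c = (d - c) / 2 := by simp only [q]; ring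
    have s4 : d - q = (d - c) / 2 := by simp only [q]; ring
    rw [s1, s3] at hA
    rw [s1, s4] at hB
    rw [s2, s3] at hC
    rw [s2, s4] at hD
    refine (add_le_add (add_le_add (add_le_add hA hB) hC) hD).trans (le_of_eq ?_)
    ring

theorem tendsto_eLpNorm_of_integral_sq {v : ℕ → ℝ × ℝ → ℝ}
    (hv : ∀ n, MemLp (v n) 2 (volume.restrict Ω))
    (h : Tendsto (fun n => ∫ x in Ω, v n x ^ 2) uf (𝓝 0)) :
    Tendsto (fun n => eLpNorm (v n) 2 (volume.restrict Ω)) uf (𝓝 0) := by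
  have e : ∀ n, eLpNorm (v n) 2 (volume.restrict Ω) = ENNReal.ofReal (√(∫ x in Ω, v n x ^ 2)) := by
    intro n
    rw [← norm_toLp_sq (hv n), Real.sqrt_sq (norm_nonneg _), Lp.norm_toLp,
      ENNReal.ofReal_toReal (hv n).2.ne]
  simp only [e]
  have := (ENNReal.continuous_ofReal.tendsto _).comp ((Real.continuous_sqrt.tendsto _).comp h)
  simpa [Function.comp_def] using this

/-- The differences have bounded gradients and weak limit zero, so subdividing often enough makes
the gradient term as small as desired. -/
theorem PerJet.rellich {F : ℕ → ℝ × ℝ → ℝ} {G : ℕ → Fin 2 → ℝ × ℝ → ℝ} {f : ℝ × ℝ → ℝ}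
    {g : Fin 2 → ℝ × ℝ → ℝ} (h : ∀ n, PerJet (F n) (G n)) (hf : PerJet f g) {C : ℝ}
    (hC : ∀ n i, ∫ x in Ω, G n i x ^ 2 ≤ C) (hF : WTendsto F f) : L2Tendsto uf F f := by
  have hv := fun n => (h n).sub hf
  have h0 : WTendsto (fun n => F n - f) fun _ => 0 := fun k hk => by
    have := (hF k hk).sub_const (∫ x in Ω, f x * k x)
    rw [sub_self] at this
    simp only [zero_mul, integral_zero]
    refine this.congr fun n => ?_
    have i1 : IntegrableOn (fun x => F n x * k x) Ω := (h n).memLp.integrable_mul hk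
    have i2 : IntegrableOn (fun x => f x * k x) Ω := hf.memLp.integrable_mul hk
    rw [← integral_sub i1 i2]
    refine integral_congr_ae (Eventually.of_forall fun x => ?_)
    simp [sub_mul]
  set C' := ∑ i, ∫ x in Ω, g i x ^ 2
  have hb : ∀ n i, ∫ x in Ω, (G n i - g i) x ^ 2 ≤ 2 * C + 2 * C' := by
    intro n i
    have i1 : IntegrableOn (fun x => G n i x ^ 2) Ω := ((h n).memLp_deriv i).integrable_sq
    have i2 : IntegrableOn (fun x => g i x ^ 2) Ω := (hf.memLp_deriv i).integrable_sq
    have h1 : ∫ x in Ω, g i x ^ 2 ≤ C' :=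
      Finset.single_le_sum (f := fun i => ∫ x in Ω, g i x ^ 2)
        (fun i _ => integral_nonneg fun _ => sq_nonneg _) (Finset.mem_univ i)
    calc ∫ x in Ω, (G n i - g i) x ^ 2 ≤ ∫ x in Ω, (2 * G n i x ^ 2 + 2 * g i x ^ 2) := by
          refine integral_mono ((hv n).memLp_deriv i).integrable_sq
            ((i1.const_mul 2).add (i2.const_mul 2)) fun x => ?_
          simp only [Pi.sub_apply]
          nlinarith [sq_nonneg (G n i x + g i x)]
      _ ≤ _ := by
          rw [integral_add (i1.const_mul 2) (i2.const_mul 2), integral_const_mul,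
            integral_const_mul]
          linarith [hC n i]
  refine tendsto_eLpNorm_of_integral_sq (fun n => (hv n).memLp) ?_
  set B := ((2 * Real.pi - 0) ^ 2 / 2 + (1 / 2 - -(1 / 2)) ^ 2 / 2) * (2 * C + 2 * C')
  rw [Metric.tendsto_nhds]
  intro ε hε
  have hpow : Tendsto (fun k : ℕ => (1 / 4 : ℝ) ^ k * B) atTop (𝓝 (0 * B)) :=
    (tendsto_pow_atTop_nhds_zero_of_lt_one (by norm_num) (by norm_num)).mul_const B
  rw [zero_mul] at hpow
  obtain ⟨k, hk⟩ := (hpow.eventually (gt_mem_nhds (half_pos hε))).exists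
  filter_upwards [rellich_rect hv h0 k pi2_pos (by norm_num : -(1 / 2 : ℝ) < 1 / 2)
    (subset_refl Ω) _ (half_pos hε)] with n hn
  rw [Real.dist_0_eq_abs, abs_of_nonneg (integral_nonneg fun _ => sq_nonneg _)]
  refine hn.trans_lt ?_
  have h2 : (1 / 4 : ℝ) ^ k * ((2 * Real.pi - 0) ^ 2 / 2 * (∫ x in Ω, (G n 0 - g 0) x ^ 2)
      + (1 / 2 - -(1 / 2)) ^ 2 / 2 * ∫ x in Ω, (G n 1 - g 1) x ^ 2) ≤ (1 / 4 : ℝ) ^ k * B := by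
    gcongr
    simp only [B, add_mul]
    gcongr
    · exact hb n 0
    · exact hb n 1
  have h3 : ε / 2 + (1 / 4 : ℝ) ^ k * ((2 * Real.pi - 0) ^ 2 / 2 * (∫ x in Ω, (G n 0 - g 0) x ^ 2)
      + (1 / 2 - -(1 / 2)) ^ 2 / 2 * ∫ x in Ω, (G n 1 - g 1) x ^ 2) < ε := by linarith
  exact h3

/-! ### Existence of minimizers -/

theorem integrableOn_add {f g : ℝ × ℝ → ℝ} {Q : Set (ℝ × ℝ)} (hf : IntegrableOn f Q)
    (hg : IntegrableOn g Q) : IntegrableOn (fun x => f x + g x) Q := Integrable.add hf hg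

theorem integrableOn_sub {f g : ℝ × ℝ → ℝ} {Q : Set (ℝ × ℝ)} (hf : IntegrableOn f Q)
    (hg : IntegrableOn g Q) : IntegrableOn (fun x => f x - g x) Q := Integrable.sub hf hg

theorem integrableOn_const_mul {f : ℝ × ℝ → ℝ} {Q : Set (ℝ × ℝ)} (c : ℝ)
    (hf : IntegrableOn f Q) : IntegrableOn (fun x => c * f x) Q := Integrable.const_mul hf c

theorem volume_Ω : (volume Ω).toReal = 2 * Real.pi := by
  rw [Ω, Measure.volume_eq_prod, Measure.prod_prod, Real.volume_Icc, Real.volume_Icc,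
    ENNReal.toReal_mul, ENNReal.toReal_ofReal (by linarith [pi2_pos]),
    ENNReal.toReal_ofReal (by norm_num)]
  norm_num

theorem integral_const_Ω (c : ℝ) : ∫ _ in Ω, c = 2 * Real.pi * c := by
  rw [setIntegral_const, measureReal_def, volume_Ω, smul_eq_mul]

theorem PerJet.poincare_Ω {f g} (h : PerJet f g) : ∫ x in Ω, f x ^ 2 ≤
    (∫ x in Ω, f x) ^ 2 / (2 * Real.pi) + 2 * Real.pi ^ 2 * (∫ x in Ω, g 0 x ^ 2)
      + 1 / 2 * ∫ x in Ω, g 1 x ^ 2 := by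
  have := h.poincare pi2_pos (by norm_num : -(1 / 2 : ℝ) < 1 / 2) (subset_refl Ω)
  rw [show (2 * Real.pi - 0) * (1 / 2 - -(1 / 2)) = 2 * Real.pi by ring,
    show (2 * Real.pi - 0) ^ 2 / 2 = 2 * Real.pi ^ 2 by ring,
    show ((1 / 2 : ℝ) - -(1 / 2)) ^ 2 / 2 = 1 / 2 by norm_num] at this
  exact this

theorem PerJet.sub_const {f g} (h : PerJet f g) (k : ℝ) : PerJet (fun x => f x - k) g := by
  have hk : SmoothPer fun _ => k := ⟨contDiff_const, fun _ => ⟨rfl, rfl⟩⟩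
  have := h.sub hk.perJet
  have e : ∀ i, pd i (fun _ => k) = 0 := fun i => by ext x; simp [pd]
  simp only [e, sub_zero] at this
  exact this

/-- The unknowns of the variational problem together with their weak derivatives: `u` is the radial
displacement, `a` the azimuthal one and `b` the periodic part of the axial one. -/
structure Conf where
  u : ℝ × ℝ → ℝ
  p : Fin 2 → ℝ × ℝ → ℝ
  H : Fin 2 → Fin 2 → ℝ × ℝ → ℝ
  a : ℝ × ℝ → ℝ
  ga : Fin 2 → ℝ × ℝ → ℝ
  b : ℝ × ℝ → ℝ
  gb : Fin 2 → ℝ × ℝ → ℝ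

namespace Conf

/-- Hoop strain. -/
def hoop (c : Conf) (x : ℝ × ℝ) : ℝ := c.ga 0 x + 1 / 2 * (c.p 0 x * c.p 0 x) + c.u x

/-- Axial strain. -/
def axial (c : Conf) (lam : ℝ) (x : ℝ × ℝ) : ℝ := (c.gb 1 x - lam) + 1 / 2 * (c.p 1 x * c.p 1 x)

/-- Shear strain. -/
def shear (c : Conf) (x : ℝ × ℝ) : ℝ :=
  1 / 2 * (c.ga 1 x + c.gb 0 x) + 1 / 2 * (c.p 0 x * c.p 1 x)

/-- The energy as a real number. -/
def E (c : Conf) (h lam : ℝ) : ℝ :=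
  (∫ x in Ω, c.hoop x ^ 2) + (∫ x in Ω, c.axial lam x ^ 2) + 2 * (∫ x in Ω, c.shear x ^ 2)
    + h ^ 2 * ((∫ x in Ω, c.H 0 0 x ^ 2) + (∫ x in Ω, c.H 0 1 x ^ 2)
      + (∫ x in Ω, c.H 1 0 x ^ 2) + ∫ x in Ω, c.H 1 1 x ^ 2)

/-- Admissibility of a configuration. -/
structure Adm (c : Conf) (lam r : ℝ) (m : ℝ≥0∞) : Prop where
  hu : PerJet c.u c.p
  hp : ∀ j, PerJet (c.p j) (c.H j)
  ha : PerJet c.a c.ga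
  hb : PerJet c.b c.gb
  obst : ∀ᵐ x ∂(volume.restrict Ω), r - 1 ≤ c.u x
  bp : ∀ i, eLpNorm (c.p i) ⊤ (volume.restrict Ω) ≤ m
  bga : ∀ i, eLpNorm (c.ga i) ⊤ (volume.restrict Ω) ≤ m
  bgb : ∀ i, eLpNorm (fun x => c.gb i x - if i = 1 then lam else 0) ⊤ (volume.restrict Ω) ≤ m

variable {c : Conf} {lam r h M : ℝ} {m : ℝ≥0∞}

theorem Adm.memLp_hoop (hc : c.Adm lam r m) : MemLp c.hoop 2 (volume.restrict Ω) :=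
  ((hc.ha.memLp_deriv 0).add (((hc.hp 0).memLp_mul (hc.hp 0)).1.const_mul (1 / 2))).add hc.hu.memLp

theorem Adm.memLp_axial (hc : c.Adm lam r m) : MemLp (c.axial lam) 2 (volume.restrict Ω) :=
  ((hc.hb.memLp_deriv 1).sub (memLp_const lam)).add
    (((hc.hp 1).memLp_mul (hc.hp 1)).1.const_mul (1 / 2))

theorem Adm.memLp_shear (hc : c.Adm lam r m) : MemLp c.shear 2 (volume.restrict Ω) :=
  (((hc.ha.memLp_deriv 1).add (hc.hb.memLp_deriv 0)).const_mul (1 / 2)).add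
    (((hc.hp 0).memLp_mul (hc.hp 1)).1.const_mul (1 / 2))

theorem integral_sq_nonneg (f : ℝ × ℝ → ℝ) : 0 ≤ ∫ x in Ω, f x ^ 2 :=
  integral_nonneg fun _ => sq_nonneg _

theorem integral_sq_add_three {f f1 f2 f3 : ℝ × ℝ → ℝ} (h1 : MemLp f1 2 (volume.restrict Ω))
    (h2 : MemLp f2 2 (volume.restrict Ω)) (h3 : MemLp f3 2 (volume.restrict Ω))
    (hf : ∀ x, f x = f1 x + f2 x + f3 x) : ∫ x in Ω, f x ^ 2 ≤
      3 * ((∫ x in Ω, f1 x ^ 2) + (∫ x in Ω, f2 x ^ 2) + ∫ x in Ω, f3 x ^ 2) := by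
  have i1 : IntegrableOn (fun x => f1 x ^ 2) Ω := h1.integrable_sq
  have i2 : IntegrableOn (fun x => f2 x ^ 2) Ω := h2.integrable_sq
  have i3 : IntegrableOn (fun x => f3 x ^ 2) Ω := h3.integrable_sq
  rw [← integral_add i1 i2, ← integral_add (integrableOn_add i1 i2) i3, ← integral_const_mul]
  have hfi : IntegrableOn (fun x => f x ^ 2) Ω := by
    simp only [hf]
    exact ((h1.add h2).add h3).integrable_sq
  refine integral_mono hfi (((i1.add i2).add i3).const_mul 3) fun x => ?_
  simp only [hf]
  nlinarith [sq_nonneg (f1 x - f2 x), sq_nonneg (f1 x - f3 x), sq_nonneg (f2 x - f3 x)]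

theorem integral_mul_le {f g : ℝ × ℝ → ℝ} (hf : MemLp f 2 (volume.restrict Ω))
    (hg : MemLp g 2 (volume.restrict Ω)) : -2 * ∫ x in Ω, f x * g x ≤
      (∫ x in Ω, f x ^ 2) + ∫ x in Ω, g x ^ 2 := by
  have i1 : IntegrableOn (fun x => f x ^ 2) Ω := hf.integrable_sq
  have i2 : IntegrableOn (fun x => g x ^ 2) Ω := hg.integrable_sq
  have i3 : IntegrableOn (fun x => f x * g x) Ω := hf.integrable_mul hg
  rw [← integral_add i1 i2, ← integral_const_mul]
  exact integral_mono (i3.const_mul _) (i1.add i2) fun x => by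
    change -2 * (f x * g x) ≤ f x ^ 2 + g x ^ 2
    nlinarith [sq_nonneg (f x + g x)]

theorem E_nonneg (c : Conf) (h lam : ℝ) : 0 ≤ c.E h lam := by
  have := fun f => integral_sq_nonneg f
  unfold E
  have h1 := this c.hoop
  have h2 := this (c.axial lam)
  have h3 := this c.shear
  have h4 := mul_nonneg (sq_nonneg h) (add_nonneg (add_nonneg (add_nonneg (this (c.H 0 0))
    (this (c.H 0 1))) (this (c.H 1 0))) (this (c.H 1 1)))
  linarith

theorem Adm.integral_hoop (hc : c.Adm lam r m) : ∫ x in Ω, c.hoop x =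
    1 / 2 * (∫ x in Ω, c.p 0 x ^ 2) + ∫ x in Ω, c.u x := by
  have i1 := integrableOn_of_memLp (hc.ha.memLp_deriv 0)
  have i2 := integrableOn_of_memLp ((hc.hp 0).memLp_mul (hc.hp 0)).1
  have i3 := integrableOn_of_memLp hc.hu.memLp
  unfold hoop
  rw [integral_add (integrableOn_add i1 (integrableOn_const_mul _ i2)) i3,
    integral_add i1 (integrableOn_const_mul _ i2),
    hc.ha.integral_deriv 0, integral_const_mul]
  simp only [pow_two, zero_add]

/-- Coercivity. The bending energy controls the Hessian; Poincaré, twice, controls the gradient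
(which has mean zero) and u up to its mean; Ladyzhenskaya then bounds the quadratic part of the
strains, and Korn's identity separates the two shear derivatives. -/
theorem Adm.bounds (hh : 0 < h) (lam M : ℝ) : ∃ C, ∀ (c : Conf) (r : ℝ) (m : ℝ≥0∞), 1 ≤ r →
    c.Adm lam r m → c.E h lam ≤ M →
    (∫ x in Ω, c.u x ^ 2 ≤ C) ∧ (∀ j, ∫ x in Ω, c.p j x ^ 2 ≤ C) ∧
    (∀ j i, ∫ x in Ω, c.H j i x ^ 2 ≤ C) ∧ (∀ i, ∫ x in Ω, c.ga i x ^ 2 ≤ C) ∧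
    (∀ i, ∫ x in Ω, c.gb i x ^ 2 ≤ C) ∧ (∫ x in Ω, c.hoop x ^ 2 ≤ C) ∧
    (∫ x in Ω, c.axial lam x ^ 2 ≤ C) ∧ (∫ x in Ω, c.shear x ^ 2 ≤ C) := by
  set C1 := 2 * Real.pi + M
  set C2 := M / h ^ 2
  set C3 := 2 * Real.pi ^ 2 * C2 + 1 / 2 * C2
  set C4 := C1 ^ 2 / (2 * Real.pi) + 2 * Real.pi ^ 2 * C3 + 1 / 2 * C3
  set C5 := 4 * (C3 + C2 + C2) ^ 2
  set C6 := 3 * (M + C5 / 2 + C4)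
  set C7 := 3 * (M + 2 * Real.pi * lam ^ 2 + C5 / 2)
  set C8 := 3 * (4 * M + 2 * C5)
  refine ⟨M + C2 + C3 + C4 + C6 + C7 + C8, fun c r m hr hc hE => ?_⟩
  have nn := fun f => integral_sq_nonneg f
  have hh2 : 0 < h ^ 2 := by positivity
  have hpi := Real.pi_pos
  have hM : 0 ≤ M := (E_nonneg c h lam).trans hE
  have nH : 0 ≤ h ^ 2 * ((∫ x in Ω, c.H 0 0 x ^ 2) + (∫ x in Ω, c.H 0 1 x ^ 2)
      + (∫ x in Ω, c.H 1 0 x ^ 2) + ∫ x in Ω, c.H 1 1 x ^ 2) :=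
    mul_nonneg hh2.le (add_nonneg (add_nonneg (add_nonneg (nn _) (nn _)) (nn _)) (nn _))
  unfold E at hE
  have n1 := nn c.hoop
  have n2 := nn (c.axial lam)
  have n3 := nn c.shear
  have b1 : ∫ x in Ω, c.hoop x ^ 2 ≤ M := by linarith
  have b2 : ∫ x in Ω, c.axial lam x ^ 2 ≤ M := by linarith
  have b3 : ∫ x in Ω, c.shear x ^ 2 ≤ M := by linarith
  have b4 : ∀ j i, ∫ x in Ω, c.H j i x ^ 2 ≤ C2 := by
    intro j i
    rw [le_div_iff₀ hh2, mul_comm]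
    refine le_trans (mul_le_mul_of_nonneg_left ?_ hh2.le) (by linarith :
      h ^ 2 * ((∫ x in Ω, c.H 0 0 x ^ 2) + (∫ x in Ω, c.H 0 1 x ^ 2)
      + (∫ x in Ω, c.H 1 0 x ^ 2) + ∫ x in Ω, c.H 1 1 x ^ 2) ≤ M)
    have e1 := nn (c.H 0 0)
    have e2 := nn (c.H 0 1)
    have e3 := nn (c.H 1 0)
    have e4 := nn (c.H 1 1)
    fin_cases j <;> fin_cases i <;> simp only [Fin.zero_eta, Fin.mk_one] <;> linarith
  -- The obstacle with r ≥ 1 bounds the mean of u from below, the hoop strain from above. Without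
  -- the obstacle, u would not be controlled by this argument.
  have hu0 : 0 ≤ ∫ x in Ω, c.u x := integral_nonneg_of_ae (by
    filter_upwards [hc.obst] with x hx
    exact (by linarith : (0 : ℝ) ≤ r - 1).trans hx)
  have b5 : ∫ x in Ω, c.hoop x ≤ C1 := by
    have i1 : IntegrableOn (fun x => c.hoop x ^ 2) Ω := hc.memLp_hoop.integrable_sq
    calc ∫ x in Ω, c.hoop x ≤ ∫ x in Ω, (1 + c.hoop x ^ 2) :=
          integral_mono (integrableOn_of_memLp hc.memLp_hoop) ((integrable_const 1).add i1)
            fun x => by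
              change c.hoop x ≤ 1 + c.hoop x ^ 2
              nlinarith [sq_nonneg (c.hoop x - 1)]
      _ = 2 * Real.pi + ∫ x in Ω, c.hoop x ^ 2 := by
          rw [integral_add (integrable_const 1) i1, integral_const_Ω, mul_one]
      _ ≤ C1 := by linarith
  rw [hc.integral_hoop] at b5
  have b6 : ∀ j, ∫ x in Ω, c.p j x ^ 2 ≤ C3 := fun j => by
    have := (hc.hp j).poincare_Ω
    rw [hc.hu.integral_deriv j] at this
    refine this.trans ?_
    rw [zero_pow two_ne_zero, zero_div, zero_add]
    exact add_le_add (mul_le_mul_of_nonneg_left (b4 j 0) (by positivity))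
      (mul_le_mul_of_nonneg_left (b4 j 1) (by positivity))
  have b7 : ∫ x in Ω, c.u x ^ 2 ≤ C4 := by
    refine hc.hu.poincare_Ω.trans ?_
    have : (∫ x in Ω, c.u x) ≤ C1 := by linarith [nn (c.p 0)]
    exact add_le_add (add_le_add (div_le_div_of_nonneg_right (pow_le_pow_left₀ hu0 this 2)
      pi2_pos.le) (mul_le_mul_of_nonneg_left (b6 0) (by positivity)))
      (mul_le_mul_of_nonneg_left (b6 1) (by positivity))
  have b8 : ∀ j, ∫ x in Ω, c.p j x ^ 4 ≤ C5 := fun j => by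
    refine (hc.hp j).ladyzhenskaya.2.trans ?_
    have := nn (c.p j)
    have := nn (c.H j 0)
    have := nn (c.H j 1)
    exact mul_le_mul_of_nonneg_left (pow_le_pow_left₀ (by positivity)
      (add_le_add (add_le_add (b6 j) (b4 j 0)) (b4 j 1)) 2) (by norm_num)
  have b9 : ∀ i j, ∫ x in Ω, (c.p i x * c.p j x) ^ 2 ≤ 2 * C5 := fun i j =>
    (((hc.hp i).memLp_mul (hc.hp j)).2.trans (add_le_add (b8 i) (b8 j))).trans (by linarith)
  have half : ∀ (k : ℝ) (f : ℝ × ℝ → ℝ), ∫ x in Ω, (k * f x) ^ 2 = k ^ 2 * ∫ x in Ω, f x ^ 2 :=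
    fun k f => by simp only [mul_pow, integral_const_mul]
  have b10 : ∫ x in Ω, c.ga 0 x ^ 2 ≤ C6 := by
    refine (integral_sq_add_three (f2 := fun x => -(1 / 2) * (c.p 0 x * c.p 0 x))
      (f3 := fun x => -1 * c.u x) hc.memLp_hoop
      (((hc.hp 0).memLp_mul (hc.hp 0)).1.const_mul _) (hc.hu.memLp.const_mul _)
      (fun x => by unfold hoop; ring)).trans ?_
    rw [half, half]
    have := b9 0 0
    refine mul_le_mul_of_nonneg_left ?_ (by norm_num)
    linarith
  have b11 : ∫ x in Ω, c.gb 1 x ^ 2 ≤ C7 := by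
    refine (integral_sq_add_three (f2 := fun _ => lam)
      (f3 := fun x => -(1 / 2) * (c.p 1 x * c.p 1 x)) hc.memLp_axial (memLp_const lam)
      (((hc.hp 1).memLp_mul (hc.hp 1)).1.const_mul _)
      (fun x => by unfold axial; ring)).trans ?_
    rw [half, integral_const_Ω]
    have := b9 1 1
    refine mul_le_mul_of_nonneg_left ?_ (by norm_num)
    linarith
  have b12 : ∫ x in Ω, (c.ga 1 x + c.gb 0 x) ^ 2 ≤ C8 := by
    refine (integral_sq_add_three (f1 := fun x => 2 * c.shear x)
      (f2 := fun x => -1 * (c.p 0 x * c.p 1 x)) (f3 := fun _ => 0)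
      (hc.memLp_shear.const_mul _) (((hc.hp 0).memLp_mul (hc.hp 1)).1.const_mul _)
      (memLp_const 0) (fun x => by unfold shear; ring)).trans ?_
    rw [half, half, integral_const_Ω]
    have := b9 0 1
    refine mul_le_mul_of_nonneg_left ?_ (by norm_num)
    linarith
  -- Korn: the cross term of the shear square equals ∫ ∂_z b ∂_θ a, whose factors are already
  -- bounded.
  have b13 : (∫ x in Ω, c.ga 1 x ^ 2) + ∫ x in Ω, c.gb 0 x ^ 2 ≤ C8 + C6 + C7 := by
    have h1 := integral_mul_le (hc.hb.memLp_deriv 1) (hc.ha.memLp_deriv 0)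
    rw [← hc.ha.korn hc.hb] at h1
    have i1 : IntegrableOn (fun x => c.ga 1 x ^ 2) Ω := (hc.ha.memLp_deriv 1).integrable_sq
    have i2 : IntegrableOn (fun x => c.gb 0 x ^ 2) Ω := (hc.hb.memLp_deriv 0).integrable_sq
    have i3 : IntegrableOn (fun x => c.gb 0 x * c.ga 1 x) Ω :=
      (hc.hb.memLp_deriv 0).integrable_mul (hc.ha.memLp_deriv 1)
    have e : ∫ x in Ω, (c.ga 1 x + c.gb 0 x) ^ 2 = (∫ x in Ω, c.ga 1 x ^ 2)
        + (∫ x in Ω, c.gb 0 x ^ 2) + 2 * ∫ x in Ω, c.gb 0 x * c.ga 1 x := by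
      rw [← integral_add i1 i2, ← integral_const_mul, ← integral_add
        (integrableOn_add i1 i2) (integrableOn_const_mul 2 i3)]
      refine integral_congr_ae (Eventually.of_forall fun x => ?_)
      ring
    rw [e] at b12
    linarith
  have p2 : 0 ≤ C2 := (nn _).trans (b4 0 0)
  have p3 : 0 ≤ C3 := (nn _).trans (b6 0)
  have p4 : 0 ≤ C4 := (nn _).trans b7
  have p6 : 0 ≤ C6 := (nn _).trans b10
  have p7 : 0 ≤ C7 := (nn _).trans b11
  have p8 : 0 ≤ C8 := (nn _).trans b12
  have q1 := nn (c.ga 1)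
  have q2 := nn (c.gb 0)
  refine ⟨by linarith, fun j => by linarith [b6 j], fun j i => by linarith [b4 j i], fun i => ?_,
    fun i => ?_, by linarith, by linarith, by linarith⟩
  · fin_cases i <;> simp only [Fin.zero_eta, Fin.mk_one] <;> linarith
  · fin_cases i <;> simp only [Fin.zero_eta, Fin.mk_one] <;> linarith

/-- The energy sees the tangential displacements only through their gradients, so the mean may be
removed to make Poincaré applicable. -/
theorem exists_centered {f : ℝ × ℝ → ℝ} {g : Fin 2 → ℝ × ℝ → ℝ} (h : PerJet f g) {C : ℝ}
    (hC : ∀ i, ∫ x in Ω, g i x ^ 2 ≤ C) :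
    ∃ f', PerJet f' g ∧ ∫ x in Ω, f' x ^ 2 ≤ 2 * Real.pi ^ 2 * C + 1 / 2 * C := by
  set k := (∫ x in Ω, f x) / (2 * Real.pi)
  have hk := h.sub_const k
  refine ⟨_, hk, hk.poincare_Ω.trans ?_⟩
  have e : ∫ x in Ω, (f x - k) = 0 := by
    rw [integral_sub (integrableOn_of_memLp h.memLp) (integrable_const k), integral_const_Ω,
      mul_div_cancel₀ _ pi2_pos.ne', sub_self]
  rw [e, zero_pow two_ne_zero, zero_div, zero_add]
  exact add_le_add (mul_le_mul_of_nonneg_left (hC 0) (by positivity))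
    (mul_le_mul_of_nonneg_left (hC 1) (by positivity))

/-- All jets converge weakly, and Rellich upgrades the gradient of u to strong convergence. Its
products then converge in set integrals, the strains converge weakly, and each term of the energy is
weakly lower semicontinuous. -/
theorem exists_limit {c : ℕ → Conf} {I : ℝ} (hh : 0 < h) (hr : 1 ≤ r)
    (hc : ∀ n, (c n).Adm lam r m) (hE : ∀ n, (c n).E h lam ≤ M)
    (hI : Tendsto (fun n => (c n).E h lam) uf (𝓝 I)) : ∃ c' : Conf, c'.Adm lam r m ∧
      c'.E h lam ≤ I := by
  obtain ⟨C, hC⟩ := Adm.bounds hh lam M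
  have B := fun n => hC (c n) r m hr (hc n) (hE n)
  choose a' ha' hac using fun n => exists_centered (hc n).ha (B n).2.2.2.1
  choose b' hb' hbc using fun n => exists_centered (hc n).hb (B n).2.2.2.2.1
  obtain ⟨u, mu, wu⟩ := exists_wTendsto (fun n => (hc n).hu.memLp) (fun n => (B n).1)
  choose p mp wp using fun j => exists_wTendsto (fun n => ((hc n).hp j).memLp)
    (fun n => (B n).2.1 j)
  choose H mH wH using fun j i => exists_wTendsto (fun n => ((hc n).hp j).memLp_deriv i)
    (fun n => (B n).2.2.1 j i)
  obtain ⟨a, ma, wa⟩ := exists_wTendsto (fun n => (ha' n).memLp) hac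
  choose ga mga wga using fun i => exists_wTendsto (fun n => (ha' n).memLp_deriv i)
    (fun n => (B n).2.2.2.1 i)
  obtain ⟨b, mb, wb⟩ := exists_wTendsto (fun n => (hb' n).memLp) hbc
  choose gb mgb wgb using fun i => exists_wTendsto (fun n => (hb' n).memLp_deriv i)
    (fun n => (B n).2.2.2.2.1 i)
  have hadm : (Conf.mk u p H a ga b gb).Adm lam r m :=
    { hu := PerJet.of_wTendsto (fun n => (hc n).hu) mu mp wu wp
      hp := fun j => PerJet.of_wTendsto (fun n => (hc n).hp j) (mp j) (mH j) (wp j) (wH j)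
      ha := PerJet.of_wTendsto ha' ma mga wa wga
      hb := PerJet.of_wTendsto hb' mb mgb wb wgb
      obst := wu.le_ae (fun n => (hc n).hu.memLp) mu fun n => (hc n).obst
      bp := fun i => (wp i).eLpNorm_top_le (fun n => ((hc n).hp i).memLp) (mp i)
        fun n => (hc n).bp i
      bga := fun i => (wga i).eLpNorm_top_le (fun n => (ha' n).memLp_deriv i) (mga i)
        fun n => (hc n).bga i
      bgb := fun i => ((wgb i).sub_const (fun n => (hb' n).memLp_deriv i) (mgb i) _).eLpNorm_top_le
        (fun n => ((hb' n).memLp_deriv i).sub (memLp_const _)) ((mgb i).sub (memLp_const _))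
        fun n => (hc n).bgb i }
  refine ⟨_, hadm, ?_⟩
  have hps : ∀ j, L2Tendsto uf (fun n => (c n).p j) (p j) := fun j =>
    PerJet.rellich (fun n => (hc n).hp j) (hadm.hp j) (fun n i => (B n).2.2.1 j i) (wp j)
  have hprod : ∀ i j Q, MeasurableSet Q → Q ⊆ Ω → Tendsto (fun n => ∫ x in Q, (c n).p i x
      * (c n).p j x) uf (𝓝 (∫ x in Q, p i x * p j x)) := fun i j Q hQ hQΩ => by
    have hm : volume.restrict Q ≤ volume.restrict Ω := Measure.restrict_mono hQΩ le_rfl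
    exact tendsto_integral_mul (fun n => ((hc n).hp i).memLp.mono_measure hm)
      ((mp i).mono_measure hm) (fun n => ((hc n).hp j).memLp.mono_measure hm)
      ((mp j).mono_measure hm) ((hps i).restrict hQΩ) ((hps j).restrict hQΩ)
  have ion : ∀ {f : ℝ × ℝ → ℝ} {Q}, MemLp f 2 (volume.restrict Ω) → Q ⊆ Ω → IntegrableOn f Q :=
    fun hf hQ => (integrableOn_of_memLp hf).mono_set hQ
  have ihoop : ∀ {c : Conf}, c.Adm lam r m → ∀ Q ⊆ Ω, ∫ x in Q, c.hoop x = (∫ x in Q, c.ga 0 x)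
      + 1 / 2 * (∫ x in Q, c.p 0 x * c.p 0 x) + ∫ x in Q, c.u x := fun {c} hc Q hQ => by
    have i1 := ion (hc.ha.memLp_deriv 0) hQ
    have i2 := ion ((hc.hp 0).memLp_mul (hc.hp 0)).1 hQ
    unfold hoop
    rw [integral_add (integrableOn_add i1 (integrableOn_const_mul _ i2)) (ion hc.hu.memLp hQ),
      integral_add i1 (integrableOn_const_mul _ i2), integral_const_mul]
  have iaxial : ∀ {c : Conf}, c.Adm lam r m → ∀ Q ⊆ Ω, ∫ x in Q, c.axial lam x =
      (∫ x in Q, c.gb 1 x) - (∫ _ in Q, lam) + 1 / 2 * (∫ x in Q, c.p 1 x * c.p 1 x) :=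
    fun {c} hc Q hQ => by
    have i1 := ion (hc.hb.memLp_deriv 1) hQ
    have i2 := ion ((hc.hp 1).memLp_mul (hc.hp 1)).1 hQ
    have i3 := ion (memLp_const lam) hQ
    unfold axial
    rw [integral_add (integrableOn_sub i1 i3) (integrableOn_const_mul _ i2), integral_sub i1 i3, integral_const_mul]
  have ishear : ∀ {c : Conf}, c.Adm lam r m → ∀ Q ⊆ Ω, ∫ x in Q, c.shear x =
      1 / 2 * ((∫ x in Q, c.ga 1 x) + ∫ x in Q, c.gb 0 x)
        + 1 / 2 * (∫ x in Q, c.p 0 x * c.p 1 x) := fun {c} hc Q hQ => by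
    have i1 := ion (hc.ha.memLp_deriv 1) hQ
    have i2 := ion ((hc.hp 0).memLp_mul (hc.hp 1)).1 hQ
    have i3 := ion (hc.hb.memLp_deriv 0) hQ
    unfold shear
    rw [integral_add (integrableOn_const_mul _ (integrableOn_add i1 i3))
      (integrableOn_const_mul _ i2), integral_const_mul,
      integral_add i1 i3, integral_const_mul]
  have w1 : WTendsto (fun n => (c n).hoop) (Conf.mk u p H a ga b gb).hoop :=
    (wTendsto_of_setIntegral (fun n => (hc n).memLp_hoop) (fun n => (B n).2.2.2.2.2.1)
      (integrableOn_of_memLp hadm.memLp_hoop) fun Q hQ hQΩ => by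
        simp only [fun n => ihoop (hc n) Q hQΩ, ihoop hadm Q hQΩ]
        exact (((wga 0).setIntegral hQ hQΩ).add ((hprod 0 0 Q hQ hQΩ).const_mul _)).add
          (wu.setIntegral hQ hQΩ)).2
  have w2 : WTendsto (fun n => (c n).axial lam) ((Conf.mk u p H a ga b gb).axial lam) :=
    (wTendsto_of_setIntegral (fun n => (hc n).memLp_axial) (fun n => (B n).2.2.2.2.2.2.1)
      (integrableOn_of_memLp hadm.memLp_axial) fun Q hQ hQΩ => by
        simp only [fun n => iaxial (hc n) Q hQΩ, iaxial hadm Q hQΩ]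
        exact (((wgb 1).setIntegral hQ hQΩ).sub_const _).add
          ((hprod 1 1 Q hQ hQΩ).const_mul _)).2
  have w3 : WTendsto (fun n => (c n).shear) (Conf.mk u p H a ga b gb).shear :=
    (wTendsto_of_setIntegral (fun n => (hc n).memLp_shear) (fun n => (B n).2.2.2.2.2.2.2)
      (integrableOn_of_memLp hadm.memLp_shear) fun Q hQ hQΩ => by
        simp only [fun n => ishear (hc n) Q hQΩ, ishear hadm Q hQΩ]
        exact ((((wga 1).setIntegral hQ hQΩ).add ((wgb 0).setIntegral hQ hQΩ)).const_mul _).add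
          ((hprod 0 1 Q hQ hQΩ).const_mul _)).2
  -- Along the ultrafilter every bounded term has its own limit, so the lower semicontinuity
  -- estimates can simply be added.
  have lsc : ∀ {F : ℕ → ℝ × ℝ → ℝ} {f : ℝ × ℝ → ℝ}, WTendsto F f →
      (∀ n, MemLp (F n) 2 (volume.restrict Ω)) → MemLp f 2 (volume.restrict Ω) →
      (∀ n, ∫ x in Ω, F n x ^ 2 ≤ C) → ∃ y, Tendsto (fun n => ∫ x in Ω, F n x ^ 2) uf (𝓝 y) ∧
        ∫ x in Ω, f x ^ 2 ≤ y := fun hw hF hf hb => by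
    obtain ⟨y, hy⟩ := exists_tendsto_uf fun n => (abs_of_nonneg (integral_sq_nonneg _)).trans_le
      (hb n)
    exact ⟨y, hy, integral_sq_le_of_wTendsto hw hF hf hy⟩
  obtain ⟨y1, t1, l1⟩ := lsc w1 (fun n => (hc n).memLp_hoop) hadm.memLp_hoop
    (fun n => (B n).2.2.2.2.2.1)
  obtain ⟨y2, t2, l2⟩ := lsc w2 (fun n => (hc n).memLp_axial) hadm.memLp_axial
    (fun n => (B n).2.2.2.2.2.2.1)
  obtain ⟨y3, t3, l3⟩ := lsc w3 (fun n => (hc n).memLp_shear) hadm.memLp_shear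
    (fun n => (B n).2.2.2.2.2.2.2)
  choose yH tH lH using fun j i => lsc (wH j i) (fun n => ((hc n).hp j).memLp_deriv i) (mH j i)
    (fun n => (B n).2.2.1 j i)
  have hlim := ((t1.add t2).add (t3.const_mul 2)).add
    (((((tH 0 0).add (tH 0 1)).add (tH 1 0)).add (tH 1 1)).const_mul (h ^ 2))
  rw [tendsto_nhds_unique hI hlim]
  unfold E
  exact add_le_add (add_le_add (add_le_add l1 l2) (mul_le_mul_of_nonneg_left l3 (by norm_num)))
    (mul_le_mul_of_nonneg_left (add_le_add (add_le_add (add_le_add (lH 0 0) (lH 0 1)) (lH 1 0))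
      (lH 1 1)) (sq_nonneg h))

theorem exists_minimizer (hh : 0 < h) (hr : 1 ≤ r) (hne : ∃ c : Conf, c.Adm lam r m) :
    ∃ c : Conf, c.Adm lam r m ∧ ∀ c' : Conf, c'.Adm lam r m → c.E h lam ≤ c'.E h lam := by
  set S : Set ℝ := {e | ∃ c : Conf, c.Adm lam r m ∧ c.E h lam = e}
  have hS : S.Nonempty := by
    obtain ⟨c, hc⟩ := hne
    exact ⟨_, c, hc, rfl⟩
  have hb : BddBelow S := ⟨0, by rintro _ ⟨c, -, rfl⟩; exact E_nonneg c h lam⟩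
  obtain ⟨s, hs1, hs2, hs3⟩ := exists_seq_tendsto_sInf hS hb
  choose c hc hcs using hs3
  obtain ⟨M, hM⟩ := hs2.bddAbove_range
  obtain ⟨c', hc', hE⟩ := exists_limit (c := c) (M := M) (I := sInf S) hh hr hc
    (fun n => by rw [hcs]; exact hM ⟨n, rfl⟩)
    (by simp only [hcs]; exact hs2.mono_left uf_le_atTop)
  exact ⟨c', hc', fun d hd => hE.trans (csInf_le hb ⟨d, hd, rfl⟩)⟩

end Conf

/-! ### Configurations and displacement fields -/

namespace Conf

variable {c : Conf} {lam r h : ℝ} {m : ℝ≥0∞}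

/-- The displacement field described by a configuration. -/
def toDisp (c : Conf) (lam : ℝ) : Displacement := ⟨c.u, c.a, fun x => c.b x - lam * x.2⟩

theorem hasWeakDeriv_z (hb : PerJet c.b c.gb) (i : Fin 2) :
    HasWeakDeriv (interior Ω) i (c.toDisp lam).z (fun x => c.gb i x - if i = 1 then lam else 0) := by
  have hs : ContDiff ℝ ∞ fun x : ℝ × ℝ => -(lam * x.2) := (contDiff_const.mul contDiff_snd).neg
  have h2 := (hb.hasWeakDeriv i).add ((hasWeakDeriv_of_contDiff hs i).mono (subset_univ _))
  have e : ∀ x : ℝ × ℝ, pd i (fun x : ℝ × ℝ => -(lam * x.2)) x = -(if i = 1 then lam else 0) := by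
    intro x
    have : HasFDerivAt (fun x : ℝ × ℝ => -(lam * x.2)) (-(lam • ContinuousLinearMap.snd ℝ ℝ ℝ)) x :=
      (hasFDerivAt_snd.const_mul lam).neg
    rw [pd, this.fderiv]
    fin_cases i <;> simp [dir]
  simp only [e, ← sub_eq_add_neg] at h2
  exact h2

theorem Adm.mem_admissible (hc : c.Adm lam r m) : c.toDisp lam ∈ admissible lam r m := by
  refine ⟨memHPer_two hc.hu hc.hp, hc.ha.memHPer, ?_, hc.obst, fun i j => ?_⟩
  · simpa only [toDisp, sub_add_cancel] using hc.hb.memHPer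
  · have e0 := eLpNorm_congr_ae (p := ⊤) (weakDeriv_ae_eq (hc.hu.hasWeakDeriv i))
    have e1 := eLpNorm_congr_ae (p := ⊤) (weakDeriv_ae_eq (hc.ha.hasWeakDeriv i))
    have e2 := eLpNorm_congr_ae (p := ⊤) (weakDeriv_ae_eq (hasWeakDeriv_z (lam := lam) hc.hb i))
    fin_cases j
    · exact e0.trans_le (hc.bp i)
    · exact e1.trans_le (hc.bga i)
    · exact e2.trans_le (hc.bgb i)

/-- The off-diagonal strain occurs twice in the Frobenius norm, hence the factor 2 in front of the
shear. -/
theorem Adm.energy_eq (hc : c.Adm lam r m) :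
    (c.toDisp lam).energy h = ENNReal.ofReal (c.E h lam) := by
  have i1 : IntegrableOn (fun x => c.hoop x ^ 2) Ω := hc.memLp_hoop.integrable_sq
  have i2 : IntegrableOn (fun x => c.axial lam x ^ 2) Ω := hc.memLp_axial.integrable_sq
  have i3 : IntegrableOn (fun x => c.shear x ^ 2) Ω := hc.memLp_shear.integrable_sq
  have iH : ∀ j i, IntegrableOn (fun x => c.H j i x ^ 2) Ω := fun j i =>
    ((hc.hp j).memLp_deriv i).integrable_sq
  have j1 := integrableOn_add (integrableOn_add i1 i2) (integrableOn_const_mul 2 i3)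
  have j2 := integrableOn_add (integrableOn_add (iH 0 0) (iH 0 1)) (iH 1 0)
  have j3 := integrableOn_const_mul (h ^ 2) (integrableOn_add j2 (iH 1 1))
  have eE : c.E h lam = ∫ x in Ω, (c.hoop x ^ 2 + c.axial lam x ^ 2 + 2 * c.shear x ^ 2
      + h ^ 2 * (c.H 0 0 x ^ 2 + c.H 0 1 x ^ 2 + c.H 1 0 x ^ 2 + c.H 1 1 x ^ 2)) := by
    rw [integral_add j1 j3, integral_add (integrableOn_add i1 i2) (integrableOn_const_mul 2 i3),
      integral_add i1 i2, integral_const_mul, integral_const_mul, integral_add j2 (iH 1 1),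
      integral_add (integrableOn_add (iH 0 0) (iH 0 1)) (iH 1 0), integral_add (iH 0 0) (iH 0 1)]
    rfl
  rw [eE, ofReal_integral_eq_lintegral_ofReal (integrableOn_add j1 j3)
    (Eventually.of_forall fun x => by positivity)]
  unfold Displacement.energy
  refine lintegral_congr_ae ?_
  have wp := fun i => weakDeriv_ae_eq (hc.hu.hasWeakDeriv i)
  have wa := fun i => weakDeriv_ae_eq (hc.ha.hasWeakDeriv i)
  have wb := fun i => weakDeriv_ae_eq (hasWeakDeriv_z (lam := lam) hc.hb i)
  -- The inner weak derivative is first changed on a null set, then the outer one is identified.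
  have wH := fun j i => weakDeriv_ae_eq (((hc.hp j).hasWeakDeriv i).congr
    (f' := weakDeriv j c.u) (g' := c.H j i) (by rw [restrict_interior_Ω]; exact (wp j).symm)
    (ae_eq_refl _))
  filter_upwards [wp 0, wp 1, wa 0, wa 1, wb 0, wb 1, wH 0 0, wH 0 1, wH 1 0, wH 1 1]
    with x p0 p1 a0 a1 b0 b1 h00 h01 h10 h11
  congr 1
  have t0 : (c.toDisp lam).tangential 0 = c.a := rfl
  have t1 : (c.toDisp lam).tangential 1 = (c.toDisp lam).z := rfl
  have tr : (c.toDisp lam).rho = c.u := rfl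
  simp only [Fin.sum_univ_two, Displacement.strain, t0, t1, tr, p0, p1, a0, a1, b0, b1, h00, h01,
    h10, h11, hoop, axial, shear]
  simp
  ring

theorem exists_of_mem_admissible {φ : Displacement} (hφ : φ ∈ admissible lam r m) :
    ∃ c : Conf, c.Adm lam r m ∧ PerJet2 c.u c.p c.H ∧ c.toDisp lam = φ := by
  obtain ⟨h1, h2, h3, h4, h5⟩ := hφ
  obtain ⟨p, H, hj2, hwp, -⟩ := h1.exists_perJet2
  obtain ⟨ga, ha, hwa⟩ := h2.exists_perJet
  obtain ⟨gb, hb, -⟩ := h3.exists_perJet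
  set c : Conf := ⟨φ.rho, p, H, φ.theta, ga, fun x => φ.z x + lam * x.2, gb⟩
  have hcφ : c.toDisp lam = φ := by
    simp only [toDisp, c, add_sub_cancel_right]
  refine ⟨c, ⟨hj2.perJet, hj2.perJet_deriv, ha, hb, h4, fun i => ?_, fun i => ?_, fun i => ?_⟩,
    hj2, hcφ⟩
  · rw [← eLpNorm_congr_ae (weakDeriv_ae_eq (hwp i))]
    exact h5 i 0
  · rw [← eLpNorm_congr_ae (weakDeriv_ae_eq (hwa i))]
    exact h5 i 1
  · rw [← eLpNorm_congr_ae (weakDeriv_ae_eq (hasWeakDeriv_z (c := c) hb i)), hcφ]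
    exact h5 i 2

/-- Splits the rest of the work in two: a lower bound for all configurations with a second order
jet, and one good competitor. -/
theorem exists_isLeast_energy (hh : 0 < h) (hr : 1 ≤ r) {L U : ℝ}
    (hL : ∀ c : Conf, c.Adm lam r m → PerJet2 c.u c.p c.H → L ≤ c.E h lam)
    (hU : ∃ c : Conf, c.Adm lam r m ∧ c.E h lam ≤ U) :
    ∃ E : ℝ≥0, IsLeast (Displacement.energy h '' admissible lam r m) (E : ℝ≥0∞) ∧
      L ≤ (E : ℝ) ∧ (E : ℝ) ≤ U := by
  obtain ⟨c0, hc0, hE0⟩ := hU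
  obtain ⟨c, hc, hmin⟩ := exists_minimizer hh hr ⟨c0, hc0⟩
  refine ⟨NNReal.mk (c.E h lam) (E_nonneg c h lam), ⟨⟨c.toDisp lam, hc.mem_admissible, ?_⟩, ?_⟩, ?_,
    (hmin c0 hc0).trans hE0⟩
  · rw [hc.energy_eq, ENNReal.ofReal_eq_coe_nnreal (E_nonneg c h lam)]
  · rintro _ ⟨φ, hφ, rfl⟩
    obtain ⟨d, hd, -, rfl⟩ := exists_of_mem_admissible hφ
    rw [hd.energy_eq, ← ENNReal.ofReal_eq_coe_nnreal (E_nonneg c h lam)]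
    exact ENNReal.ofReal_le_ofReal (hmin d hd)
  -- The minimizer only carries separate jets for u and its gradient. Going to the displacement
  -- field and back yields a configuration of equal energy with a jointly approximated second order
  -- jet, as `hL` demands.
  · obtain ⟨d, hd, hd2, hdc⟩ := exists_of_mem_admissible hc.mem_admissible
    have e := hd.energy_eq (h := h)
    rw [hdc, hc.energy_eq, ENNReal.ofReal_eq_ofReal_iff (E_nonneg c h lam) (E_nonneg d h lam)] at e
    exact (hL d hd hd2).trans_eq e.symm

end Conf

/-! ### One-dimensional interpolation inequalities -/

theorem sq_integral_mul_le {α : Type*} [MeasurableSpace α] {μ : Measure α} {f g : α → ℝ}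
    (hf : MemLp f 2 μ) (hg : MemLp g 2 μ) :
    (∫ x, f x * g x ∂μ) ^ 2 ≤ (∫ x, f x ^ 2 ∂μ) * ∫ x, g x ^ 2 ∂μ := by
  have := real_inner_mul_inner_self_le (hf.toLp f) (hg.toLp g)
  simp only [inner_toLp] at this
  simpa only [pow_two] using this

theorem sq_intervalIntegral_mul_le {a b : ℝ} (hab : a ≤ b) {f g : ℝ → ℝ} (hf : Continuous f)
    (hg : Continuous g) : (∫ x in a..b, f x * g x) ^ 2
      ≤ (∫ x in a..b, f x ^ 2) * ∫ x in a..b, g x ^ 2 := by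
  simp only [intervalIntegral.integral_of_le hab]
  have hm : ∀ {k : ℝ → ℝ}, Continuous k → MemLp k 2 (volume.restrict (Ioc a b)) := fun {k} hk => by
    refine (memLp_two_iff_integrable_sq hk.aestronglyMeasurable).2 ?_
    exact ((hk.fun_pow 2).continuousOn.integrableOn_compact isCompact_Icc).mono_set
      Ioc_subset_Icc_self
  exact sq_integral_mul_le (hm hf) (hm hg)

section Slice

variable {f f' f'' : ℝ → ℝ}

/-- By the mean value theorem the difference quotient is a value of f' within distance l, so the
error is governed by f'' on a window of length l. Fubini and periodicity then integrate over the
window position. -/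
theorem integral_sq_sub_slope_le (h1 : ∀ t, HasDerivAt f (f' t) t)
    (h2 : ∀ t, HasDerivAt f' (f'' t) t) (hc : Continuous f'')
    (hper : Function.Periodic f'' 1) {l : ℝ} (hl : 0 < l) :
    ∫ y in (-(1 / 2))..(1 / 2), (f' y - (f (y + l) - f y) / l) ^ 2
      ≤ l ^ 2 * ∫ y in (-(1 / 2))..(1 / 2), f'' y ^ 2 := by
  have cf : Continuous f := continuous_iff_continuousAt.2 fun t => (h1 t).continuousAt
  have cf' : Continuous f' := continuous_iff_continuousAt.2 fun t => (h2 t).continuousAt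
  have pt : ∀ y, (f' y - (f (y + l) - f y) / l) ^ 2 ≤ l * ∫ t in (0)..l, f'' (y + t) ^ 2 := by
    intro y
    obtain ⟨ξ, hξ, e⟩ := exists_hasDerivAt_eq_slope f f' (by linarith : y < y + l)
      cf.continuousOn fun t _ => h1 t
    rw [add_sub_cancel_left] at e
    rw [← e]
    have := sq_sub_le_of_hasDerivAt (a := y) (b := y + l) h2 hc
      ⟨le_rfl, by linarith⟩ ⟨hξ.1.le, hξ.2.le⟩
    rw [add_sub_cancel_left] at this
    refine this.trans (le_of_eq ?_)
    rw [intervalIntegral.integral_comp_add_left (fun t => f'' t ^ 2), add_zero]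
  have c2 : Continuous fun x : ℝ × ℝ => f'' (x.1 + x.2) ^ 2 := by fun_prop
  calc _ ≤ ∫ y in (-(1 / 2))..(1 / 2), l * ∫ t in (0)..l, f'' (y + t) ^ 2 := by
        refine intervalIntegral.integral_mono_on (by norm_num)
          (Continuous.intervalIntegrable (by fun_prop) _ _)
          (Continuous.intervalIntegrable ((continuous_inner_snd c2).const_mul l) _ _)
          fun y _ => pt y
    _ = l * ∫ t in (0)..l, ∫ y in (-(1 / 2))..(1 / 2), f'' (y + t) ^ 2 := by
        rw [intervalIntegral.integral_const_mul, ← rect_integral (by norm_num) hl.le c2,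
          rect_integral_swap (by norm_num) hl.le c2]
    _ = l * ∫ t in (0)..l, ∫ y in (-(1 / 2))..(1 / 2), f'' y ^ 2 := by
        congr 2
        ext t
        rw [intervalIntegral.integral_comp_add_right (fun y => f'' y ^ 2)]
        have hp : Function.Periodic (fun y => f'' y ^ 2) 1 := fun y => by simp only [hper y]
        have := hp.intervalIntegral_add_eq (-(1 / 2) + t) (-(1 / 2))
        rw [show -(1 / 2) + t + 1 = 1 / 2 + t by ring,
          show (-(1 / 2) + 1 : ℝ) = 1 / 2 by norm_num] at this
        exact this
    _ = _ := by
        rw [intervalIntegral.integral_const, smul_eq_mul]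
        ring

/-- With M the maximum of |g|, g = f − f(x0), two estimates are combined: M³ ≤ 8XD from the
fundamental theorem applied to g², and D² ≤ 2MXY from integration by parts. Eliminating M gives the
claim. -/
theorem interpolation (h1 : ∀ t, HasDerivAt f (f' t) t)
    (h2 : ∀ t, HasDerivAt f' (f'' t) t) (hc : Continuous f'')
    (hper : f (1 / 2) = f (-(1 / 2))) (hper' : f' (1 / 2) = f' (-(1 / 2))) :
    (∫ y in (-(1 / 2))..(1 / 2), f' y ^ 2) ^ 5 ≤ 64 * (∫ y in (-(1 / 2))..(1 / 2), |f y|) ^ 4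
      * (∫ y in (-(1 / 2))..(1 / 2), f'' y ^ 2) ^ 3 := by
  have cf : Continuous f := continuous_iff_continuousAt.2 fun t => (h1 t).continuousAt
  have cf' : Continuous f' := continuous_iff_continuousAt.2 fun t => (h2 t).continuousAt
  have hI : (-(1 / 2) : ℝ) ≤ 1 / 2 := by norm_num
  set X := ∫ y in (-(1 / 2))..(1 / 2), |f y| with hX
  set D := ∫ y in (-(1 / 2))..(1 / 2), f' y ^ 2 with hD
  set Y := ∫ y in (-(1 / 2))..(1 / 2), f'' y ^ 2 with hY
  have hX0 : 0 ≤ X := intervalIntegral.integral_nonneg hI fun _ _ => abs_nonneg _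
  have hD0 : 0 ≤ D := intervalIntegral.integral_nonneg hI fun _ _ => sq_nonneg _
  have hY0 : 0 ≤ Y := intervalIntegral.integral_nonneg hI fun _ _ => sq_nonneg _
  -- Subtracting the value of f where |f| is smallest creates a zero and at most doubles the L¹
  -- norm.
  obtain ⟨x0, hx0, hmin⟩ := isCompact_Icc.exists_isMinOn (nonempty_Icc.2 hI) cf.abs.continuousOn
  set g : ℝ → ℝ := fun y => f y - f x0
  have cg : Continuous g := cf.sub continuous_const
  have dg : ∀ t, HasDerivAt g (f' t) t := fun t => (h1 t).sub_const _
  have hf0 : |f x0| ≤ X := by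
    have := intervalIntegral.integral_mono_on hI (f := fun _ => |f x0|) (g := fun y => |f y|)
      (intervalIntegrable_const (μ := volume)) (cf.abs.intervalIntegrable _ _)
      (fun y hy => hmin hy)
    rw [intervalIntegral.integral_const, smul_eq_mul] at this
    norm_num at this ⊢
    exact this
  have hgX : ∫ y in (-(1 / 2))..(1 / 2), |g y| ≤ 2 * X := by
    have := intervalIntegral.integral_mono_on hI (μ := volume) (f := fun y => |g y|)
      (g := fun y => |f y| + |f x0|) (cg.abs.intervalIntegrable _ _)
      ((cf.abs.add continuous_const).intervalIntegrable _ _) (fun y _ => abs_sub _ _)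
    rw [intervalIntegral.integral_add (cf.abs.intervalIntegrable _ _)
      (intervalIntegrable_const (μ := volume)),
      intervalIntegral.integral_const, smul_eq_mul] at this
    norm_num at this ⊢
    linarith
  obtain ⟨x1, hx1, hmax⟩ := isCompact_Icc.exists_isMaxOn (nonempty_Icc.2 hI) cg.abs.continuousOn
  set M := |g x1|
  have hM0 : 0 ≤ M := abs_nonneg _
  have hgM : ∀ y ∈ Icc (-(1 / 2) : ℝ) (1 / 2), |g y| ≤ M := fun y hy => hmax hy
  have hg2 : ∫ y in (-(1 / 2))..(1 / 2), g y ^ 2 ≤ M * (2 * X) := by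
    have := intervalIntegral.integral_mono_on hI (μ := volume) (f := fun y => g y ^ 2)
      (g := fun y => M * |g y|) ((cg.fun_pow 2).intervalIntegrable _ _)
      ((continuous_const.mul cg.abs).intervalIntegrable _ _) (fun y hy => by
        rw [← sq_abs, pow_two]
        exact mul_le_mul_of_nonneg_right (hgM y hy) (abs_nonneg _))
    rw [intervalIntegral.integral_const_mul] at this
    exact this.trans (mul_le_mul_of_nonneg_left hgX hM0)
  have hg20 : 0 ≤ ∫ y in (-(1 / 2))..(1 / 2), g y ^ 2 :=
    intervalIntegral.integral_nonneg hI fun _ _ => sq_nonneg _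
  -- the sup bound
  have hM4 : M ^ 4 ≤ 8 * M * X * D := by
    have d2 : ∀ t, HasDerivAt (fun t => g t ^ 2) (2 * g t * f' t) t := fun t => by
      simpa using (dg t).fun_pow 2
    have a1 := abs_sub_le_of_hasDerivAt d2 ((continuous_const.mul cg).mul cf') hx1 hx0
    have e0 : g x0 = 0 := sub_self _
    rw [e0, zero_pow two_ne_zero, sub_zero, abs_of_nonneg (sq_nonneg _)] at a1
    have a2 : ∫ t in (-(1 / 2))..(1 / 2), |2 * g t * f' t|
        = 2 * ∫ t in (-(1 / 2))..(1 / 2), |g t| * |f' t| := by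
      rw [← intervalIntegral.integral_const_mul]
      congr 1
      ext t
      rw [abs_mul, abs_mul, abs_two, mul_assoc]
    have a3 := sq_intervalIntegral_mul_le hI cg.abs cf'.abs
    simp only [sq_abs] at a3
    have a4 : 0 ≤ ∫ t in (-(1 / 2))..(1 / 2), |g t| * |f' t| :=
      intervalIntegral.integral_nonneg hI fun _ _ => mul_nonneg (abs_nonneg _) (abs_nonneg _)
    have hMg : M ^ 2 = g x1 ^ 2 := sq_abs _
    rw [a2, ← hMg] at a1
    calc M ^ 4 = (M ^ 2) ^ 2 := by ring
      _ ≤ (2 * ∫ t in (-(1 / 2))..(1 / 2), |g t| * |f' t|) ^ 2 :=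
        pow_le_pow_left₀ (sq_nonneg _) a1 2
      _ = 4 * (∫ t in (-(1 / 2))..(1 / 2), |g t| * |f' t|) ^ 2 := by ring
      _ ≤ 4 * ((M * (2 * X)) * D) := by
        refine mul_le_mul_of_nonneg_left (a3.trans ?_) (by norm_num)
        exact mul_le_mul_of_nonneg_right hg2 hD0
      _ = _ := by ring
  -- Periodicity of f and f' removes the boundary terms in the integration by parts.
  have hD2 : D ^ 2 ≤ M * (2 * X) * Y := by
    have ibp := intervalIntegral.integral_mul_deriv_eq_deriv_mul (a := -(1 / 2)) (b := 1 / 2)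
      (fun t _ => dg t) (fun t _ => h2 t) (cf'.intervalIntegrable _ _) (hc.intervalIntegrable _ _)
    have eg : g (1 / 2) = g (-(1 / 2)) := by simp only [g, hper]
    rw [eg, hper', sub_self, zero_sub] at ibp
    have e : D = -∫ y in (-(1 / 2))..(1 / 2), g y * f'' y := by
      rw [ibp, neg_neg]
      simp only [hD, pow_two]
    rw [e, neg_sq]
    exact (sq_intervalIntegral_mul_le hI cg hc).trans (mul_le_mul_of_nonneg_right hg2 hY0)
  rcases hD0.eq_or_lt with h0 | hDp
  · rw [← h0, zero_pow (by norm_num)]; positivity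
  rcases hM0.eq_or_lt with h0 | hMp
  · rw [← h0] at hD2
    have := pow_pos hDp 2
    linarith
  have hM3 : M ^ 3 ≤ 8 * X * D := by
    have : M * M ^ 3 ≤ M * (8 * X * D) := by nlinarith
    exact le_of_mul_le_mul_left this hMp
  have h6 : D * D ^ 5 ≤ D * (64 * X ^ 4 * Y ^ 3) := by
    calc D * D ^ 5 = (D ^ 2) ^ 3 := by ring
      _ ≤ (M * (2 * X) * Y) ^ 3 := pow_le_pow_left₀ (sq_nonneg _) hD2 3
      _ = M ^ 3 * (8 * X ^ 3 * Y ^ 3) := by ring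
      _ ≤ 8 * X * D * (8 * X ^ 3 * Y ^ 3) := mul_le_mul_of_nonneg_right hM3 (by positivity)
      _ = _ := by ring
  exact le_of_mul_le_mul_left h6 hDp

end Slice

/-- The energy per slice is bounded below by the few-wrinkles scaling. -/
theorem slice_lower {A h lam X D Y S : ℝ} (hA : 0 < A) (hh : 0 < h) (hlam : 0 < lam) (hX : 0 ≤ X)
    (hY : 0 ≤ Y) (hS : S ≤ lam ^ 2)
    (hS' : S ≤ A ^ (4 / 7 : ℝ) * h ^ (6 / 7 : ℝ) * lam ^ (5 / 7 : ℝ))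
    (hD : D ^ 5 ≤ 64 * X ^ 4 * Y ^ 3) :
    S / 4 ≤ 2 * A * X + h ^ 2 * Y + lam * max (3 * lam / 4 - 1 / 2 * D) 0 := by
  have hAX : 0 ≤ A * X := by positivity
  have hhY : 0 ≤ h ^ 2 * Y := by positivity
  rcases le_total D lam with hle | hle
  -- Too little length is absorbed on this slice, so the axial term alone pays λ²/4.
  · have h1 : lam / 4 ≤ max (3 * lam / 4 - 1 / 2 * D) 0 := le_max_of_le_left (by linarith)
    have := mul_le_mul_of_nonneg_left h1 hlam.le
    nlinarith
  · have h1 : 0 ≤ lam * max (3 * lam / 4 - 1 / 2 * D) 0 := mul_nonneg hlam.le (le_max_right _ _)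
    set P := A ^ (4 / 7 : ℝ) * h ^ (6 / 7 : ℝ) * lam ^ (5 / 7 : ℝ) with hP
    have hP7 : P ^ 7 = A ^ 4 * h ^ 6 * lam ^ 5 := by
      rw [hP, mul_pow, mul_pow]
      simp only [← Real.rpow_natCast, ← Real.rpow_mul hA.le, ← Real.rpow_mul hh.le,
        ← Real.rpow_mul hlam.le]
      norm_num
    set F := A * X + h ^ 2 * Y
    -- The exponents 4 and 3 of the interpolation inequality reproduce P⁷ up to the constant 64,
    -- which is at most 2⁷.
    have hF : P ≤ 2 * F := by
      refine le_of_pow_le_pow_left₀ (n := 7) (by norm_num) (by positivity) ?_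
      rw [hP7]
      calc A ^ 4 * h ^ 6 * lam ^ 5 ≤ A ^ 4 * h ^ 6 * (64 * X ^ 4 * Y ^ 3) :=
            mul_le_mul_of_nonneg_left ((pow_le_pow_left₀ hlam.le hle 5).trans hD) (by positivity)
        _ = 64 * ((A * X) ^ 4 * (h ^ 2 * Y) ^ 3) := by ring
        _ ≤ 64 * (F ^ 4 * F ^ 3) := by
            gcongr
            · simp only [F]; linarith
            · simp only [F]; linarith
        _ ≤ (2 * F) ^ 7 := by
            have : 0 ≤ F ^ 7 := by positivity
            ring_nf
            linarith
    have h2 : 0 ≤ F := by positivity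
    have h3 : F ≤ 2 * A * X + h ^ 2 * Y := by simp only [F]; linarith
    linarith

theorem L2Tendsto.abs {ι : Type*} {l : Filter ι} {F : ι → ℝ × ℝ → ℝ} {f : ℝ × ℝ → ℝ}
    (h : L2Tendsto l F f) : L2Tendsto l (fun n x => |F n x|) (fun x => |f x|) :=
  tendsto_of_tendsto_of_tendsto_of_le_of_le tendsto_const_nhds h (fun _ => zero_le)
    fun n => eLpNorm_mono fun x => by
      simpa using abs_abs_sub_abs_le (F n x) (f x)

theorem L2Tendsto.integral_abs {ι : Type*} {l : Filter ι} {F : ι → ℝ × ℝ → ℝ} {f : ℝ × ℝ → ℝ}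
    (h : L2Tendsto l F f) (hF : ∀ n, MemLp (F n) 2 (volume.restrict Ω))
    (hf : MemLp f 2 (volume.restrict Ω)) :
    Tendsto (fun n => ∫ x in Ω, |F n x|) l (𝓝 (∫ x in Ω, |f x|)) := by
  simpa only [mul_one] using h.abs.integral_mul (l2Tendsto_const fun _ => 1)
    (fun n => (hF n).abs) hf.abs (fun _ => memLp_const 1) (memLp_const 1)

/-- The few-wrinkles lower bound in integrated form, for smooth functions. -/
theorem exists_strip_of_smoothPer {ψ : ℝ × ℝ → ℝ} (hψ : SmoothPer ψ) {A h lam S : ℝ} (hA : 0 < A)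
    (hh : 0 < h) (hlam : 0 < lam) (hS : S ≤ lam ^ 2)
    (hS' : S ≤ A ^ (4 / 7 : ℝ) * h ^ (6 / 7 : ℝ) * lam ^ (5 / 7 : ℝ)) :
    ∃ T : Set ℝ, MeasurableSet T ∧ 2 * Real.pi * (S / 4) ≤ 2 * A * (∫ x in Ω, |ψ x|)
      + h ^ 2 * (∫ x in Ω, pd 1 (pd 1 ψ) x ^ 2)
      + lam * (∫ x in Ω, T.indicator (fun _ => (1 : ℝ)) x.1
        * (3 * lam / 4 - 1 / 2 * pd 1 ψ x ^ 2)) := by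
  have c0 := hψ.1.continuous
  have c1 := (hψ.pd 1).1.continuous
  have c2 := ((hψ.pd 1).pd 1).1.continuous
  set Dn : ℝ → ℝ := fun x => ∫ y in (-(1 / 2))..(1 / 2), pd 1 ψ (x, y) ^ 2
  have cD : Continuous Dn := continuous_inner_snd (c1.fun_pow 2)
  -- The slices on which the positive part is active. Trading the positive part for a set of slices
  -- leaves an expression linear in |∂_zψ|².
  set T : Set ℝ := {x | 1 / 2 * Dn x < 3 * lam / 4}
  have hT : MeasurableSet T := (isOpen_lt (continuous_const.mul cD) continuous_const).measurableSet
  have cX : Continuous fun x => ∫ y in (-(1 / 2))..(1 / 2), |ψ (x, y)| :=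
    continuous_inner_snd c0.abs
  have cY : Continuous fun x => ∫ y in (-(1 / 2))..(1 / 2), pd 1 (pd 1 ψ) (x, y) ^ 2 :=
    continuous_inner_snd (c2.fun_pow 2)
  have hI : (-(1 / 2) : ℝ) ≤ 1 / 2 := by norm_num
  have per : ∀ {k : ℝ × ℝ → ℝ}, SmoothPer k → ∀ x, k (x, 1 / 2) = k (x, -(1 / 2)) := by
    intro k hk x
    have := (hk.2 (x, -(1 / 2))).2
    rwa [show ((x, -(1 / 2)) : ℝ × ℝ) + (0, 1) = (x, 1 / 2) by ext <;> norm_num] at this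
  have slice : ∀ x, S / 4 ≤ 2 * A * (∫ y in (-(1 / 2))..(1 / 2), |ψ (x, y)|)
      + h ^ 2 * (∫ y in (-(1 / 2))..(1 / 2), pd 1 (pd 1 ψ) (x, y) ^ 2)
      + lam * max (3 * lam / 4 - 1 / 2 * Dn x) 0 := fun x =>
    slice_lower hA hh hlam (intervalIntegral.integral_nonneg hI fun _ _ => abs_nonneg _)
      (intervalIntegral.integral_nonneg hI fun _ _ => sq_nonneg _) hS hS'
      (interpolation (fun t => hasDerivAt_snd hψ.1 x t)
        (fun t => hasDerivAt_snd (hψ.pd 1).1 x t) (c2.comp (by fun_prop))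
        (per hψ x) (per (hψ.pd 1) x))
  have cm : Continuous fun x => max (3 * lam / 4 - 1 / 2 * Dn x) 0 := by fun_prop
  have k1 : Continuous fun x => 2 * A * (∫ y in (-(1 / 2))..(1 / 2), |ψ (x, y)|) := by fun_prop
  have k2 : Continuous fun x =>
    h ^ 2 * (∫ y in (-(1 / 2))..(1 / 2), pd 1 (pd 1 ψ) (x, y) ^ 2) := by fun_prop
  have k12 : Continuous fun x => 2 * A * (∫ y in (-(1 / 2))..(1 / 2), |ψ (x, y)|)
    + h ^ 2 * (∫ y in (-(1 / 2))..(1 / 2), pd 1 (pd 1 ψ) (x, y) ^ 2) := k1.add k2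
  have k3 : Continuous fun x => lam * max (3 * lam / 4 - 1 / 2 * Dn x) 0 := by fun_prop
  have s1 := intervalIntegral.integral_mono_on pi2_pos.le
    (intervalIntegrable_const (μ := volume)) ((k12.add k3).intervalIntegrable _ _)
    fun x _ => slice x
  simp only [Pi.add_apply] at s1
  rw [intervalIntegral.integral_add (k12.intervalIntegrable _ _) (k3.intervalIntegrable _ _),
    intervalIntegral.integral_add (k1.intervalIntegrable _ _) (k2.intervalIntegrable _ _)] at s1
  simp only [intervalIntegral.integral_const_mul] at s1
  rw [intervalIntegral.integral_const, smul_eq_mul, sub_zero, ← integral_Ω c0.abs,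
    ← integral_Ω (c2.fun_pow 2)] at s1
  have mT := memLp_indicator_fst hT
  have i1 : IntegrableOn (fun x : ℝ × ℝ => T.indicator (fun _ => (1 : ℝ)) x.1
      * (3 * lam / 4 - 1 / 2 * pd 1 ψ x ^ 2)) Ω :=
    mT.integrable_mul (memLp_of_continuous (by fun_prop) isCompact_Ω)
  have e1 : ∫ x in (0)..(2 * Real.pi), max (3 * lam / 4 - 1 / 2 * Dn x) 0
      = ∫ x in Ω, T.indicator (fun _ => (1 : ℝ)) x.1
        * (3 * lam / 4 - 1 / 2 * pd 1 ψ x ^ 2) := by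
    rw [Ω, Measure.volume_eq_prod, setIntegral_prod _ i1,
      intervalIntegral.integral_of_le pi2_pos.le, integral_Icc_eq_integral_Ioc]
    refine integral_congr_ae (Eventually.of_forall fun x => ?_)
    simp only [integral_const_mul, integral_Icc_eq_integral_Ioc,
      ← intervalIntegral.integral_of_le hI]
    have cs : Continuous fun y => pd 1 ψ (x, y) ^ 2 := (c1.fun_pow 2).comp (by fun_prop)
    rw [intervalIntegral.integral_sub intervalIntegrable_const
      ((cs.const_mul _).intervalIntegrable _ _), intervalIntegral.integral_const,
      intervalIntegral.integral_const_mul]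
    by_cases hx : x ∈ T
    · rw [indicator_of_mem hx, max_eq_left (sub_nonneg.2 (le_of_lt hx))]
      norm_num [Dn]
    · rw [indicator_of_notMem hx, max_eq_right (sub_nonpos.2 (not_lt.1 hx)), zero_mul]
  rw [e1] at s1
  exact ⟨T, hT, s1⟩

theorem integral_abs_mul_abs_sub_tendsto {F : ℕ → ℝ × ℝ → ℝ} {f : ℝ × ℝ → ℝ}
    (h : L2Tendsto atTop F f) (hF : ∀ n, MemLp (F n) 2 (volume.restrict Ω))
    (hf : MemLp f 2 (volume.restrict Ω)) :
    Tendsto (fun n => ∫ x in Ω, |f x| * |F n x - f x|) atTop (𝓝 0) := by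
  have hz : L2Tendsto atTop (fun n x => |F n x - f x|) (fun _ => 0) := by
    refine tendsto_of_tendsto_of_tendsto_of_le_of_le tendsto_const_nhds h (fun _ => zero_le)
      fun n => eLpNorm_mono fun x => ?_
    simp
  have := (l2Tendsto_const (l := (atTop : Filter ℕ)) fun x => |f x|).integral_mul hz
    (fun _ => hf.abs) hf.abs (fun n => ((hF n).sub hf).abs) (memLp_const 0)
  simpa only [mul_zero, integral_zero] using this

/-- The few-wrinkles lower bound in integrated form. -/
theorem PerJet2.exists_strip {w p H} (hw : PerJet2 w p H) {A h lam S : ℝ} (hA : 0 < A) (hh : 0 < h)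
    (hlam : 0 < lam) (hS : S ≤ lam ^ 2)
    (hS' : S ≤ A ^ (4 / 7 : ℝ) * h ^ (6 / 7 : ℝ) * lam ^ (5 / 7 : ℝ)) {δ : ℝ} (hδ : 0 < δ) :
    ∃ T : Set ℝ, MeasurableSet T ∧ 2 * Real.pi * (S / 4) ≤ 2 * A * (∫ x in Ω, |w x|)
      + h ^ 2 * (∫ x in Ω, H 1 1 x ^ 2)
      + lam * (∫ x in Ω, T.indicator (fun _ => (1 : ℝ)) x.1
        * (3 * lam / 4 - 1 / 2 * (p 1 x * p 1 x))) + δ := by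
  obtain ⟨ψ, hψ, h0, h1, h2⟩ := hw.approx
  have t0 := h0.integral_abs (fun n => (hψ n).memLp) hw.memLp
  have t2 := (h2 1 1).integral_sq (fun n => (((hψ n).pd 1).pd 1).memLp) (hw.memLp_deriv2 1 1)
  have t1 : Tendsto (fun n => ∫ x in Ω, |p 1 x| * |pd 1 (ψ n) x - p 1 x|) atTop (𝓝 0) := 
    integral_abs_mul_abs_sub_tendsto (h1 1) (fun n => ((hψ n).pd 1).memLp) (hw.memLp_deriv 1)
  have hlim := ((t0.const_mul (2 * A)).add (t2.const_mul (h ^ 2))).add (t1.const_mul lam)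
  rw [mul_zero, add_zero] at hlim
  obtain ⟨n, hn⟩ := (hlim.eventually (gt_mem_nhds (lt_add_of_pos_right _ hδ))).exists
  obtain ⟨T, hT, s1⟩ := exists_strip_of_smoothPer (hψ n) hA hh hlam hS hS'
  refine ⟨T, hT, ?_⟩
  have c1 := ((hψ n).pd 1).1.continuous
  have mT := memLp_indicator_fst hT
  have i1 : IntegrableOn (fun x : ℝ × ℝ => T.indicator (fun _ => (1 : ℝ)) x.1
      * (3 * lam / 4 - 1 / 2 * pd 1 (ψ n) x ^ 2)) Ω :=
    mT.integrable_mul (memLp_of_continuous (by fun_prop) isCompact_Ω)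
  have i2 : IntegrableOn (fun x : ℝ × ℝ => |p 1 x| * |pd 1 (ψ n) x - p 1 x|) Ω :=
    (hw.memLp_deriv 1).abs.integrable_mul (((hψ n).pd 1).memLp.sub (hw.memLp_deriv 1)).abs
  have hpp := (hw.perJet_deriv 1).memLp_mul (hw.perJet_deriv 1)
  have i3 : IntegrableOn (fun x : ℝ × ℝ => T.indicator (fun _ => (1 : ℝ)) x.1
      * (3 * lam / 4 - 1 / 2 * (p 1 x * p 1 x))) Ω :=
    mT.integrable_mul ((memLp_const _).sub (hpp.1.const_mul _))
  -- By convexity −q²/2 ≤ −a²/2 + |a||q − a|. The resulting error does not involve T, which matters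
  -- because T depends on the approximant.
  have e2 : ∫ x in Ω, T.indicator (fun _ => (1 : ℝ)) x.1
        * (3 * lam / 4 - 1 / 2 * pd 1 (ψ n) x ^ 2)
      ≤ (∫ x in Ω, T.indicator (fun _ => (1 : ℝ)) x.1 * (3 * lam / 4 - 1 / 2 * (p 1 x * p 1 x)))
        + ∫ x in Ω, |p 1 x| * |pd 1 (ψ n) x - p 1 x| := by
    rw [← integral_add i3 i2]
    refine integral_mono i1 (integrableOn_add i3 i2) fun x => ?_
    set a := p 1 x
    set q := pd 1 (ψ n) x
    have hq : -(a * (q - a)) ≤ |a| * |q - a| := by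
      rw [← abs_mul]; exact neg_le_abs _
    by_cases hx : x.1 ∈ T
    · simp only [indicator_of_mem hx]
      nlinarith [sq_nonneg (q - a)]
    · simp only [indicator_of_notMem hx, zero_mul, zero_add]
      positivity
  have e3 := mul_le_mul_of_nonneg_left e2 hlam.le
  linarith

/-! ### Lower bounds -/

theorem pd_sub_const (i : Fin 2) (f : ℝ × ℝ → ℝ) (k : ℝ) : pd i (fun x => f x - k) = pd i f := by
  ext x
  simp [pd, fderiv_sub_const]

theorem PerJet2.sub_const {f g H} (h : PerJet2 f g H) (k : ℝ) :
    PerJet2 (fun x => f x - k) g H := by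
  obtain ⟨ψ, hψ, h0, h1, h2⟩ := h.approx
  refine ⟨h.memLp.sub (memLp_const k), h.memLp_deriv, h.memLp_deriv2,
    fun n x => ψ n x - k, fun n => ⟨(hψ n).1.sub contDiff_const, fun x => ?_⟩, ?_, ?_, ?_⟩
  · have := (hψ n).2 x
    exact ⟨by simp only [this.1], by simp only [this.2]⟩
  · refine h0.congr fun n => ?_
    congr 1
    ext x
    simp
  · simpa only [pd_sub_const] using h1
  · simpa only [pd_sub_const] using h2

/-! ### Difference quotients in z -/

section Slope

variable {ψ : ℝ × ℝ → ℝ} {l : ℝ}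

theorem SmoothPer.integral_sq_sub_slope_le (hψ : SmoothPer ψ) (hl : 0 < l) :
    ∫ x in Ω, (VKD.pd 1 ψ x - (ψ (x.1, x.2 + l) - ψ x) / l) ^ 2
      ≤ l ^ 2 * ∫ x in Ω, VKD.pd 1 (VKD.pd 1 ψ) x ^ 2 := by
  have c0 := hψ.1.continuous
  have c1 := (hψ.pd 1).1.continuous
  have c2 := ((hψ.pd 1).pd 1).1.continuous
  rw [integral_Ω (by fun_prop), integral_Ω (by fun_prop), ← intervalIntegral.integral_const_mul]
  have k1 : Continuous fun x : ℝ × ℝ => (VKD.pd 1 ψ x - (ψ (x.1, x.2 + l) - ψ x) / l) ^ 2 := by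
    fun_prop
  have k2 : Continuous fun x : ℝ × ℝ => VKD.pd 1 (VKD.pd 1 ψ) x ^ 2 := by fun_prop
  refine intervalIntegral.integral_mono_on pi2_pos.le
    ((continuous_inner_snd k1).intervalIntegrable _ _)
    (((continuous_inner_snd k2).const_mul _).intervalIntegrable _ _) fun x _ => ?_
  refine VKD.integral_sq_sub_slope_le (fun t => hasDerivAt_snd hψ.1 x t)
    (fun t => hasDerivAt_snd (hψ.pd 1).1 x t) (c2.comp (by fun_prop)) (fun t => ?_) hl
  simpa using (((hψ.pd 1).pd 1).2 (x, t)).2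

theorem SmoothPer.integral_abs_slope_le (hψ : SmoothPer ψ) (hl : 0 < l) :
    ∫ x in Ω, |(ψ (x.1, x.2 + l) - ψ x) / l| ≤ 2 / l * ∫ x in Ω, |ψ x| := by
  have c0 := hψ.1.continuous
  have k0 : Continuous fun x : ℝ × ℝ => |ψ x| := c0.abs
  have k1 : Continuous fun x : ℝ × ℝ => |ψ (x.1, x.2 + l)| := by fun_prop
  have shift : ∫ x in Ω, |ψ (x.1, x.2 + l)| = ∫ x in Ω, |ψ x| := by
    rw [integral_Ω k1, integral_Ω k0]
    congr 1
    ext x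
    have hp : Function.Periodic (fun y => |ψ (x, y)|) 1 := fun y => by
      have := (hψ.2 (x, y)).2
      simp only [Prod.mk_add_mk, add_zero] at this
      simp only [this]
    simp only
    rw [intervalIntegral.integral_comp_add_right (fun y => |ψ (x, y)|)]
    have := hp.intervalIntegral_add_eq (-(1 / 2) + l) (-(1 / 2))
    rwa [show -(1 / 2) + l + 1 = 1 / 2 + l by ring,
      show (-(1 / 2) + 1 : ℝ) = 1 / 2 by norm_num] at this
  calc ∫ x in Ω, |(ψ (x.1, x.2 + l) - ψ x) / l|
      ≤ ∫ x in Ω, l⁻¹ * (|ψ (x.1, x.2 + l)| + |ψ x|) := by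
        refine integral_mono (integrableOn_Ω (by fun_prop)) (integrableOn_Ω (by fun_prop))
          fun x => ?_
        simp only
        rw [abs_div, abs_of_pos hl, div_eq_inv_mul]
        exact mul_le_mul_of_nonneg_left (abs_sub _ _) (inv_nonneg.2 hl.le)
    _ = l⁻¹ * ((∫ x in Ω, |ψ (x.1, x.2 + l)|) + ∫ x in Ω, |ψ x|) := by
        rw [integral_const_mul, integral_add (integrableOn_Ω k1) (integrableOn_Ω k0)]
    _ = _ := by
        rw [shift]
        ring

end Slope

/-- Interpolation between the `L¹` norm and the second derivative under a slope bound. -/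
theorem PerJet2.integral_sq_le {w p H} (hw : PerJet2 w p H) {m l : ℝ} (hm : 0 ≤ m)
    (hp : ∀ᵐ x ∂(volume.restrict Ω), |p 1 x| ≤ m) (hl : 0 < l) :
    ∫ x in Ω, p 1 x ^ 2 ≤ 3 * (l ^ 2 * ∫ x in Ω, H 1 1 x ^ 2)
      + 2 * m * (2 / l * ∫ x in Ω, |w x|) := by
  obtain ⟨ψ, hψ, h0, h1, h2⟩ := hw.approx
  have t0 := h0.integral_abs (fun n => (hψ n).memLp) hw.memLp
  have tD := (h1 1).integral_sq (fun n => ((hψ n).pd 1).memLp) (hw.memLp_deriv 1)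
  have t2 := (h2 1 1).integral_sq (fun n => (((hψ n).pd 1).pd 1).memLp) (hw.memLp_deriv2 1 1)
  have te : Tendsto (fun n => ∫ x in Ω, (pd 1 (ψ n) x - p 1 x) ^ 2) atTop (𝓝 0) := by
    have hz : L2Tendsto atTop (fun n x => pd 1 (ψ n) x - p 1 x) (fun _ => 0) := by
      refine (h1 1).congr fun n => ?_
      congr 1
      ext x
      simp
    simpa using hz.integral_sq (fun n => ((hψ n).pd 1).memLp.sub (hw.memLp_deriv 1)) (memLp_const 0)
  have hlim := ((t2.const_mul (l ^ 2)).const_mul 3).add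
    (((t0.const_mul (2 / l)).const_mul (2 * m)).add (te.const_mul 3))
  rw [mul_zero, add_zero] at hlim
  refine le_of_tendsto_of_tendsto' tD hlim fun n => ?_
  have c0 := (hψ n).1.continuous
  have c1 := ((hψ n).pd 1).1.continuous
  have b1 := (hψ n).integral_sq_sub_slope_le hl
  have b2 := (hψ n).integral_abs_slope_le hl
  set R : ℝ × ℝ → ℝ := fun x => (ψ n (x.1, x.2 + l) - ψ n x) / l
  have cR : Continuous R := by simp only [R]; fun_prop
  have i1 : IntegrableOn (fun x => 3 * (pd 1 (ψ n) x - R x) ^ 2) Ω :=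
    integrableOn_Ω (by fun_prop)
  have i2 : IntegrableOn (fun x => 2 * m * |R x|) Ω := integrableOn_Ω (by fun_prop)
  have i3 : IntegrableOn (fun x => (pd 1 (ψ n) x - p 1 x) ^ 2) Ω :=
    (((hψ n).pd 1).memLp.sub (hw.memLp_deriv 1)).integrable_sq
  have i3' := integrableOn_const_mul 3 i3
  -- The slope bound is known for the limit `p 1` only, not for the approximants. It is therefore
  -- used on the product `q * s`, and the discrepancy `a - q` disappears in the limit.
  have key : ∫ x in Ω, pd 1 (ψ n) x ^ 2 ≤ ∫ x in Ω, (3 * (pd 1 (ψ n) x - R x) ^ 2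
      + (2 * m * |R x| + 3 * (pd 1 (ψ n) x - p 1 x) ^ 2)) := by
    refine integral_mono_ae (integrableOn_Ω (by fun_prop))
      (integrableOn_add i1 (integrableOn_add i2 i3')) ?_
    filter_upwards [hp] with x hx
    set a := pd 1 (ψ n) x
    set q := p 1 x
    set s := R x
    have hqs : q * s ≤ m * |s| := (le_abs_self _).trans (by
      rw [abs_mul]; exact mul_le_mul_of_nonneg_right hx (abs_nonneg _))
    nlinarith [sq_nonneg (a / 2 - (a - s)), sq_nonneg (a / 2 - (a - q)),
      sq_nonneg ((a - q) + (a - s))]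
  rw [integral_add i1 (integrableOn_add i2 i3'), integral_add i2 i3', integral_const_mul,
    integral_const_mul, integral_const_mul] at key
  refine key.trans (add_le_add (mul_le_mul_of_nonneg_left b1 (by norm_num))
    (add_le_add (mul_le_mul_of_nonneg_left b2 (by linarith)) le_rfl))

namespace Conf

variable {c : Conf} {lam r h : ℝ} {m : ℝ≥0∞}

/-- Linearise the hoop energy at A by (hoop − A)² ≥ 0. The mean of the hoop strain is at least the
mean of u, and the obstacle turns the mean of u − A into an L¹ norm. -/
theorem Adm.excess_lower (hc : c.Adm lam r m) (hr : 1 ≤ r) : bulkEnergy r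
    + (2 * (r - 1) * (∫ x in Ω, |c.u x - (r - 1)|) + h ^ 2 * (∫ x in Ω, c.H 1 1 x ^ 2))
    + (∫ x in Ω, c.axial lam x ^ 2) ≤ c.E h lam := by
  have nn := fun f => integral_sq_nonneg f
  set A := r - 1
  have hA : 0 ≤ A := sub_nonneg.2 hr
  have eX : ∫ x in Ω, |c.u x - A| = (∫ x in Ω, c.u x) - 2 * Real.pi * A := by
    rw [← integral_const_Ω A, ← integral_sub (integrableOn_of_memLp hc.hu.memLp)
      (integrable_const A)]
    refine integral_congr_ae ?_
    filter_upwards [hc.obst] with x hx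
    exact abs_of_nonneg (sub_nonneg.2 hx)
  have i1 : IntegrableOn (fun x => c.hoop x ^ 2) Ω := hc.memLp_hoop.integrable_sq
  have i2 := integrableOn_const_mul (2 * A) (integrableOn_of_memLp hc.memLp_hoop)
  have b1 : 2 * A * (∫ x in Ω, c.hoop x) - 2 * Real.pi * A ^ 2 ≤ ∫ x in Ω, c.hoop x ^ 2 := by
    rw [← integral_const_Ω (A ^ 2), ← integral_const_mul, ← integral_sub i2 (integrable_const _)]
    refine integral_mono (integrableOn_sub i2 (integrable_const _)) i1 fun x => ?_
    simp only
    nlinarith [sq_nonneg (c.hoop x - A)]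
  rw [hc.integral_hoop] at b1
  have b2 := mul_nonneg hA (nn (c.p 0))
  have b3 := nn c.shear
  have b4 := mul_nonneg (sq_nonneg h) (nn (c.H 0 0))
  have b5 := mul_nonneg (sq_nonneg h) (nn (c.H 0 1))
  have b6 := mul_nonneg (sq_nonneg h) (nn (c.H 1 0))
  have eB : bulkEnergy r = 2 * Real.pi * A ^ 2 := by rw [bulkEnergy, volume_Ω]
  rw [eB, eX]
  unfold E
  nlinarith

/-- Expand (ε_zz + λ/2)² ≥ 0 on the strip; the term linear in the axial derivative integrates to
zero there. -/
theorem Adm.strip_le (hc : c.Adm lam r m) {T : Set ℝ} (hT : MeasurableSet T) :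
    lam * (∫ x in Ω, T.indicator (fun _ => (1 : ℝ)) x.1
      * (3 * lam / 4 - 1 / 2 * (c.p 1 x * c.p 1 x))) ≤ ∫ x in Ω, c.axial lam x ^ 2 := by
  have mT := memLp_indicator_fst hT
  have i1 : IntegrableOn (fun x : ℝ × ℝ => T.indicator (fun _ => (1 : ℝ)) x.1
      * (3 * lam / 4 - 1 / 2 * (c.p 1 x * c.p 1 x))) Ω :=
    mT.integrable_mul ((memLp_const _).sub (((hc.hp 1).memLp_mul (hc.hp 1)).1.const_mul _))
  have i2 : IntegrableOn (fun x => c.axial lam x ^ 2) Ω := hc.memLp_axial.integrable_sq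
  have i3 : IntegrableOn (fun x : ℝ × ℝ => T.indicator (fun _ => (1 : ℝ)) x.1 * c.gb 1 x) Ω :=
    mT.integrable_mul (hc.hb.memLp_deriv 1)
  have key : ∫ x in Ω, lam * (T.indicator (fun _ => (1 : ℝ)) x.1
      * (3 * lam / 4 - 1 / 2 * (c.p 1 x * c.p 1 x))) ≤ ∫ x in Ω, (c.axial lam x ^ 2
      + lam * (T.indicator (fun _ => (1 : ℝ)) x.1 * c.gb 1 x)) := by
    refine integral_mono (integrableOn_const_mul _ i1)
      (integrableOn_add i2 (integrableOn_const_mul _ i3)) fun x => ?_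
    by_cases hx : x.1 ∈ T
    · simp only [indicator_of_mem hx, axial]
      nlinarith [sq_nonneg ((c.gb 1 x - lam) + 1 / 2 * (c.p 1 x * c.p 1 x) + lam / 2)]
    · simp only [indicator_of_notMem hx, zero_mul, mul_zero, add_zero]
      positivity
  rwa [integral_add i2 (integrableOn_const_mul _ i3), integral_const_mul, integral_const_mul,
    hc.hb.integral_strip hT, mul_zero, add_zero] at key

/-- The few-wrinkles lower bound. -/
theorem Adm.lower_few (hc : c.Adm lam r m) (h2 : PerJet2 c.u c.p c.H) (hr : 1 < r) (hh : 0 < h)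
    (hlam : 0 < lam) {S : ℝ} (hS0 : 0 ≤ S) (hS : S ≤ lam ^ 2)
    (hS' : S ≤ (r - 1) ^ (4 / 7 : ℝ) * h ^ (6 / 7 : ℝ) * lam ^ (5 / 7 : ℝ)) :
    S ≤ c.E h lam - bulkEnergy r := by
  have hE := hc.excess_lower (h := h) hr.le
  have key : 2 * Real.pi * (S / 4) ≤ c.E h lam - bulkEnergy r := by
    refine le_of_forall_pos_le_add fun δ hδ => ?_
    obtain ⟨T, hT, hb⟩ := (h2.sub_const (r - 1)).exists_strip (sub_pos.2 hr) hh hlam hS hS' hδ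
    have := hc.strip_le hT
    linarith
  nlinarith [Real.pi_gt_three]

/-- The wrinkles absorb at most half of the imposed compression, so the mean axial strain stays
below −λ/2. -/
theorem Adm.sq_le_integral_axial (hc : c.Adm lam r m) (hlam : 0 < lam)
    (hD : ∫ x in Ω, c.p 1 x ^ 2 ≤ 2 * Real.pi * lam) :
    lam ^ 2 ≤ ∫ x in Ω, c.axial lam x ^ 2 := by
  have ig := integrableOn_of_memLp (hc.hb.memLp_deriv 1)
  have ip := integrableOn_const_mul (1 / 2)
    (integrableOn_of_memLp ((hc.hp 1).memLp_mul (hc.hp 1)).1)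
  have il : IntegrableOn (fun _ : ℝ × ℝ => lam) Ω := integrable_const lam
  have e : ∫ x in Ω, c.axial lam x = 1 / 2 * (∫ x in Ω, c.p 1 x ^ 2) - 2 * Real.pi * lam := by
    unfold axial
    rw [integral_add (integrableOn_sub ig il) ip, integral_sub ig il, hc.hb.integral_deriv 1,
      integral_const_Ω, integral_const_mul]
    simp only [pow_two]
    ring
  have i2 : IntegrableOn (fun x => c.axial lam x ^ 2) Ω := hc.memLp_axial.integrable_sq
  have i1 := integrableOn_const_mul (-lam) (integrableOn_of_memLp hc.memLp_axial)
  have il2 : IntegrableOn (fun _ : ℝ × ℝ => lam ^ 2 / 4) Ω := integrable_const _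
  have key : ∫ x in Ω, (-lam * c.axial lam x - lam ^ 2 / 4) ≤ ∫ x in Ω, c.axial lam x ^ 2 :=
    integral_mono (integrableOn_sub i1 il2) i2 fun x => by
      change -lam * c.axial lam x - lam ^ 2 / 4 ≤ c.axial lam x ^ 2
      nlinarith [sq_nonneg (c.axial lam x + lam / 2)]
  rw [integral_sub i1 il2, integral_const_mul, integral_const_Ω, e] at key
  nlinarith [Real.pi_gt_three, mul_le_mul_of_nonneg_left hD hlam.le, mul_pos hlam hlam]

/-- The many-wrinkles lower bound. -/
theorem Adm.lower_many {M : ℝ} (hc : c.Adm lam r (ENNReal.ofReal M)) (h2 : PerJet2 c.u c.p c.H)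
    (hM : 2 ≤ M) (hr : 1 < r) (hh : 0 < h) (hlam : 0 < lam) {S : ℝ} (hS0 : 0 ≤ S)
    (hS : S ≤ lam ^ 2) (hS' : S ≤ (r - 1) ^ (2 / 3 : ℝ) * h ^ (2 / 3 : ℝ) * lam) :
    S / M ≤ c.E h lam - bulkEnergy r := by
  have hE := hc.excess_lower (h := h) hr.le
  set A := r - 1
  have hA : 0 < A := sub_pos.2 hr
  set X := ∫ x in Ω, |c.u x - A|
  have hX : 0 ≤ X := integral_nonneg fun _ => abs_nonneg _
  set Y := ∫ x in Ω, c.H 1 1 x ^ 2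
  have hY : 0 ≤ Y := integral_sq_nonneg _
  have hZ := integral_sq_nonneg (c.axial lam)
  have hM0 : 0 < M := by linarith
  have hAX : 0 ≤ A * X := by positivity
  have hhY : 0 ≤ h ^ 2 * Y := by positivity
  by_cases hD : ∫ x in Ω, c.p 1 x ^ 2 ≤ 2 * Real.pi * lam
  · have := hc.sq_le_integral_axial hlam hD
    have : S / M ≤ S := div_le_self hS0 (by linarith)
    linarith
  · rw [not_le] at hD
    have hp : ∀ᵐ x ∂(volume.restrict Ω), |c.p 1 x| ≤ M := by
      filter_upwards [ae_le_eLpNormEssSup (f := c.p 1) (μ := volume.restrict Ω)] with x hx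
      have := hx.trans ((eLpNorm_exponent_top (f := c.p 1)).symm.trans_le (hc.bp 1))
      rw [Real.enorm_eq_ofReal_abs] at this
      exact (ENNReal.ofReal_le_ofReal_iff hM0.le).1 this
    -- The optimal length is l = k/A = h^{2/3}A^{-1/3}: then l²Y = h²Y/k and X/l = AX/k, so both
    -- terms carry the weights of the energy.
    set k := A ^ (2 / 3 : ℝ) * h ^ (2 / 3 : ℝ) with hk
    have hk0 : 0 < k := by positivity
    have hk3 : k ^ 3 = A ^ 2 * h ^ 2 := by
      rw [hk, mul_pow]
      simp only [← Real.rpow_natCast, ← Real.rpow_mul hA.le, ← Real.rpow_mul hh.le]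
      norm_num
    have hb := (h2.sub_const A).integral_sq_le hM0.le hp (l := k / A) (by positivity)
    have e1 : (k / A) ^ 2 * Y = h ^ 2 * Y / k := by
      field_simp
      rw [hk3]
      ring
    have e2 : 2 / (k / A) * X = 2 * (A * X) / k := by
      field_simp
    change _ ≤ 3 * ((k / A) ^ 2 * Y) + 2 * M * (2 / (k / A) * X) at hb
    rw [e1, e2] at hb
    -- The bending coefficient 3 is absorbed by 2M, using M ≥ 2.
    have h3 : 2 * Real.pi * lam * k ≤ 2 * M * (2 * (A * X) + h ^ 2 * Y) := by
      have := hD.le.trans hb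
      rw [← mul_le_mul_iff_left₀ hk0] at this
      refine this.trans ?_
      have e : (3 * (h ^ 2 * Y / k) + 2 * M * (2 * (A * X) / k)) * k
          = 3 * (h ^ 2 * Y) + 2 * M * (2 * (A * X)) := by field_simp
      rw [e]
      nlinarith
    rw [div_le_iff₀ hM0]
    have h4 : 2 * (A * X) + h ^ 2 * Y ≤ c.E h lam - bulkEnergy r := by linarith
    have h5 := mul_le_mul_of_nonneg_left h4 hM0.le
    have h6 : lam * k ≤ Real.pi * (lam * k) :=
      le_mul_of_one_le_left (by positivity) (by linarith [Real.pi_gt_three])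
    linarith

end Conf

/-! ### Wrinkle profiles -/

/-- A nonnegative smooth `1`-periodic profile with unit Dirichlet energy which is concentrated at
length scale `s`. -/
structure IsProfile (K s : ℝ) (p : ℝ → ℝ) : Prop where
  smooth : ContDiff ℝ ∞ p
  periodic : Function.Periodic p 1
  nonneg : ∀ z, 0 ≤ p z
  integral_deriv_sq : ∫ z in (-(1 / 2))..(1 / 2), deriv p z ^ 2 = 1
  deriv_sq_le : ∀ z, deriv p z ^ 2 ≤ 2 / s
  integral_le : ∫ z in (-(1 / 2))..(1 / 2), p z ≤ K * (s * √s)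
  integral_sq_le : ∫ z in (-(1 / 2))..(1 / 2), p z ^ 2 ≤ K * s ^ 2
  integral_deriv2_sq_le : ∫ z in (-(1 / 2))..(1 / 2), deriv (deriv p) z ^ 2 ≤ K / s ^ 2

theorem intervalIntegral_le_of_le {f : ℝ → ℝ} {C : ℝ} (hf : Continuous f) (h : ∀ z, f z ≤ C) :
    ∫ z in (-(1 / 2))..(1 / 2), f z ≤ C := by
  have := intervalIntegral.integral_mono_on (μ := volume) (by norm_num : (-(1 / 2) : ℝ) ≤ 1 / 2)
    (hf.intervalIntegrable _ _) (intervalIntegrable_const (c := C)) fun z _ => h z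
  rw [intervalIntegral.integral_const, smul_eq_mul] at this
  norm_num at this ⊢
  exact this

theorem hasDerivAt_sin_mul (k z : ℝ) :
    HasDerivAt (fun z => Real.sin (k * z)) (k * Real.cos (k * z)) z := by
  simpa [mul_comm] using ((hasDerivAt_id z).const_mul k).sin

theorem hasDerivAt_cos_mul (k z : ℝ) :
    HasDerivAt (fun z => Real.cos (k * z)) (-(k * Real.sin (k * z))) z := by
  simpa [mul_comm] using ((hasDerivAt_id z).const_mul k).cos

/-- For s bounded away from zero a single smooth profile suffices; its squared slope 2 sin² is at
most 2 ≤ 2/s. -/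
theorem isProfile_cos {K s : ℝ} (hK : 100 ≤ K) (hs : 1 / 10 ≤ s) (hs1 : s ≤ 1) :
    IsProfile K s fun z => (1 - Real.cos (2 * Real.pi * z)) * (√2 / (2 * Real.pi)) := by
  have hpi := Real.pi_gt_three
  have hpi4 := Real.pi_lt_four
  have hpi' := Real.pi_lt_d2
  have hs0 : 0 < s := by linarith
  set κ := 2 * Real.pi with hκ
  have hκ0 : 0 < κ := by positivity
  have e2 : √2 ^ 2 = (2 : ℝ) := Real.sq_sqrt (by norm_num)
  have hr2 : √2 ≤ (2 : ℝ) := by nlinarith [Real.sqrt_nonneg 2]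
  set p : ℝ → ℝ := fun z => (1 - Real.cos (κ * z)) * (√2 / κ)
  have d1 : deriv p = fun z => √2 * Real.sin (κ * z) := by
    ext z
    have := (((hasDerivAt_cos_mul κ z).const_sub 1).mul_const (√2 / κ)).deriv
    simp only [p]
    rw [this]
    field_simp
  have d2 : deriv (deriv p) = fun z => √2 * (κ * Real.cos (κ * z)) := by
    rw [d1]
    ext z
    exact ((hasDerivAt_sin_mul κ z).const_mul _).deriv
  have cp : Continuous p := by simp only [p]; fun_prop
  have hp1 : ∀ z, p z ≤ 1 := fun z => by
    have h1 : 1 - Real.cos (κ * z) ≤ 2 := by linarith [Real.neg_one_le_cos (κ * z)]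
    have h2 : √2 / κ ≤ 1 / 3 := by
      rw [div_le_div_iff₀ hκ0 (by norm_num)]; linarith
    have := mul_le_mul h1 h2 (by positivity) (by norm_num)
    simp only [p]; linarith
  have hp0 : ∀ z, 0 ≤ p z := fun z =>
    mul_nonneg (sub_nonneg.2 (Real.cos_le_one _)) (by positivity)
  have hss : 1 / 4 ≤ √s := Real.le_sqrt_of_sq_le (by norm_num; linarith)
  refine ⟨by fun_prop, fun z => ?_, hp0, ?_, fun z => ?_, ?_, ?_, ?_⟩
  · simp only [p, mul_add, mul_one, hκ, Real.cos_add_two_pi]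
  · have hF : ∀ z ∈ uIcc (-(1 / 2) : ℝ) (1 / 2),
        HasDerivAt (fun z => z - Real.sin (2 * κ * z) / (2 * κ)) (deriv p z ^ 2) z := fun z _ => by
      have h := (hasDerivAt_id z).sub ((hasDerivAt_sin_mul (2 * κ) z).div_const (2 * κ))
      refine h.congr_deriv ?_
      rw [d1, mul_pow, e2, mul_div_cancel_left₀ _ (by positivity), mul_assoc, Real.cos_two_mul,
        Real.sin_sq]
      ring
    rw [intervalIntegral.integral_eq_sub_of_hasDerivAt hF
      (Continuous.intervalIntegrable (by rw [d1]; fun_prop) _ _)]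
    have s1 : Real.sin (2 * κ * (1 / 2)) = 0 := by
      rw [show 2 * κ * (1 / 2) = 2 * Real.pi by rw [hκ]; ring, Real.sin_two_pi]
    have s2 : Real.sin (2 * κ * (-(1 / 2))) = 0 := by rw [mul_neg, Real.sin_neg, s1, neg_zero]
    rw [s1, s2]
    norm_num
  · rw [d1, le_div_iff₀ hs0, mul_pow, e2]
    nlinarith [Real.sin_sq_le_one (κ * z), sq_nonneg (Real.sin (κ * z))]
  · refine (intervalIntegral_le_of_le cp hp1).trans ?_
    have : (1 / 10) * (1 / 4) ≤ s * √s := mul_le_mul hs hss (by norm_num) hs0.le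
    nlinarith
  · refine (intervalIntegral_le_of_le (by fun_prop) fun z => pow_le_one₀ (n := 2) (hp0 z)
      (hp1 z)).trans ?_
    nlinarith
  · refine (intervalIntegral_le_of_le (C := 80) (by rw [d2]; fun_prop) fun z => ?_).trans ?_
    · rw [d2, mul_pow, e2, mul_pow]
      have : κ ^ 2 ≤ 40 := by rw [hκ]; nlinarith
      nlinarith [Real.cos_sq_le_one (κ * z), sq_nonneg (Real.cos (κ * z)), sq_nonneg κ]
    · rw [le_div_iff₀ (by positivity)]
      nlinarith

section Peak

variable {σ : ℝ}

/-- The unnormalized peaked profile. -/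
def peak (σ z : ℝ) : ℝ := (1 + Real.sin (Real.pi * z) ^ 2 / σ ^ 2)⁻¹

/-- The derivative of the peaked profile. -/
def peak' (σ z : ℝ) : ℝ :=
  -(2 * Real.pi * (Real.sin (Real.pi * z) * Real.cos (Real.pi * z)) / σ ^ 2) * peak σ z ^ 2

/-- The second derivative of the peaked profile. -/
def peak'' (σ z : ℝ) : ℝ :=
  -(2 * Real.pi ^ 2 * (Real.cos (Real.pi * z) ^ 2 - Real.sin (Real.pi * z) ^ 2) / σ ^ 2)
      * peak σ z ^ 2
    + 2 * (2 * Real.pi * (Real.sin (Real.pi * z) * Real.cos (Real.pi * z)) / σ ^ 2) ^ 2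
      * peak σ z ^ 3

theorem one_le_peak_inv (σ z : ℝ) : 1 ≤ 1 + Real.sin (Real.pi * z) ^ 2 / σ ^ 2 := by
  have : 0 ≤ Real.sin (Real.pi * z) ^ 2 / σ ^ 2 := by positivity
  linarith

theorem peak_pos (σ z : ℝ) : 0 < peak σ z := inv_pos.2 (by linarith [one_le_peak_inv σ z])

theorem peak_le_one (σ z : ℝ) : peak σ z ≤ 1 := inv_le_one_of_one_le₀ (one_le_peak_inv σ z)

theorem contDiff_peak (σ : ℝ) : ContDiff ℝ ∞ (peak σ) := by
  refine ContDiff.inv (by fun_prop) fun z => ?_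
  linarith [one_le_peak_inv σ z]

theorem hasDerivAt_peak (σ z : ℝ) : HasDerivAt (peak σ) (peak' σ z) z := by
  have h1 := ((((hasDerivAt_sin_mul Real.pi z).fun_pow 2).div_const (σ ^ 2)).const_add 1).fun_inv
    (by linarith [one_le_peak_inv σ z])
  refine h1.congr_deriv ?_
  simp only [peak', peak]
  rw [inv_pow]
  ring

theorem hasDerivAt_peak' (σ z : ℝ) : HasDerivAt (peak' σ) (peak'' σ z) z := by
  have h1 := (((((hasDerivAt_sin_mul Real.pi z).fun_mul (hasDerivAt_cos_mul Real.pi z)).const_mul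
    (2 * Real.pi)).div_const (σ ^ 2)).fun_neg).fun_mul ((hasDerivAt_peak σ z).fun_pow 2)
  refine h1.congr_deriv ?_
  simp only [peak'', peak']
  push_cast
  ring

theorem continuous_peak (σ : ℝ) : Continuous (peak σ) := (contDiff_peak σ).continuous

theorem continuous_peak' (σ : ℝ) : Continuous (peak' σ) := by
  have := continuous_peak σ
  unfold peak'
  fun_prop

theorem continuous_peak'' (σ : ℝ) : Continuous (peak'' σ) := by
  have := continuous_peak σ
  unfold peak''
  fun_prop

theorem periodic_peak (σ : ℝ) : Function.Periodic (peak σ) 1 := fun z => by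
  simp only [peak, mul_add, mul_one, Real.sin_add_pi, neg_sq]

theorem two_mul_sq_le_sin_sq {z : ℝ} (hz : z ∈ Icc (-(1 / 2) : ℝ) (1 / 2)) :
    (2 * z) ^ 2 ≤ Real.sin (Real.pi * z) ^ 2 := by
  have key : ∀ {t : ℝ}, 0 ≤ t → t ≤ 1 / 2 → 2 * t ≤ Real.sin (Real.pi * t) := fun {t} h0 h1 => by
    have hpi := Real.pi_pos
    have := Real.mul_le_sin (x := Real.pi * t) (by positivity) (by nlinarith)
    rwa [show 2 / Real.pi * (Real.pi * t) = 2 * t by field_simp] at this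
  rcases le_total 0 z with h0 | h0
  · exact pow_le_pow_left₀ (by linarith) (key h0 hz.2) 2
  · have := pow_le_pow_left₀ (by linarith) (key (neg_nonneg.2 h0) (by linarith [hz.1])) 2
    simpa using this

/-- Jordan's inequality |sin πz| ≥ 2|z| compares the peak with a Lorentzian of width σ/2, whose
integral is an arctangent. -/
theorem integral_peak_le (hσ : 0 < σ) : ∫ z in (-(1 / 2))..(1 / 2), peak σ z ≤ 2 * σ := by
  have hI : (-(1 / 2) : ℝ) ≤ 1 / 2 := by norm_num
  have cc : Continuous fun z : ℝ => (1 + (z / (σ / 2)) ^ 2)⁻¹ :=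
    Continuous.inv₀ (by fun_prop) fun z => by positivity
  calc ∫ z in (-(1 / 2))..(1 / 2), peak σ z
      ≤ ∫ z in (-(1 / 2))..(1 / 2), (1 + (z / (σ / 2)) ^ 2)⁻¹ := by
        refine intervalIntegral.integral_mono_on hI ((continuous_peak σ).intervalIntegrable _ _)
          (cc.intervalIntegrable _ _) fun z hz => ?_
        refine inv_anti₀ (by positivity) (add_le_add le_rfl ?_)
        rw [div_div_eq_mul_div, mul_comm, div_pow]
        exact div_le_div_of_nonneg_right (two_mul_sq_le_sin_sq hz) (by positivity)
    _ = σ / 2 * (Real.arctan (1 / 2 / (σ / 2)) - Real.arctan (-(1 / 2) / (σ / 2))) := by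
        rw [intervalIntegral.integral_comp_div (fun z => (1 + z ^ 2)⁻¹) (by positivity),
          integral_inv_one_add_sq, smul_eq_mul]
    _ ≤ σ / 2 * 4 := by
        refine mul_le_mul_of_nonneg_left ?_ (by positivity)
        linarith [Real.arctan_lt_pi_div_two (1 / 2 / (σ / 2)),
          Real.neg_pi_div_two_lt_arctan (-(1 / 2) / (σ / 2)), Real.pi_lt_four]
    _ = 2 * σ := by ring

theorem sin_sq_mul_peak_le (σ z : ℝ) :
    Real.sin (Real.pi * z) ^ 2 / σ ^ 2 * peak σ z ≤ 1 := by
  have h := one_le_peak_inv σ z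
  rw [peak, mul_inv_le_iff₀ (by linarith)]
  linarith

/-- With g = 1/(1 + q), the essential factor 4q g² is at most 1 by the arithmetic-geometric mean
inequality. -/
theorem peak'_sq_le (hσ : 0 < σ) (z : ℝ) : peak' σ z ^ 2 ≤ Real.pi ^ 2 / σ ^ 2 := by
  set q := Real.sin (Real.pi * z) ^ 2 / σ ^ 2 with hq
  set g := peak σ z with hg
  have hq0 : 0 ≤ q := by positivity
  have hg0 := peak_pos σ z
  have hg1 := peak_le_one σ z
  have hgq : g * (1 + q) = 1 := inv_mul_cancel₀ (by positivity)
  have e : peak' σ z ^ 2 = Real.pi ^ 2 / σ ^ 2 * Real.cos (Real.pi * z) ^ 2 * g ^ 2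
      * (4 * q * g ^ 2) := by
    simp only [peak', hq, ← hg]
    field_simp
    ring
  have h1 : 4 * q * g ^ 2 ≤ 1 := by
    have : (g * (1 - q)) ^ 2 = 1 - 4 * q * g ^ 2 := by
      have : (g * (1 + q)) ^ 2 = 1 := by rw [hgq]; norm_num
      linarith [this]
    nlinarith [sq_nonneg (g * (1 - q))]
  have h2 : g ^ 2 ≤ 1 := pow_le_one₀ hg0.le hg1
  have h3 := Real.cos_sq_le_one (Real.pi * z)
  have h4 : 0 ≤ Real.pi ^ 2 / σ ^ 2 := by positivity
  rw [e]
  calc _ ≤ Real.pi ^ 2 / σ ^ 2 * 1 * 1 * 1 := by gcongr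
    _ = _ := by ring

/-- One factor of the peak is kept so that integration gains the width σ. -/
theorem peak''_sq_le (hσ : 0 < σ) (z : ℝ) :
    peak'' σ z ^ 2 ≤ (10 * Real.pi ^ 2 / σ ^ 2) ^ 2 * peak σ z := by
  have hqg := sin_sq_mul_peak_le σ z
  set q := Real.sin (Real.pi * z) ^ 2 / σ ^ 2 with hq
  set g := peak σ z with hg
  have hq0 : 0 ≤ q := by positivity
  have hg0 := peak_pos σ z
  have hg1 := peak_le_one σ z
  have hc := Real.cos_sq_le_one (Real.pi * z)
  have hs := Real.sin_sq_le_one (Real.pi * z)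
  set S := Real.sin (Real.pi * z)
  set C := Real.cos (Real.pi * z)
  have e : peak'' σ z = 2 * Real.pi ^ 2 / σ ^ 2 * g ^ 2
      * (-(C ^ 2 - S ^ 2) + 4 * (q * g) * C ^ 2) := by
    simp only [peak'', hq, ← hg]
    field_simp
    ring
  have b : (-(C ^ 2 - S ^ 2) + 4 * (q * g) * C ^ 2) ^ 2 ≤ 5 ^ 2 := by
    refine sq_le_sq' ?_ ?_
    · have : 0 ≤ 4 * (q * g) * C ^ 2 := by positivity
      nlinarith [sq_nonneg S]
    · have : (q * g) * C ^ 2 ≤ 1 := mul_le_one₀ hqg (sq_nonneg _) hc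
      nlinarith [sq_nonneg C]
  have hg4 : (g ^ 2) ^ 2 ≤ g := by
    have : g ^ 3 ≤ 1 := pow_le_one₀ hg0.le hg1
    nlinarith
  rw [e, mul_pow, mul_pow]
  calc (2 * Real.pi ^ 2 / σ ^ 2) ^ 2 * (g ^ 2) ^ 2 * (-(C ^ 2 - S ^ 2) + 4 * (q * g) * C ^ 2) ^ 2
      ≤ (2 * Real.pi ^ 2 / σ ^ 2) ^ 2 * g * 5 ^ 2 := by gcongr
    _ = _ := by ring

/-- The peak falls from 1 to at most 1/2 over [0, σ/2], and Cauchy–Schwarz bounds the Dirichlet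
energy of such a drop from below. The condition σ ≤ 1 keeps that interval inside the period. -/
theorem le_integral_peak'_sq (hσ : 0 < σ) (hσ1 : σ ≤ 1) :
    1 / (2 * σ) ≤ ∫ z in (-(1 / 2))..(1 / 2), peak' σ z ^ 2 := by
  have hz : σ / 2 ∈ Icc (-(1 / 2) : ℝ) (1 / 2) := ⟨by linarith, by linarith⟩
  have c2 : Continuous fun z => peak' σ z ^ 2 := (continuous_peak' σ).fun_pow 2
  have h0 : peak σ 0 = 1 := by simp [peak]
  have h1 : peak σ (σ / 2) ≤ 1 / 2 := by
    have := two_mul_sq_le_sin_sq hz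
    rw [show 2 * (σ / 2) = σ by ring] at this
    rw [peak, one_div]
    refine inv_anti₀ (by norm_num) ?_
    have : 1 ≤ Real.sin (Real.pi * (σ / 2)) ^ 2 / σ ^ 2 := (one_le_div₀ (by positivity)).2 this
    linarith
  have h2 := sq_integral_le (a := 0) (b := σ / 2) (by linarith) (continuous_peak' σ)
  rw [intervalIntegral.integral_eq_sub_of_hasDerivAt (fun z _ => hasDerivAt_peak σ z)
    ((continuous_peak' σ).intervalIntegrable _ _), h0, sub_zero] at h2
  have h3 : ∫ z in (0)..(σ / 2), peak' σ z ^ 2 ≤ ∫ z in (-(1 / 2))..(1 / 2), peak' σ z ^ 2 :=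
    intervalIntegral.integral_mono_interval (by norm_num) (by linarith) hz.2
      (Eventually.of_forall fun z => sq_nonneg _) (c2.intervalIntegrable _ _)
  have h4 : 1 / 4 ≤ (peak σ (σ / 2) - 1) ^ 2 := by nlinarith
  rw [div_le_iff₀ (by positivity)]
  nlinarith

theorem isProfile_peak {K s : ℝ} (hK : 10 ^ 6 ≤ K) (hs : 0 < s) (hs1 : s ≤ 1 / 10) :
    IsProfile K s fun z => peak (10 * s) z
      * (√(∫ z in (-(1 / 2))..(1 / 2), peak' (10 * s) z ^ 2))⁻¹ := by
  have hpi := Real.pi_gt_three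
  have hpi4 := Real.pi_lt_d2
  -- After normalisation the squared slope is at most (π²/σ²)·2σ ≤ 20/σ, by π² ≤ 10; the factor 10
  -- turns this into exactly 2/s.
  set σ := 10 * s with hσs
  have hσ : 0 < σ := by positivity
  set D := ∫ z in (-(1 / 2))..(1 / 2), peak' σ z ^ 2
  have hD : 1 / (2 * σ) ≤ D := le_integral_peak'_sq hσ (by linarith)
  have hD0 : 0 < D := lt_of_lt_of_le (by positivity) hD
  have hDi : D⁻¹ ≤ 2 * σ := by
    have := inv_anti₀ (by positivity) hD
    simpa using this
  set κ := (√D)⁻¹ with hκ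
  have hκ0 : 0 < κ := by positivity
  have hκ2 : κ ^ 2 = D⁻¹ := by rw [hκ, inv_pow, Real.sq_sqrt hD0.le]
  have hκ2' : κ ^ 2 ≤ 20 * s := by rw [hκ2]; linarith
  have hκs : κ ≤ 5 * √s := by
    refine le_of_sq_le_sq ?_ (by positivity)
    rw [mul_pow, Real.sq_sqrt hs.le]
    linarith
  have d1 : deriv (fun z => peak σ z * κ) = fun z => peak' σ z * κ :=
    funext fun z => ((hasDerivAt_peak σ z).mul_const κ).deriv
  have d2 : deriv (deriv fun z => peak σ z * κ) = fun z => peak'' σ z * κ := by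
    rw [d1]
    exact funext fun z => ((hasDerivAt_peak' σ z).mul_const κ).deriv
  have hI : (-(1 / 2) : ℝ) ≤ 1 / 2 := by norm_num
  have bI := integral_peak_le hσ
  have bI0 : 0 ≤ ∫ z in (-(1 / 2))..(1 / 2), peak σ z :=
    intervalIntegral.integral_nonneg hI fun z _ => (peak_pos σ z).le
  have cp := continuous_peak σ
  have cp' := continuous_peak' σ
  have cp'' := continuous_peak'' σ
  refine ⟨(contDiff_peak σ).mul contDiff_const, fun z => ?_, fun z => ?_, ?_, fun z => ?_, ?_, ?_,
    ?_⟩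
  · simp only [periodic_peak σ z]
  · exact mul_nonneg (peak_pos σ z).le hκ0.le
  · simp only [d1, mul_pow, intervalIntegral.integral_mul_const, hκ2]
    exact mul_inv_cancel₀ hD0.ne'
  · simp only [d1, mul_pow]
    calc peak' σ z ^ 2 * κ ^ 2 ≤ Real.pi ^ 2 / σ ^ 2 * (20 * s) :=
          mul_le_mul (peak'_sq_le hσ z) hκ2' (sq_nonneg _) (by positivity)
      _ ≤ 10 / σ ^ 2 * (20 * s) := by gcongr; nlinarith
      _ = 2 / s := by rw [hσs]; field_simp; norm_num
  · rw [intervalIntegral.integral_mul_const]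
    have hss : 0 ≤ s * √s := by positivity
    calc _ ≤ 2 * σ * (5 * √s) := mul_le_mul bI hκs hκ0.le (by positivity)
      _ = 100 * (s * √s) := by rw [hσs]; ring
      _ ≤ K * (s * √s) := by gcongr; linarith
  · simp only [mul_pow]
    rw [intervalIntegral.integral_mul_const]
    have b2 : ∫ z in (-(1 / 2))..(1 / 2), peak σ z ^ 2 ≤ ∫ z in (-(1 / 2))..(1 / 2), peak σ z :=
      intervalIntegral.integral_mono_on hI ((cp.fun_pow 2).intervalIntegrable _ _)
        (cp.intervalIntegrable _ _) fun z _ => by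
          have := peak_pos σ z
          have := peak_le_one σ z
          nlinarith
    calc _ ≤ 2 * σ * (20 * s) := mul_le_mul (b2.trans bI) hκ2' (sq_nonneg _) (by positivity)
      _ = 400 * s ^ 2 := by rw [hσs]; ring
      _ ≤ K * s ^ 2 := by gcongr; linarith
  · simp only [d2, mul_pow]
    rw [intervalIntegral.integral_mul_const]
    have b2 : ∫ z in (-(1 / 2))..(1 / 2), peak'' σ z ^ 2
        ≤ (10 * Real.pi ^ 2 / σ ^ 2) ^ 2 * ∫ z in (-(1 / 2))..(1 / 2), peak σ z := by
      rw [← intervalIntegral.integral_const_mul]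
      exact intervalIntegral.integral_mono_on hI ((cp''.fun_pow 2).intervalIntegrable _ _)
        ((continuous_const.mul cp).intervalIntegrable _ _) fun z _ => peak''_sq_le hσ z
    calc _ ≤ ((10 * Real.pi ^ 2 / σ ^ 2) ^ 2 * (2 * σ)) * (20 * s) :=
          mul_le_mul (b2.trans (mul_le_mul_of_nonneg_left bI (sq_nonneg _))) hκ2' (sq_nonneg _)
            (by positivity)
      _ ≤ ((10 * 10 / σ ^ 2) ^ 2 * (2 * σ)) * (20 * s) := by gcongr; nlinarith
      _ = 400 / s ^ 2 := by rw [hσs]; field_simp; norm_num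
      _ ≤ K / s ^ 2 := by gcongr; linarith

end Peak

theorem exists_profile : ∃ K : ℝ, 0 < K ∧ ∀ s : ℝ, 0 < s → s ≤ 1 → ∃ p, IsProfile K s p := by
  refine ⟨10 ^ 6, by norm_num, fun s hs hs1 => ?_⟩
  rcases le_total s (1 / 10) with h | h
  · exact ⟨_, isProfile_peak le_rfl hs h⟩
  · exact ⟨_, isProfile_cos (by norm_num) h hs1⟩

/-! ### Axisymmetric competitors -/

section Axisymmetric

variable {f : ℝ → ℝ}

theorem smoothPer_snd (hf : ContDiff ℝ ∞ f) (hp : Function.Periodic f 1) :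
    SmoothPer fun x : ℝ × ℝ => f x.2 := by
  refine ⟨hf.comp contDiff_snd, fun x => ⟨?_, ?_⟩⟩
  · simp
  · simpa using hp x.2

theorem pd_snd (hf : ContDiff ℝ ∞ f) (i : Fin 2) :
    pd i (fun x : ℝ × ℝ => f x.2) = fun x => deriv f x.2 * (dir i).2 := by
  ext x
  have h1 : HasDerivAt f (deriv f x.2) x.2 :=
    ((hf.differentiable (by simp)) x.2).hasDerivAt
  have h2 := h1.hasFDerivAt.comp x (hasFDerivAt_snd (𝕜 := ℝ) (p := x))
  have e : pd i (fun x : ℝ × ℝ => f x.2) x = _ :=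
    congrArg (fun T : ℝ × ℝ →L[ℝ] ℝ => T (dir i)) h2.fderiv
  rw [e]
  simp [mul_comm]

theorem pd_zero_snd (hf : ContDiff ℝ ∞ f) : pd 0 (fun x : ℝ × ℝ => f x.2) = fun _ => 0 := by
  rw [pd_snd hf]
  simp [dir]

theorem pd_one_snd (hf : ContDiff ℝ ∞ f) :
    pd 1 (fun x : ℝ × ℝ => f x.2) = fun x => deriv f x.2 := by
  rw [pd_snd hf]
  simp [dir]

theorem contDiff_deriv (hf : ContDiff ℝ ∞ f) : ContDiff ℝ ∞ (deriv f) :=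
  (contDiff_infty_iff_deriv.1 hf).2

theorem pd_const (i : Fin 2) (k : ℝ) : pd i (fun _ : ℝ × ℝ => k) = fun _ => 0 := by
  ext x
  simp [pd]

theorem integral_Ω_snd (hf : Continuous f) :
    ∫ x in Ω, f x.2 = 2 * Real.pi * ∫ z in (-(1 / 2))..(1 / 2), f z := by
  rw [integral_Ω (by fun_prop)]
  simp only [intervalIntegral.integral_const, smul_eq_mul, sub_zero]

end Axisymmetric

namespace Conf

/-- The axisymmetric configuration with radial displacement `A + w` and axial displacement `β`. -/
def axisym (A : ℝ) (w β : ℝ → ℝ) : Conf where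
  u x := A + w x.2
  p i := pd i fun x => A + w x.2
  H j i := pd i (pd j fun x => A + w x.2)
  a _ := 0
  ga i := pd i fun _ => 0
  b x := β x.2
  gb i := pd i fun x => β x.2

variable {A lam h : ℝ} {w β : ℝ → ℝ} {m : ℝ≥0∞}

theorem axisym_p_zero (hw : ContDiff ℝ ∞ w) : (axisym A w β).p 0 = fun _ => 0 :=
  pd_zero_snd (f := fun z => A + w z) (contDiff_const.add hw)

theorem axisym_p_one (hw : ContDiff ℝ ∞ w) : (axisym A w β).p 1 = fun x => deriv w x.2 := by
  have := pd_one_snd (f := fun z => A + w z) (contDiff_const.add hw)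
  simp only [deriv_const_add'] at this
  exact this

theorem axisym_H_zero (hw : ContDiff ℝ ∞ w) (i : Fin 2) :
    (axisym A w β).H 0 i = fun _ => 0 := by
  have : (axisym A w β).H 0 i = pd i ((axisym A w β).p 0) := rfl
  rw [this, axisym_p_zero hw, pd_const]

theorem axisym_H_one_zero (hw : ContDiff ℝ ∞ w) : (axisym A w β).H 1 0 = fun _ => 0 := by
  have : (axisym A w β).H 1 0 = pd 0 ((axisym A w β).p 1) := rfl
  rw [this, axisym_p_one hw, pd_zero_snd (contDiff_deriv hw)]

theorem axisym_H_one_one (hw : ContDiff ℝ ∞ w) :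
    (axisym A w β).H 1 1 = fun x => deriv (deriv w) x.2 := by
  have : (axisym A w β).H 1 1 = pd 1 ((axisym A w β).p 1) := rfl
  rw [this, axisym_p_one hw, pd_one_snd (contDiff_deriv hw)]

theorem axisym_adm {r : ℝ} (hw : ContDiff ℝ ∞ w) (hwp : Function.Periodic w 1)
    (hw0 : ∀ z, 0 ≤ w z) (hβ : ContDiff ℝ ∞ β) (hβp : Function.Periodic β 1)
    (h1 : ∀ z, ENNReal.ofReal |deriv w z| ≤ m) (h2 : ∀ z, ENNReal.ofReal |deriv β z - lam| ≤ m) :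
    (axisym (r - 1) w β).Adm lam r m := by
  have su : SmoothPer (axisym (r - 1) w β).u :=
    smoothPer_snd (f := fun z => r - 1 + w z) (contDiff_const.add hw) fun z => by simp only [hwp z]
  have s0 : SmoothPer fun _ : ℝ × ℝ => (0 : ℝ) := ⟨contDiff_const, fun _ => ⟨rfl, rfl⟩⟩
  have bound : ∀ (g : ℝ × ℝ → ℝ), (∀ x, ENNReal.ofReal |g x| ≤ m) →
      eLpNorm g ⊤ (volume.restrict Ω) ≤ m := fun g hg => by
    rw [eLpNorm_exponent_top]
    exact essSup_le_of_ae_le _ (Eventually.of_forall fun x => by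
      simpa only [Real.enorm_eq_ofReal_abs] using hg x)
  refine ⟨su.perJet, fun j => (su.pd j).perJet, s0.perJet, (smoothPer_snd hβ hβp).perJet,
    Eventually.of_forall fun x => ?_, fun i => bound _ fun x => ?_, fun i => bound _ fun x => ?_,
    fun i => bound _ fun x => ?_⟩
  · simpa [axisym] using hw0 x.2
  · fin_cases i
    · change ENNReal.ofReal |(axisym (r - 1) w β).p 0 x| ≤ m
      simp [axisym_p_zero hw]
    · change ENNReal.ofReal |(axisym (r - 1) w β).p 1 x| ≤ m
      simpa only [axisym_p_one hw] using h1 x.2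
  · have : (axisym (r - 1) w β).ga i = fun _ => 0 := pd_const i 0
    simp [this]
  · fin_cases i
    · have : (axisym (r - 1) w β).gb 0 = fun _ => 0 := pd_zero_snd hβ
      simp [this]
    · have : (axisym (r - 1) w β).gb 1 = fun x => deriv β x.2 := pd_one_snd hβ
      simpa [this] using h2 x.2

theorem axisym_energy (hw : ContDiff ℝ ∞ w) (hβ : ContDiff ℝ ∞ β) :
    (axisym A w β).E h lam = 2 * Real.pi * A ^ 2
      + 2 * Real.pi * (2 * A * (∫ z in (-(1 / 2))..(1 / 2), w z)
        + (∫ z in (-(1 / 2))..(1 / 2), w z ^ 2)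
        + (∫ z in (-(1 / 2))..(1 / 2), (deriv β z - lam + 1 / 2 * deriv w z ^ 2) ^ 2)
        + h ^ 2 * ∫ z in (-(1 / 2))..(1 / 2), deriv (deriv w) z ^ 2) := by
  have cw := hw.continuous
  have cw' := (contDiff_deriv hw).continuous
  have cw'' := (contDiff_deriv (contDiff_deriv hw)).continuous
  have cβ' := (contDiff_deriv hβ).continuous
  have ea : ∀ i, (axisym A w β).ga i = fun _ => 0 := fun i => pd_const i 0
  have eb0 : (axisym A w β).gb 0 = fun _ => 0 := pd_zero_snd hβ
  have eb1 : (axisym A w β).gb 1 = fun x => deriv β x.2 := pd_one_snd hβ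
  have e1 : ∀ x, (axisym A w β).hoop x = A + w x.2 := fun x => by
    have eu : (axisym A w β).u x = A + w x.2 := rfl
    simp [hoop, ea, axisym_p_zero hw, eu]
  have e2 : ∀ x, (axisym A w β).axial lam x = deriv β x.2 - lam + 1 / 2 * deriv w x.2 ^ 2 :=
    fun x => by simp only [axial, eb1, axisym_p_one hw, pow_two]
  have e3 : ∀ x, (axisym A w β).shear x = 0 := fun x => by
    simp [shear, ea, eb0, axisym_p_zero hw]
  have i1 : ∫ x in Ω, (A + w x.2) ^ 2 = 2 * Real.pi * ∫ z in (-(1 / 2))..(1 / 2), (A + w z) ^ 2 :=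
    integral_Ω_snd (f := fun z => (A + w z) ^ 2) (by fun_prop)
  have i2 : ∫ x in Ω, (deriv β x.2 - lam + 1 / 2 * deriv w x.2 ^ 2) ^ 2 = 2 * Real.pi *
      ∫ z in (-(1 / 2))..(1 / 2), (deriv β z - lam + 1 / 2 * deriv w z ^ 2) ^ 2 :=
    integral_Ω_snd (f := fun z => (deriv β z - lam + 1 / 2 * deriv w z ^ 2) ^ 2) (by fun_prop)
  have i3 : ∫ x in Ω, deriv (deriv w) x.2 ^ 2 = 2 * Real.pi *
      ∫ z in (-(1 / 2))..(1 / 2), deriv (deriv w) z ^ 2 :=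
    integral_Ω_snd (f := fun z => deriv (deriv w) z ^ 2) (by fun_prop)
  have i4 : ∫ z in (-(1 / 2))..(1 / 2), (A + w z) ^ 2 = A ^ 2
      + 2 * A * (∫ z in (-(1 / 2))..(1 / 2), w z) + ∫ z in (-(1 / 2))..(1 / 2), w z ^ 2 := by
    have e : ∀ z, (A + w z) ^ 2 = A ^ 2 + (2 * A * w z + w z ^ 2) := fun z => by ring
    simp only [e]
    rw [intervalIntegral.integral_add (intervalIntegrable_const (μ := volume))
        (Continuous.intervalIntegrable (by fun_prop) _ _),
      intervalIntegral.integral_add (Continuous.intervalIntegrable (by fun_prop) _ _)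
        (Continuous.intervalIntegrable (by fun_prop) _ _),
      intervalIntegral.integral_const_mul, intervalIntegral.integral_const]
    norm_num
    ring
  unfold E
  simp only [e1, e2, e3, axisym_H_zero hw, axisym_H_one_zero hw, axisym_H_one_one hw]
  rw [i1, i2, i3, i4]
  simp only [ne_eq, OfNat.ofNat_ne_zero, not_false_eq_true, zero_pow, integral_zero]
  ring

end Conf

theorem bulkEnergy_eq (r : ℝ) : bulkEnergy r = 2 * Real.pi * (r - 1) ^ 2 := by
  rw [bulkEnergy, volume_Ω]

namespace Conf

variable {lam h r K s : ℝ} {m : ℝ≥0∞} {p : ℝ → ℝ}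

/-- The unwrinkled competitor. -/
theorem exists_unwrinkled (hlam : 0 < lam) (hm : ENNReal.ofReal lam ≤ m) :
    ∃ c : Conf, c.Adm lam r m ∧ c.E h lam ≤ bulkEnergy r + 2 * Real.pi * lam ^ 2 := by
  refine ⟨axisym (r - 1) (fun _ => 0) fun _ => 0, axisym_adm contDiff_const (fun _ => rfl)
    (fun _ => le_rfl) contDiff_const (fun _ => rfl) (fun z => ?_) (fun z => ?_), ?_⟩
  · simp
  · simpa [abs_of_pos hlam] using hm
  · rw [axisym_energy contDiff_const contDiff_const, bulkEnergy_eq]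
    norm_num

theorem integral_comp_natCast_mul {F : ℝ → ℝ} (hF : Continuous F) (hp : Function.Periodic F 1)
    {N : ℕ} (hN : N ≠ 0) :
    ∫ z in (-(1 / 2))..(1 / 2), F (N * z) = ∫ z in (-(1 / 2))..(1 / 2), F z := by
  have hN' : (N : ℝ) ≠ 0 := Nat.cast_ne_zero.2 hN
  have hi : ∀ t₁ t₂, IntervalIntegrable F volume t₁ t₂ := fun _ _ => hF.intervalIntegrable _ _
  have h1 := hp.intervalIntegral_add_zsmul_eq N (N * -(1 / 2)) hi
  have h2 := hp.intervalIntegral_add_eq (N * -(1 / 2)) (-(1 / 2))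
  rw [h2] at h1
  rw [intervalIntegral.integral_comp_mul_left _ hN']
  rw [show (N : ℝ) * (1 / 2) = N * -(1 / 2) + (N : ℤ) • (1 : ℝ) by simp; ring, h1]
  rw [show (-(1 / 2) + 1 : ℝ) = 1 / 2 by norm_num]
  simp [hN']

/-- The wrinkled competitor with `N` wrinkles of relative width `s`. -/
theorem exists_wrinkled (hp : IsProfile K s p) (hlam : 0 < lam) {N : ℕ} (hN : N ≠ 0)
    (hm1 : ∀ z, ENNReal.ofReal |√(2 * lam) * deriv p z| ≤ m)
    (hm2 : ∀ z, ENNReal.ofReal (lam * deriv p z ^ 2) ≤ m) (hr : 1 ≤ r) :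
    ∃ c : Conf, c.Adm lam r m ∧ c.E h lam ≤ bulkEnergy r + 2 * Real.pi * K *
      (2 * (r - 1) * (√(2 * lam) / N) * (s * √s) + 2 * lam / N ^ 2 * s ^ 2
        + h ^ 2 * (2 * lam * N ^ 2) / s ^ 2) := by
  have hN' : (N : ℝ) ≠ 0 := Nat.cast_ne_zero.2 hN
  have hN0 : (0 : ℝ) < N := by positivity
  have hA : 0 ≤ r - 1 := sub_nonneg.2 hr
  set κ := √(2 * lam)
  have hκ2 : κ ^ 2 = 2 * lam := Real.sq_sqrt (by positivity)
  have hκ0 : 0 ≤ κ := Real.sqrt_nonneg _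
  have sp' := contDiff_deriv hp.smooth
  have sp'' := contDiff_deriv sp'
  have hlin : ∀ z : ℝ, HasDerivAt (fun z : ℝ => (N : ℝ) * z) N z := fun z => by
    simpa using (hasDerivAt_id z).const_mul (N : ℝ)
  have dp : ∀ {q : ℝ → ℝ}, ContDiff ℝ ∞ q → ∀ z, HasDerivAt (fun z => q (N * z))
      (deriv q (N * z) * N) z := fun {q} hq z =>
    (((hq.differentiable (by simp)) _).hasDerivAt).comp z (hlin z)
  have per' : Function.Periodic (deriv p) 1 := fun z => by
    have : deriv (fun z => p (z + 1)) z = deriv p (z + 1) := deriv_comp_add_const p 1 z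
    rw [← this]
    congr 1
    exact funext hp.periodic
  have per'' : Function.Periodic (deriv (deriv p)) 1 := fun z => by
    have : deriv (fun z => deriv p (z + 1)) z = deriv (deriv p) (z + 1) :=
      deriv_comp_add_const (deriv p) 1 z
    rw [← this]
    congr 1
    exact funext per'
  have perN : ∀ {q : ℝ → ℝ}, Function.Periodic q 1 → ∀ z, q (N * (z + 1)) = q (N * z) :=
    fun {q} hq z => by
      rw [mul_add]
      exact hq.nat_mul N (N * z)
  set w : ℝ → ℝ := fun z => κ / N * p (N * z)
  have sw : ContDiff ℝ ∞ w := by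
    have := hp.smooth
    simp only [w]
    fun_prop
  have dw : deriv w = fun z => κ * deriv p (N * z) := funext fun z => by
    rw [((dp hp.smooth z).const_mul (κ / N)).deriv]
    field_simp
  have ddw : deriv (deriv w) = fun z => κ * N * deriv (deriv p) (N * z) := by
    rw [dw]
    ext z
    rw [((dp sp' z).const_mul κ).deriv]
    ring
  -- The prescribed derivative of the axial displacement: v − λ + (w')²/2 = 0. Its mean vanishes
  -- because the profile has unit Dirichlet energy, so its primitive β is periodic.
  set v : ℝ → ℝ := fun z => lam - lam * deriv p (N * z) ^ 2
  have sv : ContDiff ℝ ∞ v := by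
    simp only [v]
    fun_prop
  have pv : Function.Periodic v 1 := fun z => by simp only [v, perN per' z]
  set β : ℝ → ℝ := fun z => ∫ t in (0)..z, v t
  have dβ : ∀ z, HasDerivAt β (v z) z := fun z =>
    intervalIntegral.integral_hasDerivAt_right (sv.continuous.intervalIntegrable _ _)
      (sv.continuous.stronglyMeasurableAtFilter _ _) sv.continuous.continuousAt
  have dβ' : deriv β = v := funext fun z => (dβ z).deriv
  have sβ : ContDiff ℝ ∞ β := by
    rw [contDiff_infty_iff_deriv, dβ']
    exact ⟨fun z => (dβ z).differentiableAt, sv⟩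
  have cp' := sp'.continuous
  have iv : ∫ t in (-(1 / 2))..(1 / 2), v t = 0 := by
    simp only [v]
    rw [intervalIntegral.integral_sub (intervalIntegrable_const (μ := volume))
      (Continuous.intervalIntegrable (by fun_prop) _ _), intervalIntegral.integral_const_mul,
      integral_comp_natCast_mul (F := fun z => deriv p z ^ 2) (by fun_prop)
        (fun z => by simp only [per' z]) hN, hp.integral_deriv_sq, intervalIntegral.integral_const]
    norm_num
  have pβ : Function.Periodic β 1 := fun z => by
    have h1 := pv.intervalIntegral_add_eq z (-(1 / 2))
    rw [show (-(1 / 2) + 1 : ℝ) = 1 / 2 by norm_num, iv] at h1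
    have h2 := intervalIntegral.integral_add_adjacent_intervals (μ := volume) (f := v) (a := 0)
      (b := z) (c := z + 1) (sv.continuous.intervalIntegrable _ _)
      (sv.continuous.intervalIntegrable _ _)
    simp only [β]
    rw [← h2, h1, add_zero]
  refine ⟨axisym (r - 1) w β, axisym_adm sw (fun z => ?_) (fun z => ?_) sβ pβ (fun z => ?_)
    (fun z => ?_), ?_⟩
  · simp only [w, perN hp.periodic z]
  · exact mul_nonneg (by positivity) (hp.nonneg _)
  · rw [dw]
    exact hm1 _
  · rw [dβ', show v z - lam = -(lam * deriv p (N * z) ^ 2) by simp only [v]; ring, abs_neg,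
      abs_of_nonneg (by positivity)]
    exact hm2 _
  · have cp := hp.smooth.continuous
    have cp'' := sp''.continuous
    have j1 : ∫ z in (-(1 / 2))..(1 / 2), w z = κ / N * ∫ z in (-(1 / 2))..(1 / 2), p z := by
      rw [intervalIntegral.integral_const_mul, integral_comp_natCast_mul cp hp.periodic hN]
    have j2 : ∫ z in (-(1 / 2))..(1 / 2), w z ^ 2
        = 2 * lam / N ^ 2 * ∫ z in (-(1 / 2))..(1 / 2), p z ^ 2 := by
      simp only [w, mul_pow]
      rw [intervalIntegral.integral_const_mul, integral_comp_natCast_mul (F := fun z => p z ^ 2)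
        (by fun_prop) (fun z => by simp only [hp.periodic z]) hN, div_pow, hκ2]
    have j3 : ∫ z in (-(1 / 2))..(1 / 2), (deriv β z - lam + 1 / 2 * deriv w z ^ 2) ^ 2 = 0 := by
      have e : ∀ z, (deriv β z - lam + 1 / 2 * deriv w z ^ 2) ^ 2 = 0 := fun z => by
        rw [dβ', dw, mul_pow, hκ2]
        simp only [v]
        ring
      simp only [e, intervalIntegral.integral_zero]
    have j4 : ∫ z in (-(1 / 2))..(1 / 2), deriv (deriv w) z ^ 2
        = 2 * lam * N ^ 2 * ∫ z in (-(1 / 2))..(1 / 2), deriv (deriv p) z ^ 2 := by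
      simp only [ddw, mul_pow]
      rw [intervalIntegral.integral_const_mul,
        integral_comp_natCast_mul (F := fun z => deriv (deriv p) z ^ 2)
        (by fun_prop) (fun z => by simp only [per'' z]) hN, hκ2]
    rw [axisym_energy sw sβ, bulkEnergy_eq, j1, j2, j3, j4, mul_assoc (2 * Real.pi) K]
    refine add_le_add le_rfl (mul_le_mul_of_nonneg_left ?_ pi2_pos.le)
    have b1 := mul_le_mul_of_nonneg_left hp.integral_le
      (by positivity : 0 ≤ 2 * (r - 1) * (κ / N))
    have b2 := mul_le_mul_of_nonneg_left hp.integral_sq_le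
      (by positivity : 0 ≤ 2 * lam / (N : ℝ) ^ 2)
    have b3 := mul_le_mul_of_nonneg_left hp.integral_deriv2_sq_le
      (by positivity : 0 ≤ h ^ 2 * (2 * lam * (N : ℝ) ^ 2))
    have e3 : h ^ 2 * (2 * lam * (N : ℝ) ^ 2) * (K / s ^ 2)
        = K * (h ^ 2 * (2 * lam * N ^ 2) / s ^ 2) := by ring
    rw [e3] at b3
    linarith

end Conf

/-! ### Upper bounds -/

/-- From λ ≤ s follows λp'² ≤ 2, hence (√(2λ) p')² ≤ 4. Both slopes are thus at most 2, which is the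
threshold imposed on m. -/
theorem IsProfile.slope_le {lam s : ℝ} {m : ℝ≥0∞} {p : ℝ → ℝ} (hp : IsProfile K s p) (hs : lam ≤ s)
    (hlam : 0 < lam) (hm : ENNReal.ofReal 2 ≤ m) :
    (∀ z, ENNReal.ofReal |√(2 * lam) * deriv p z| ≤ m) ∧
      ∀ z, ENNReal.ofReal (lam * deriv p z ^ 2) ≤ m := by
  have key : ∀ z, lam * deriv p z ^ 2 ≤ 2 := fun z => by
    have hs0 : 0 < s := hlam.trans_le hs
    have := (le_div_iff₀ hs0).1 (hp.deriv_sq_le z)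
    nlinarith [sq_nonneg (deriv p z)]
  refine ⟨fun z => (ENNReal.ofReal_le_ofReal ?_).trans hm,
    fun z => (ENNReal.ofReal_le_ofReal (key z)).trans hm⟩
  refine abs_le_of_sq_le_sq ?_ (by norm_num)
  rw [mul_pow, Real.sq_sqrt (by positivity)]
  linarith [key z]

theorem rpow_mul_rpow_mul_rpow_pow_seven {a b c : ℝ} (ha : 0 < a) (hb : 0 < b) (hc : 0 < c)
    (x y z : ℝ) : (a ^ (x / 7) * b ^ (y / 7) * c ^ (z / 7)) ^ 7 = a ^ x * b ^ y * c ^ z := by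
  rw [mul_pow, mul_pow]
  simp only [← Real.rpow_natCast, ← Real.rpow_mul ha.le, ← Real.rpow_mul hb.le,
    ← Real.rpow_mul hc.le]
  congr 3 <;> push_cast <;> ring

namespace Conf

variable {lam h r K : ℝ} {m : ℝ≥0∞}

/-- A single wrinkle. -/
theorem exists_few (hK0 : 0 < K) (hK : ∀ s : ℝ, 0 < s → s ≤ 1 → ∃ p, IsProfile K s p)
    (hh : 0 < h) (hh1 : h ≤ 1) (hlam : 0 < lam) (hr : 1 < r) (hA : lam ^ 2 * h ≤ (r - 1) ^ 4)
    (hm : m = ⊤ ∨ lam ^ 3 * (r - 1) ≤ h ^ 2 ∧ ENNReal.ofReal 2 ≤ m) :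
    ∃ c : Conf, c.Adm lam r m ∧ c.E h lam ≤ bulkEnergy r + 2 * Real.pi * K *
      (8 * ((r - 1) ^ (4 / 7 : ℝ) * h ^ (6 / 7 : ℝ) * lam ^ (5 / 7 : ℝ))) := by
  set A := r - 1
  have hA0 : 0 < A := sub_pos.2 hr
  set P := A ^ (4 / 7 : ℝ) * h ^ (6 / 7 : ℝ) * lam ^ (5 / 7 : ℝ) with hP
  have hP0 : 0 < P := by positivity
  have hP7 : P ^ 7 = A ^ 4 * h ^ 6 * lam ^ 5 := by
    have := rpow_mul_rpow_mul_rpow_pow_seven hA0 hh hlam 4 6 5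
    rw [← hP] at this
    exact_mod_cast this
  -- This width balances the cost A√λ l^{3/2} of pushing outward against the bending h²λ/l²; both
  -- then equal P.
  set l := h ^ (4 / 7 : ℝ) * lam ^ (1 / 7 : ℝ) * A⁻¹ ^ (2 / 7 : ℝ) with hl
  have hl0 : 0 < l := by positivity
  have hl7 : l ^ 7 * A ^ 2 = h ^ 4 * lam := by
    have := rpow_mul_rpow_mul_rpow_pow_seven hh hlam (inv_pos.2 hA0) 4 1 2
    rw [← hl] at this
    have e : l ^ 7 = h ^ 4 * lam ^ 1 * A⁻¹ ^ 2 := by exact_mod_cast this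
    rw [e]
    field_simp
  have e1 : h ^ 2 * lam / l ^ 2 = P := by
    refine (pow_left_inj₀ (by positivity) hP0.le (n := 7) (by norm_num)).1 ?_
    rw [hP7, div_pow, div_eq_iff (by positivity)]
    calc (h ^ 2 * lam) ^ 7 = (h ^ 6 * lam ^ 5) * (h ^ 4 * lam) ^ 2 := by ring
      _ = A ^ 4 * h ^ 6 * lam ^ 5 * (l ^ 2) ^ 7 := by rw [← hl7]; ring
  have e2 : A * √lam * (l * √l) = P := by
    refine (pow_left_inj₀ (by positivity) hP0.le (n := 2) (by norm_num)).1 ?_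
    rw [← e1, mul_pow, mul_pow, mul_pow, Real.sq_sqrt hlam.le, Real.sq_sqrt hl0.le, div_pow,
      eq_div_iff (by positivity)]
    calc A ^ 2 * lam * (l ^ 2 * l) * (l ^ 2) ^ 2 = (l ^ 7 * A ^ 2) * lam := by ring
      _ = (h ^ 2 * lam) ^ 2 := by rw [hl7]; ring
  -- Here λ²h ≤ A⁴ enters. It makes l ≤ 1 and keeps the quadratic term λl² below P.
  have hlh : l ^ 2 ≤ h := by
    refine le_of_pow_le_pow_left₀ (n := 7) (by norm_num) hh.le ?_
    have h1 : l ^ 14 * (lam ^ 2 * h) ≤ h ^ 7 * (lam ^ 2 * h) := by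
      calc l ^ 14 * (lam ^ 2 * h) ≤ l ^ 14 * A ^ 4 := mul_le_mul_of_nonneg_left hA (by positivity)
        _ = (l ^ 7 * A ^ 2) ^ 2 := by ring
        _ = h ^ 7 * (lam ^ 2 * h) := by rw [hl7]; ring
    have := le_of_mul_le_mul_right h1 (by positivity)
    linarith [show (l ^ 2) ^ 7 = l ^ 14 by ring]
  have hl1 : l ≤ 1 := by nlinarith
  have e3 : lam * l ^ 2 ≤ P := by
    rw [← e1, le_div_iff₀ (by positivity)]
    have : l ^ 2 * l ^ 2 ≤ h * h := mul_le_mul hlh hlh (sq_nonneg _) hh.le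
    nlinarith
  obtain ⟨p, hp⟩ := hK l hl0 hl1
  have slopes : (∀ z, ENNReal.ofReal |√(2 * lam) * deriv p z| ≤ m) ∧
      ∀ z, ENNReal.ofReal (lam * deriv p z ^ 2) ≤ m := by
    rcases hm with rfl | ⟨h1, h2⟩
    · exact ⟨fun _ => le_top, fun _ => le_top⟩
    · refine IsProfile.slope_le hp ?_ hlam h2
      -- The width is at least λ because λ³A ≤ h², squared, reads λ⁷A² ≤ h⁴λ after multiplication by
      -- λ.
      refine le_of_pow_le_pow_left₀ (n := 7) (by norm_num) hl0.le ?_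
      have h3 : (lam ^ 3 * A) ^ 2 ≤ (h ^ 2) ^ 2 := pow_le_pow_left₀ (by positivity) h1 2
      refine le_of_mul_le_mul_right ?_ (by positivity : 0 < A ^ 2)
      rw [hl7]
      nlinarith
  obtain ⟨c, hc, hE⟩ := exists_wrinkled (h := h) hp hlam one_ne_zero slopes.1 slopes.2 hr.le
  refine ⟨c, hc, hE.trans (add_le_add le_rfl (mul_le_mul_of_nonneg_left ?_ (by positivity)))⟩
  have hs2 : √(2 * lam) ≤ 2 * √lam := by
    rw [Real.sqrt_mul (by norm_num)]
    refine mul_le_mul_of_nonneg_right ?_ (Real.sqrt_nonneg _)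
    rw [Real.sqrt_le_left (by norm_num)]
    norm_num
  have t1 : 2 * A * √(2 * lam) * (l * √l) ≤ 4 * P := by
    calc 2 * A * √(2 * lam) * (l * √l) ≤ 2 * A * (2 * √lam) * (l * √l) := by gcongr
      _ = 4 * (A * √lam * (l * √l)) := by ring
      _ = 4 * P := by rw [e2]
  have t3 : h ^ 2 * (2 * lam) / l ^ 2 = 2 * P := by rw [← e1]; ring
  simp only [Nat.cast_one, one_pow, mul_one, div_one]
  rw [t3]
  linarith

/-- Many wrinkles with slopes of order one. -/
theorem exists_many (hK0 : 0 < K) (hK : ∀ s : ℝ, 0 < s → s ≤ 1 → ∃ p, IsProfile K s p)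
    (hh : 0 < h) (hlam : 0 < lam) (hlam1 : lam ≤ 1) (hr : 1 < r) (hA : h ≤ (r - 1) ^ 2)
    (hm : h ^ 2 ≤ lam ^ 3 * (r - 1)) (hm' : ENNReal.ofReal 2 ≤ m) :
    ∃ c : Conf, c.Adm lam r m ∧ c.E h lam ≤ bulkEnergy r + 2 * Real.pi * K *
      (18 * ((r - 1) ^ (2 / 3 : ℝ) * h ^ (2 / 3 : ℝ) * lam)) := by
  set A := r - 1
  have hA0 : 0 < A := sub_pos.2 hr
  set k := A ^ (2 / 3 : ℝ) * h ^ (2 / 3 : ℝ) with hk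
  have hk0 : 0 < k := by positivity
  have hk3 : k ^ 3 = A ^ 2 * h ^ 2 := by
    rw [hk, mul_pow]
    simp only [← Real.rpow_natCast, ← Real.rpow_mul hA0.le, ← Real.rpow_mul hh.le]
    norm_num
  -- l = h^{2/3}A^{-1/3} is the actual width of one wrinkle; it satisfies A l = h²/l², which
  -- balances pushing and bending.
  set l := k / A
  have hl0 : 0 < l := by positivity
  have hlA : A * l = k := mul_div_cancel₀ _ hA0.ne'
  have hl3 : l ^ 3 * A = h ^ 2 := by
    have : (A * l) ^ 3 = A ^ 2 * h ^ 2 := by rw [hlA, hk3]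
    have e : A ^ 2 * (l ^ 3 * A) = A ^ 2 * h ^ 2 := by linarith
    exact mul_left_cancel₀ (by positivity) e
  have hllam : l ≤ lam := by
    refine le_of_pow_le_pow_left₀ (n := 3) (by norm_num) hlam.le ?_
    refine le_of_mul_le_mul_right ?_ hA0
    rw [hl3]
    exact hm
  -- Keeps the quadratic term λl² below the linear one λAl.
  have hlA' : l ≤ A := by
    refine le_of_pow_le_pow_left₀ (n := 3) (by norm_num) hA0.le ?_
    refine le_of_mul_le_mul_right ?_ hA0
    rw [hl3]
    nlinarith
  -- Each wrinkle has actual width λ/N, which lies between l and 2l after rounding.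
  set N := ⌊lam / l⌋₊
  have hN1 : 1 ≤ N := Nat.one_le_floor_iff _ |>.2 ((one_le_div hl0).2 hllam)
  have hN1' : (1 : ℝ) ≤ N := by exact_mod_cast hN1
  have hN0 : (0 : ℝ) < N := by linarith
  have hNle : N * l ≤ lam := (le_div_iff₀ hl0).1 (Nat.floor_le (by positivity))
  have hNge : lam ≤ 2 * N * l := by
    have := (div_lt_iff₀ hl0).1 (Nat.lt_floor_add_one (lam / l))
    nlinarith
  -- Relative width λ is the smallest one for which `IsProfile.slope_le` applies.
  obtain ⟨p, hp⟩ := hK lam hlam hlam1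
  obtain ⟨h1, h2⟩ := IsProfile.slope_le hp le_rfl hlam hm'
  obtain ⟨c, hc, hE⟩ := exists_wrinkled (h := h) hp hlam (N := N) (by omega) h1 h2 hr.le
  refine ⟨c, hc, hE.trans (add_le_add le_rfl (mul_le_mul_of_nonneg_left ?_ (by positivity)))⟩
  have hs2 : √(2 * lam) * √lam ≤ 2 * lam := by
    rw [← Real.sqrt_mul (by positivity), Real.sqrt_le_left (by positivity)]
    nlinarith
  have hdiv : lam / N ≤ 2 * l := by
    rw [div_le_iff₀ hN0]; linarith
  have t1 : 2 * A * (√(2 * lam) / N) * (lam * √lam) ≤ 8 * (k * lam) := by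
    calc 2 * A * (√(2 * lam) / N) * (lam * √lam) = 2 * A * (√(2 * lam) * √lam) * (lam / N) := by
          ring
      _ ≤ 2 * A * (2 * lam) * (2 * l) := by gcongr
      _ = 8 * (k * lam) := by rw [← hlA]; ring
  have t2 : 2 * lam / N ^ 2 * lam ^ 2 ≤ 8 * (k * lam) := by
    calc 2 * lam / N ^ 2 * lam ^ 2 = 2 * lam * (lam / N) ^ 2 := by ring
      _ ≤ 2 * lam * (2 * l) ^ 2 := by gcongr
      _ = 8 * lam * (l * l) := by ring
      _ ≤ 8 * lam * (A * l) := by gcongr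
      _ = 8 * (k * lam) := by rw [hlA]; ring
  have t3 : h ^ 2 * (2 * lam * N ^ 2) / lam ^ 2 ≤ 2 * (k * lam) := by
    rw [div_le_iff₀ (by positivity)]
    calc h ^ 2 * (2 * lam * N ^ 2) = 2 * (A * l) * lam * (N * l) ^ 2 := by rw [← hl3]; ring
      _ ≤ 2 * (A * l) * lam * lam ^ 2 := by gcongr
      _ = _ := by rw [hlA]; ring
  linarith

end Conf

/-! ### Assembly of the scaling laws -/

theorem rpow_half_mul_rpow_quarter_pow_four {a b : ℝ} (ha : 0 < a) (hb : 0 < b) :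
    (a ^ (1 / 2 : ℝ) * b ^ (1 / 4 : ℝ)) ^ 4 = a ^ 2 * b := by
  rw [mul_pow]
  simp only [← Real.rpow_natCast, ← Real.rpow_mul ha.le, ← Real.rpow_mul hb.le]
  norm_num

theorem rpow_half_mul_rpow_half_sq {a b : ℝ} (ha : 0 < a) (hb : 0 < b) :
    (a ^ (1 / 2 : ℝ) * b ^ (1 / 2 : ℝ)) ^ 2 = a * b := by
  rw [mul_pow]
  simp only [← Real.rpow_natCast, ← Real.rpow_mul ha.le, ← Real.rpow_mul hb.le]
  norm_num

/-- The scaling law under a finite slope bound. -/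
theorem scaling_finite {K m h lam r : ℝ} (hK0 : 0 < K)
    (hK : ∀ s : ℝ, 0 < s → s ≤ 1 → ∃ p, IsProfile K s p) (hm : 2 ≤ m) (hh : 0 < h)
    (hh1 : h ≤ 1 / 2) (hlam : 0 < lam) (hlam1 : lam ≤ 1 / 2)
    (hmin : min (lam ^ (1 / 2 : ℝ) * h ^ (1 / 4 : ℝ)) (m ^ (1 / 2 : ℝ) * h ^ (1 / 2 : ℝ)) ≤ r - 1)
    {S : ℝ} (hS : S = min (lam ^ 2)
      (max ((r - 1) ^ (4 / 7 : ℝ) * h ^ (6 / 7 : ℝ) * lam ^ (5 / 7 : ℝ))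
        ((r - 1) ^ (2 / 3 : ℝ) * h ^ (2 / 3 : ℝ) * lam))) :
    ∃ E : ℝ≥0, IsLeast (Displacement.energy h '' admissible lam r (ENNReal.ofReal m)) (E : ℝ≥0∞) ∧
      bulkEnergy r + 1 / m * S ≤ E ∧
      (E : ℝ) ≤ bulkEnergy r + (2 * Real.pi * (1 + K * 18)) * S := by
  have hm0 : 0 < m := by linarith
  have hA0 : 0 < r - 1 := lt_of_lt_of_le (lt_min (by positivity) (by positivity)) hmin
  have hr : 1 < r := sub_pos.1 hA0
  have hm2 : ENNReal.ofReal 2 ≤ ENNReal.ofReal m := ENNReal.ofReal_le_ofReal hm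
  have hP0 : 0 < (r - 1) ^ (4 / 7 : ℝ) * h ^ (6 / 7 : ℝ) * lam ^ (5 / 7 : ℝ) := by positivity
  have hQ0 : 0 < (r - 1) ^ (2 / 3 : ℝ) * h ^ (2 / 3 : ℝ) * lam := by positivity
  have hpi := Real.pi_pos
  -- The two alternatives in the minimum. The competitors need one each, and within its regime each
  -- follows from either alternative.
  have hc : lam ^ 2 * h ≤ (r - 1) ^ 4 ∨ h ≤ (r - 1) ^ 2 := by
    rcases min_le_iff.1 hmin with h1 | h1
    · left
      rw [← rpow_half_mul_rpow_quarter_pow_four hlam hh]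
      exact pow_le_pow_left₀ (by positivity) h1 4
    · right
      have := pow_le_pow_left₀ (by positivity) h1 2
      rw [rpow_half_mul_rpow_half_sq hm0 hh] at this
      nlinarith
  set A := r - 1
  set P := A ^ (4 / 7 : ℝ) * h ^ (6 / 7 : ℝ) * lam ^ (5 / 7 : ℝ)
  set Q := A ^ (2 / 3 : ℝ) * h ^ (2 / 3 : ℝ) * lam
  have hS0 : 0 ≤ S := hS ▸ le_min (sq_nonneg _) (hP0.le.trans (le_max_left _ _))
  have hSl : S ≤ lam ^ 2 := hS ▸ min_le_left _ _
  have hSm : S ≤ max P Q := hS ▸ min_le_right _ _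
  refine Conf.exists_isLeast_energy hh hr.le (fun c hadm h2 => ?_) ?_
  -- S lies below one of the two scalings, and the corresponding lower bound applies to every
  -- configuration.
  · rcases le_max_iff.1 hSm with h3 | h3
    · have h4 := hadm.lower_few h2 hr hh hlam hS0 hSl h3
      have h5 : 1 / m * S ≤ S := mul_le_of_le_one_left hS0 ((div_le_one hm0).2 (by linarith))
      linarith
    · have h4 := hadm.lower_many h2 hm hr hh hlam hS0 hSl h3
      rw [one_div_mul_eq_div]
      linarith
  · have up : ∀ {T C : ℝ}, T ≤ S → 0 ≤ C → C ≤ 2 * Real.pi * (1 + K * 18) →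
        (∃ c : Conf, c.Adm lam r (ENNReal.ofReal m) ∧ c.E h lam ≤ bulkEnergy r + C * T) →
        ∃ c : Conf, c.Adm lam r (ENNReal.ofReal m) ∧
          c.E h lam ≤ bulkEnergy r + 2 * Real.pi * (1 + K * 18) * S := by
      rintro T C hT hC hC' ⟨c, hc1, hc2⟩
      refine ⟨c, hc1, hc2.trans (add_le_add le_rfl ?_)⟩
      exact (mul_le_mul_of_nonneg_left hT hC).trans (mul_le_mul_of_nonneg_right hC' hS0)
    rcases le_total (lam ^ 2) (max P Q) with h3 | h3
    · rw [min_eq_left h3] at hS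
      refine up hS.ge pi2_pos.le (by nlinarith [mul_pos hpi hK0])
        (Conf.exists_unwrinkled hlam (ENNReal.ofReal_le_ofReal (by linarith)))
    · rw [min_eq_right h3] at hS
      -- The crossover: λ³A ≤ h² says that the optimal single wrinkle respects the slope bound; the
      -- reverse inequality says that at least one wrinkle of width l fits into a total width λ.
      rcases le_total (lam ^ 3 * A) (h ^ 2) with h4 | h4
      · have hA4 : lam ^ 2 * h ≤ A ^ 4 := by
          rcases hc with h5 | h5
          · exact h5
          · have h6 : lam ^ 2 ≤ h := by
              refine le_of_pow_le_pow_left₀ (n := 3) (by norm_num) hh.le ?_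
              refine le_of_mul_le_mul_right ?_ hh
              calc (lam ^ 2) ^ 3 * h ≤ (lam ^ 2) ^ 3 * A ^ 2 := by gcongr
                _ = (lam ^ 3 * A) ^ 2 := by ring
                _ ≤ (h ^ 2) ^ 2 := by gcongr
                _ = h ^ 3 * h := by ring
            calc lam ^ 2 * h ≤ h * h := by gcongr
              _ ≤ A ^ 2 * A ^ 2 := by gcongr
              _ = A ^ 4 := by ring
        obtain ⟨c, hc1, hc2⟩ := Conf.exists_few hK0 hK hh (by linarith) hlam hr hA4
          (Or.inr ⟨h4, hm2⟩)
        refine up (T := P) (C := 2 * Real.pi * K * 8) (hS ▸ le_max_left _ _) (by positivity)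
          (by nlinarith [mul_pos hpi hK0]) ⟨c, hc1, hc2.trans_eq (by ring)⟩
      · have hA2 : h ≤ A ^ 2 := by
          rcases hc with h5 | h5
          · refine le_of_pow_le_pow_left₀ (n := 7) (by norm_num) (by positivity) ?_
            calc h ^ 7 = (h ^ 2) ^ 2 * h ^ 3 := by ring
              _ ≤ (lam ^ 3 * A) ^ 2 * h ^ 3 := by gcongr
              _ = A ^ 2 * (lam ^ 2 * h) ^ 3 := by ring
              _ ≤ A ^ 2 * (A ^ 4) ^ 3 := by gcongr
              _ = (A ^ 2) ^ 7 := by ring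
          · exact h5
        obtain ⟨c, hc1, hc2⟩ := Conf.exists_many hK0 hK hh hlam (by linarith) hr hA2 h4 hm2
        refine up (T := Q) (C := 2 * Real.pi * K * 18) (hS ▸ le_max_right _ _) (by positivity)
          (by nlinarith [mul_pos hpi hK0]) ⟨c, hc1, hc2.trans_eq (by ring)⟩

/-- The scaling law without slope bound. -/
theorem scaling_infinite {K h lam r : ℝ} (hK0 : 0 < K)
    (hK : ∀ s : ℝ, 0 < s → s ≤ 1 → ∃ p, IsProfile K s p) (hh : 0 < h)
    (hh1 : h ≤ 1 / 2) (hlam : 0 < lam)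
    (hA : lam ^ (1 / 2 : ℝ) * h ^ (1 / 4 : ℝ) ≤ r - 1)
    {S : ℝ} (hS : S = min (lam ^ 2)
      ((r - 1) ^ (4 / 7 : ℝ) * h ^ (6 / 7 : ℝ) * lam ^ (5 / 7 : ℝ))) :
    ∃ E : ℝ≥0, IsLeast (Displacement.energy h '' admissible lam r ⊤) (E : ℝ≥0∞) ∧
      bulkEnergy r + S ≤ E ∧ (E : ℝ) ≤ bulkEnergy r + (2 * Real.pi * (1 + K * 8)) * S := by
  have hA0 : 0 < r - 1 := lt_of_lt_of_le (by positivity) hA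
  have hr : 1 < r := sub_pos.1 hA0
  have hP0 : 0 < (r - 1) ^ (4 / 7 : ℝ) * h ^ (6 / 7 : ℝ) * lam ^ (5 / 7 : ℝ) := by positivity
  have hA4 : lam ^ 2 * h ≤ (r - 1) ^ 4 := by
    rw [← rpow_half_mul_rpow_quarter_pow_four hlam hh]
    exact pow_le_pow_left₀ (by positivity) hA 4
  set P := (r - 1) ^ (4 / 7 : ℝ) * h ^ (6 / 7 : ℝ) * lam ^ (5 / 7 : ℝ)
  have hS0 : 0 ≤ S := hS ▸ le_min (sq_nonneg _) hP0.le
  have hSl : S ≤ lam ^ 2 := hS ▸ min_le_left _ _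
  have hSP : S ≤ P := hS ▸ min_le_right _ _
  have hpS : 0 ≤ 2 * Real.pi * S := mul_nonneg pi2_pos.le hS0
  have hpK : 0 ≤ 2 * Real.pi * S * K := mul_nonneg hpS hK0.le
  refine Conf.exists_isLeast_energy hh hr.le (fun c hadm h2 => ?_) ?_
  · linarith [hadm.lower_few h2 hr hh hlam hS0 hSl hSP]
  · rcases le_total (lam ^ 2) P with h3 | h3
    · obtain ⟨c, hc1, hc2⟩ := Conf.exists_unwrinkled (h := h) (r := r) (m := ⊤) hlam le_top
      rw [min_eq_left h3] at hS
      rw [← hS] at hc2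
      exact ⟨c, hc1, by linarith⟩
    · obtain ⟨c, hc1, hc2⟩ := Conf.exists_few (m := ⊤) hK0 hK hh (by linarith) hlam hr hA4
        (Or.inl rfl)
      rw [min_eq_right h3] at hS
      change _ ≤ _ + _ * (8 * P) at hc2
      rw [← hS] at hc2
      exact ⟨c, hc1, by linarith⟩

end VKD

end

theorem theorem1p1 :
    (∀ m : ℝ, 2 ≤ m → ∃ c C : ℝ, 0 < c ∧ 0 < C ∧
      ∀ h lam r : ℝ, 0 < h → h ≤ 1 / 2 → 0 < lam → lam ≤ 1 / 2 → 1 ≤ r →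
        min (lam ^ (1 / 2 : ℝ) * h ^ (1 / 4 : ℝ)) (m ^ (1 / 2 : ℝ) * h ^ (1 / 2 : ℝ)) ≤ r - 1 →
        ∃ E : ℝ≥0,
          IsLeast (VKD.Displacement.energy h '' VKD.admissible lam r (ENNReal.ofReal m))
            (E : ℝ≥0∞) ∧
          c * min (lam ^ 2)
              (max ((r - 1) ^ (4 / 7 : ℝ) * h ^ (6 / 7 : ℝ) * lam ^ (5 / 7 : ℝ))
                ((r - 1) ^ (2 / 3 : ℝ) * h ^ (2 / 3 : ℝ) * lam))
            ≤ (E : ℝ) - VKD.bulkEnergy r ∧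
          (E : ℝ) - VKD.bulkEnergy r
            ≤ C * min (lam ^ 2)
              (max ((r - 1) ^ (4 / 7 : ℝ) * h ^ (6 / 7 : ℝ) * lam ^ (5 / 7 : ℝ))
                ((r - 1) ^ (2 / 3 : ℝ) * h ^ (2 / 3 : ℝ) * lam))) ∧
    (∃ c C : ℝ, 0 < c ∧ 0 < C ∧
      ∀ h lam r : ℝ, 0 < h → h ≤ 1 / 2 → 0 < lam → lam ≤ 1 / 2 → 1 ≤ r →
        lam ^ (1 / 2 : ℝ) * h ^ (1 / 4 : ℝ) ≤ r - 1 →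
        ∃ E : ℝ≥0,
          IsLeast (VKD.Displacement.energy h '' VKD.admissible lam r ∞) (E : ℝ≥0∞) ∧
          c * min (lam ^ 2) ((r - 1) ^ (4 / 7 : ℝ) * h ^ (6 / 7 : ℝ) * lam ^ (5 / 7 : ℝ))
            ≤ (E : ℝ) - VKD.bulkEnergy r ∧
          (E : ℝ) - VKD.bulkEnergy r
            ≤ C * min (lam ^ 2)
              ((r - 1) ^ (4 / 7 : ℝ) * h ^ (6 / 7 : ℝ) * lam ^ (5 / 7 : ℝ))) := by
  obtain ⟨K, hK0, hK⟩ := VKD.exists_profile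
  have hpi := Real.pi_pos
  refine ⟨fun m hm => ⟨1 / m, 2 * Real.pi * (1 + K * 18), by positivity, by positivity,
    fun h lam r hh hh1 hlam hlam1 _ hmin => ?_⟩, 1, 2 * Real.pi * (1 + K * 8), one_pos,
    by positivity, fun h lam r hh hh1 hlam _ _ hA => ?_⟩
  · obtain ⟨E, hE, h1, h2⟩ := VKD.scaling_finite hK0 hK hm hh hh1 hlam hlam1 hmin rfl
    exact ⟨E, hE, le_sub_iff_add_le'.2 h1, sub_le_iff_le_add'.2 h2⟩
  · obtain ⟨E, hE, h1, h2⟩ := VKD.scaling_infinite hK0 hK hh hh1 hlam hA rfl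
    exact ⟨E, hE, le_sub_iff_add_le'.2 (by rwa [one_mul]), sub_le_iff_le_add'.2 h2⟩
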